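/- **Setting.** Let $\Sigma=[-1,1]^2$, and for an integer $M\ge 3$ let $\mathrm{Hyp}^M$ be the set of $\phi\in C^M(2\Sigma)$ with $\phi(0)=0$, $\nabla\phi(0)=0$, $D^2\phi(0)=\begin{pmatrix}0&1\\1&0\end{pmatrix}$ and $|\partial_x^a\partial_y^b\phi|\le 10^{-5}$ on $2\Sigma$ for $3\le a+b\le M$. Put $$\mathcal E_\phi f(\xi)=\int f(x,y)\,e^{-i(\xi_1x+\xi_2y+\xi_3\phi(x,y))}\,dx\,dy ,\qquad \xi\in\mathbb R^3,$$ where functions on $\Sigma$ are extended by $0$. Let $H=\phi_{xy}^2-\phi_{xx}\phi_{yy}$, $A=\phi_{yy}/(\phi_{xy}+\sqrt H)$, $B=\phi_{xx}/(\phi_{xy}+\sqrt H)$. **Caps.** Let $K\in\mathbb N$, $\mu\ge1$. A family of caps is a finite family of axis-parallel squares $\tau$ of side $\mu^{1/2}K^{-1}$, intersected with $\Sigma$, which cover $\Sigma$ and whose centres $z^c_\tau\in\Sigma$ are $K^{-1}$-separated. With $t^1_z(z_1,z_2)=\phi_x(z_2)-\phi_x(z_1)-B(z)(\phi_y(z_2)-\phi_y(z_1))$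 and $t^2_z(z_1,z_2)=\phi_y(z_2)-\phi_y(z_1)-A(z)(\phi_x(z_2)-\phi_x(z_1))$, two caps $\tau_1\ne\tau_2$ with centres $z_1,z_2$ are strongly separated if $\max_{i=1,2}\min\{|t^1_{z_i}(z_1,z_2)|,|t^2_{z_i}(z_1,z_2)|\}\ge 50\mu^{1/2}K^{-1}$. **The family $\overline{\mathcal L}$.** Let $C,C',\varepsilon'>0$, $r=\mu^{1/2}K^{-3/4}$. For $k,j\in\mathbb Z$ let $A_k=kCr$, let $\omega_k,\omega_k^\perp$ be the unit vectors in the directions $(-A_k,1)$ and $(1,A_k)$, $R^k=\{z\in\Sigma:|A(z)-A_k|<Cr\}$, $S_{k,j}=[(j-1)C'r,(j+1)C'r]\,\omega_k^\perp+\mathbb R\omega_k$, $S^0_{k,j}=\{z\in S_{k,j}:(z+\mathbb R\omega_k^\perp)\cap S_{k,j}\cap R^k\ne\emptyset\}$ and $S^1_{k,j}=S^0_{k,j}+[-r,r]\omega_k$. The connected components of $S^1_{k,j}$ are rectangles. Chop each of them, in the direction $\omega_k$, into the least possible number of equally long pieces of length at most $\frac12K^{-\varepsilon'}$, and prolong each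 (closed) piece by $r$ at both ends. $\mathcal L_1$ is the set of all resulting rectangles; $\mathcal L_2$ is obtained in the same way with the two coordinates interchanged and $B$ in place of $A$; $\mathcal L_3$ consists of the axis-parallel squares of side $c=C\mu^{1/2}K^{-1/4}$ which meet $\Sigma$ and have centre in $\frac c2\mathbb Z^2$. Finally $\overline{\mathcal L}$ is the set of all finite intersections $L_1\cap\dots\cap L_m$, $m\ge1$, of members of $\mathcal L_1\cup\mathcal L_2\cup\mathcal L_3$. A number $\bar N\in\mathbb N$ is called an *overlap constant* for $(C,C')$ if, for all $\phi\in\mathrm{Hyp}^3$, $K,\mu\ge1$ and $\varepsilon'>0$ with $2r<\frac12K^{-\varepsilon'}$, each point of $\Sigma$ lies in at most $\bar N$ members of $\overline{\mathcal L}$. **Broad part and bilinear expression.** For a family $g=(g_\tau)$ of functions indexed by the caps, write also $g=\sum_\tau g_\tau$, and $g_\Delta=\sum_{\tau\subset\Delta}g_\tau$. Set $\mathrm{Br}_\alpha\mathcal E_\phi g(\xi)=|\mathcal E_\phi g(\xi)|$ if $|\mathcal E_\phi g_\Delta(\xi)|\le\alpha|\mathcal E_\phi g(\xi)|$ for all $\Delta\in\overline{\mathcal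 L}$, and $\mathrm{Br}_\alpha\mathcal E_\phi g(\xi)=0$ otherwise. Let $\mathrm{Bil}(\mathcal E_\phi g)(\xi)$ be the maximum of $|\mathcal E_\phi g_{\tau_1}(\xi)|^{1/2}|\mathcal E_\phi g_{\tau_2}(\xi)|^{1/2}$ over all pairs of strongly separated caps ($0$ if there are none). **Tubes and wave packets.** Let $R\ge1$, $\delta>0$, $B_R=[-R,R]^3$. Decompose $\Sigma$ into axis-parallel squares $\theta$ of side $R^{-1/2}$ with pairwise disjoint interiors and centres $\omega_\theta\in\Sigma$, and let $\nu(\theta)$ be the unit normal of the graph of $\phi$ in the direction $(\nabla\phi(\omega_\theta),-1)$. For each $\theta$ let $\mathbb T(\theta)$ be a set of tubes of direction $\nu(\theta)$, radius $R^{1/2+\delta}$ and length $4R$ which meet $B_R$ and whose centres lie in $\nu(\theta)^\perp$ and are $R^{1/2}$-separated, such that the coaxial tubes of radius $R^{1/2}$ cover $B_R$; let $\mathbb T=\bigcup_\theta\mathbb T(\theta)$, and $\nu(T)=\nu(\theta)$ for $T\in\mathbb T(\theta)$. A *wave packet decomposition* of $h\in L^2(\Sigma)$ is a family of $L^2$ functions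 $(h_T)_{T\in\mathbb T}$ such that, for $T\in\mathbb T(\theta)$: (a) $\mathrm{supp}\,h_T\subset3\theta$; (b) $|\mathcal E_\phi h_T|\le R^{-1000}\|h\|_2$ on $B_R\setminus T$; (c) $|\mathcal E_\phi h-\sum_{T\in\mathbb T}\mathcal E_\phi h_T|\le R^{-1000}\|h\|_2$ on $B_R$; (d) $|\int h_{T_1}\overline{h_{T_2}}|\le R^{-1000}\int_{3\theta}|h|^2$ for disjoint $T_1,T_2\in\mathbb T(\theta)$; (e) $\sum_{T\in\mathbb T(\theta)}\int_\Sigma|h_T|^2\le C_w\int_{3\theta}|h|^2$ with a constant $C_w$. **Tangential and transversal parts.** Let $P$ be a real polynomial on $\mathbb R^3$, $Z(P)$ its zero set, $W$ the $R^{1/2+\delta}$-neighbourhood of $Z(P)$, and $B_j$ a ball of radius $R^{1-\delta}$. Let $\mathbb T_{j,tang}$ be the set of $T\in\mathbb T$ with $T\cap W\cap B_j\ne\emptyset$ and $\mathrm{angle}(\nu(T),T_\zeta Z(P))\le R^{-1/2+2\delta}$ for every $\zeta\in Z(P)\cap2B_j\cap10T$ with $\nabla P(\zeta)\ne0$; let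 $\mathbb T_{j,trans}$ be the set of $T\in\mathbb T$ with $T\cap W\cap B_j\neq\emptyset$ for which this angle is $>R^{-1/2+2\delta}$ for some such $\zeta$. Given $f=\sum_\tau f_\tau$ with $f_\tau\in L^2$, $\mathrm{supp}f_\tau\subset\tau$, and a wave packet decomposition $(f_{\tau,T})_T$ of each $f_\tau$, put $f_{\tau,j,tang}=\sum_{T\in\mathbb T_{j,tang}}f_{\tau,T}$, $f_{\tau,j,trans}=\sum_{T\in\mathbb T_{j,trans}}f_{\tau,T}$, $f_{j,tang}=\sum_\tau f_{\tau,j,tang}$, and $f_{I,j,trans}=\sum_{\tau\in I}f_{\tau,j,trans}$ for a set $I$ of caps (with the $\tau$-component $0$ for $\tau\notin I$). **Lemma.** For all sufficiently large absolute constants $C$, and then all $C'\ge C_0'(C)$, overlap constants exist, and for each overlap constant $\bar N$ the following holds. Let $0<\varepsilon<10^{-10}$, $\delta=\varepsilon^2$, and let $\varepsilon'>0$ and $M\in\mathbb N$ be such that $10\bar N\varepsilon'=\varepsilon^8$ and $\frac3{4M}\le\varepsilon'\le\frac3{2M}$. There is $K_0$, depending only on $C,C',\bar N,\varepsilon,\varepsilon',M$,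 such that for all integers $K\ge K_0$, all $\phi\in\mathrm{Hyp}^M$, all $\mu\ge1$, all $\alpha$ with $\alpha\ge K^{-\varepsilon}$, $\alpha\mu\le K^{-\varepsilon/2}$ and $\alpha\mu\le10^{-5}$, all $R\ge1000\,e^{K^{e^{\varepsilon^{-1000}}}}$, all $C_w$, and all caps, functions, tubes, wave packet decompositions, $P$ and $B_j$ as above: if $\xi\in B_R\cap B_j\cap W$, then $$\mathrm{Br}_\alpha\mathcal E_\phi f(\xi)\le2\Big(\sum_I\mathrm{Br}_{K^{4\bar N\varepsilon'}\alpha}\mathcal E_\phi f_{I,j,trans}(\xi)+K^{100}\,\mathrm{Bil}(\mathcal E_\phi f_{j,tang})(\xi)+R^{-900}\sum_\tau\|f_\tau\|_2\Big),$$ where the first sum is over all subsets $I$ of the family of caps. -/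

import Mathlib

noncomputable section

namespace HypRestr

open MeasureTheory Set

/-! ### The base square, the phase functions and the extension operator -/

/-- Frequency space `ℝ³` with the Euclidean norm. -/
abbrev Space := EuclideanSpace ℝ (Fin 3)

/-- The closed axis-parallel square with centre `c` and side length `s`. -/
def square (c : ℝ × ℝ) (s : ℝ) : Set (ℝ × ℝ) :=
  Icc (c.1 - s / 2) (c.1 + s / 2) ×ˢ Icc (c.2 - s / 2) (c.2 + s / 2)

/-- `Σ = [-1,1] × [-1,1]`. -/
def Sig : Set (ℝ × ℝ) := Icc (-1) 1 ×ˢ Icc (-1) 1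

/-- `2Σ = [-2,2] × [-2,2]`. -/
def Sig2 : Set (ℝ × ℝ) := Icc (-2) 2 ×ˢ Icc (-2) 2

/-- `∂g/∂x`. -/
def dx (g : ℝ × ℝ → ℝ) (z : ℝ × ℝ) : ℝ := fderiv ℝ g z (1, 0)

/-- `∂g/∂y`. -/
def dy (g : ℝ × ℝ → ℝ) (z : ℝ × ℝ) : ℝ := fderiv ℝ g z (0, 1)

/-- The two coordinate vectors of the plane. -/
def unitVec (i : Fin 2) : ℝ × ℝ := if i = 0 then (1, 0) else (0, 1)

/-- The class `Hyp^M` of phase functions (only the values of `φ` on `2Σ` matter). The last field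
bounds all partial derivatives of order `n`, for `3 ≤ n ≤ M`, on the closed square `2Σ`. -/
structure IsHyp (M : ℕ) (φ : ℝ × ℝ → ℝ) : Prop where
  three_le : 3 ≤ M
  contDiffOn : ContDiffOn ℝ M φ Sig2
  map_zero : φ 0 = 0
  dx_zero : dx φ 0 = 0
  dy_zero : dy φ 0 = 0
  dxx_zero : dx (dx φ) 0 = 0
  dxy_zero : dx (dy φ) 0 = 1
  dyx_zero : dy (dx φ) 0 = 1
  dyy_zero : dy (dy φ) 0 = 0
  bound : ∀ n : ℕ, 3 ≤ n → n ≤ M → ∀ z ∈ Sig2, ∀ v : Fin n → Fin 2,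
    |iteratedFDerivWithin ℝ n φ Sig2 z (fun i => unitVec (v i))| ≤ 1 / 10 ^ 5

/-- The extension operator
`E_φ f(ξ) = ∫ f(x,y) exp(-i(ξ₁ x + ξ₂ y + ξ₃ φ(x,y))) dx dy`. A function on `Σ` is regarded as a
function on the plane vanishing off `Σ`; integrating over `2Σ`, where `φ` lives, lets the operator
act also on wave packets whose support sticks out of `Σ` a little. -/
def ext (φ : ℝ × ℝ → ℝ) (f : ℝ × ℝ → ℂ) (ξ : Space) : ℂ :=
  ∫ z in Sig2, f z *
    Complex.exp (-Complex.I * ((ξ 0 * z.1 + ξ 1 * z.2 + ξ 2 * φ z : ℝ) : ℂ))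

/-- On functions supported in `Σ` the operator is the integral over `Σ`. -/
theorem ext_eq_integral_Sig (φ : ℝ × ℝ → ℝ) (f : ℝ × ℝ → ℂ) (hf : Function.support f ⊆ Sig)
    (ξ : Space) :
    ext φ f ξ = ∫ z in Sig, f z *
      Complex.exp (-Complex.I * ((ξ 0 * z.1 + ξ 1 * z.2 + ξ 2 * φ z : ℝ) : ℂ)) := by
  unfold ext
  have hsub : Sig ⊆ Sig2 :=
    Set.prod_mono (Icc_subset_Icc (by norm_num) (by norm_num))
      (Icc_subset_Icc (by norm_num) (by norm_num))
  refine setIntegral_eq_of_subset_of_forall_sdiff_eq_zero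
    (measurableSet_Icc.prod measurableSet_Icc) hsub ?_
  intro z hz
  have h0 : f z = 0 := by
    by_contra h
    exact hz.2 (hf h)
  simp [h0]

/-- The `L²` norm. -/
def l2norm (f : ℝ × ℝ → ℂ) : ℝ := (eLpNorm f 2 volume).toReal

/-! ### Transversality -/

/-- `H = φ_xy² - φ_xx φ_yy`. -/
def hess (φ : ℝ × ℝ → ℝ) (z : ℝ × ℝ) : ℝ :=
  dx (dy φ) z ^ 2 - dx (dx φ) z * dy (dy φ) z

/-- `A = φ_yy / (φ_xy + √H)`. -/
def fA (φ : ℝ × ℝ → ℝ) (z : ℝ × ℝ) : ℝ :=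
  dy (dy φ) z / (dx (dy φ) z + Real.sqrt (hess φ z))

/-- `B = φ_xx / (φ_xy + √H)`. -/
def fB (φ : ℝ × ℝ → ℝ) (z : ℝ × ℝ) : ℝ :=
  dx (dx φ) z / (dx (dy φ) z + Real.sqrt (hess φ z))

/-- `t¹_z(z₁,z₂) = φ_x(z₂) - φ_x(z₁) - B(z)(φ_y(z₂) - φ_y(z₁))`. -/
def t1 (φ : ℝ × ℝ → ℝ) (z z₁ z₂ : ℝ × ℝ) : ℝ :=
  dx φ z₂ - dx φ z₁ - fB φ z * (dy φ z₂ - dy φ z₁)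

/-- `t²_z(z₁,z₂) = φ_y(z₂) - φ_y(z₁) - A(z)(φ_x(z₂) - φ_x(z₁))`. -/
def t2 (φ : ℝ × ℝ → ℝ) (z z₁ z₂ : ℝ × ℝ) : ℝ :=
  dy φ z₂ - dy φ z₁ - fA φ z * (dx φ z₂ - dx φ z₁)

/-! ### Caps -/

/-- The cap with centre `c`: a square of side length `μ^{1/2} K⁻¹`, truncated to `Σ`. -/
def cap (μ K : ℝ) (c : ℝ × ℝ) : Set (ℝ × ℝ) := square c (Real.sqrt μ / K) ∩ Sig

/-- A family of caps of side length `μ^{1/2} K⁻¹`, given by the finite set of its centres: the caps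
cover `Σ` and the centres are `K⁻¹`-separated in the Euclidean distance. -/
structure IsCapFamily (μ K : ℝ) (𝒯 : Finset (ℝ × ℝ)) : Prop where
  center_mem : ∀ c ∈ 𝒯, c ∈ Sig
  separated : ∀ c ∈ 𝒯, ∀ c' ∈ 𝒯, c ≠ c' →
    K⁻¹ ≤ Real.sqrt ((c.1 - c'.1) ^ 2 + (c.2 - c'.2) ^ 2)
  cover : Sig ⊆ ⋃ c ∈ 𝒯, cap μ K c

/-- Strong separation of two caps, in terms of their centres. -/
def StronglySeparated (φ : ℝ × ℝ → ℝ) (μ K : ℝ) (c₁ c₂ : ℝ × ℝ) : Prop :=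
  c₁ ≠ c₂ ∧
  50 * (Real.sqrt μ / K) ≤
    max (min |t1 φ c₁ c₁ c₂| |t2 φ c₁ c₁ c₂|) (min |t1 φ c₂ c₁ c₂| |t2 φ c₂ c₁ c₂|)

/-! ### The exceptional rectangles

Throughout `r = μ^{1/2} K^{-3/4}`. The construction is written for a general function `a` on the
square and is used for `a = A` and, with the coordinates interchanged, for `B`. -/

/-- `r = μ^{1/2} K^{-3/4}`. -/
def rad (μ K : ℝ) : ℝ := Real.sqrt μ * K ^ (-(3 / 4) : ℝ)

/-- The levels `A_k`, `k ∈ ℤ`, in arithmetic progression with difference `C r`. -/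
def level (C μ K : ℝ) (k : ℤ) : ℝ := k * (C * rad μ K)

/-- `R_II^k = {z ∈ Σ : |a(z) - A_k| < C r}`. -/
def levelRegion (a : ℝ × ℝ → ℝ) (C μ K : ℝ) (k : ℤ) : Set (ℝ × ℝ) :=
  {z | z ∈ Sig ∧ |a z - level C μ K k| < C * rad μ K}

/-- The coordinate of `z` along the unit vector in direction `ω = (-b, 1)`. -/
def along (b : ℝ) (z : ℝ × ℝ) : ℝ := (-b * z.1 + z.2) / Real.sqrt (1 + b ^ 2)

/-- The coordinate of `z` along the unit vector in direction `ω^⊥ = (1, b)`. -/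
def across (b : ℝ) (z : ℝ × ℝ) : ℝ := (z.1 + b * z.2) / Real.sqrt (1 + b ^ 2)

/-- The strip `S_{k,j}` of direction `(-A_k, 1)` and thickness `2 C' r`. -/
def strip (C C' μ K : ℝ) (k j : ℤ) : Set (ℝ × ℝ) :=
  {z | across (level C μ K k) z ∈
    Icc (((j : ℝ) - 1) * (C' * rad μ K)) (((j : ℝ) + 1) * (C' * rad μ K))}

/-- The set of values of the coordinate `along` on `S⁰_{k,j}`, the set of points of `S_{k,j}` whose
orthogonal cross section of the strip meets `R_II^k`. Thus
`S⁰_{k,j} = {z ∈ S_{k,j} : along z ∈ shadow0}`. -/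
def shadow0 (a : ℝ × ℝ → ℝ) (C C' μ K : ℝ) (k j : ℤ) : Set ℝ :=
  along (level C μ K k) '' (strip C C' μ K k j ∩ levelRegion a C μ K k)

/-- The same for `S¹_{k,j} = S⁰_{k,j} + [-r, r] ω`. -/
def shadow1 (a : ℝ × ℝ → ℝ) (C C' μ K : ℝ) (k j : ℤ) : Set ℝ :=
  {u | ∃ u₀ ∈ shadow0 a C C' μ K k j, |u - u₀| ≤ rad μ K}

/-- The number of pieces into which an interval of length `ℓ` is chopped: the least number of equal
pieces of length at most `K^{-ε'}/2`. In particular an interval of length at most `K^{-ε'}/2` is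
not chopped, and otherwise the pieces have length at least `K^{-ε'}/4`. -/
def pieces (K ε' ℓ : ℝ) : ℕ := ⌈ℓ / (K ^ (-ε') / 2)⌉₊

/-- The rectangles `L^i_{k,j}`: every connected component of `S¹_{k,j}` (a rectangle, determined by
the component `J` of `shadow1` through some point `u`) is chopped into pieces, and each piece is
then prolonged by `r` at both ends. -/
def rectangles (a : ℝ × ℝ → ℝ) (C C' ε' μ K : ℝ) : Set (Set (ℝ × ℝ)) :=
  {L | ∃ k j : ℤ, ∃ u ∈ shadow1 a C C' μ K k j, ∃ J : Set ℝ,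
    J = connectedComponentIn (shadow1 a C C' μ K k j) u ∧
    ∃ i : ℕ, i < pieces K ε' (sSup J - sInf J) ∧
    L = {z | z ∈ strip C C' μ K k j ∧ along (level C μ K k) z ∈
      Icc (sInf J + i * ((sSup J - sInf J) / pieces K ε' (sSup J - sInf J)) - rad μ K)
        (sInf J + (i + 1) * ((sSup J - sInf J) / pieces K ε' (sSup J - sInf J)) + rad μ K)}}

/-- The family `𝓛₁`. -/
def famL1 (φ : ℝ × ℝ → ℝ) (C C' ε' μ K : ℝ) : Set (Set (ℝ × ℝ)) :=
  rectangles (fA φ) C C' ε' μ K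

/-- The family `𝓛₂`: the same with the coordinates interchanged and `B` in place of `A`. -/
def famL2 (φ : ℝ × ℝ → ℝ) (C C' ε' μ K : ℝ) : Set (Set (ℝ × ℝ)) :=
  (fun L => Prod.swap ⁻¹' L) '' rectangles (fun z => fB φ z.swap) C C' ε' μ K

/-- The family `𝓛₃` of large caps: the squares of side length `c = C μ^{1/2} K^{-1/4}` that meet
`Σ` and whose centres lie in the lattice `(c/2) ℤ²`. -/
def famL3 (C μ K : ℝ) : Set (Set (ℝ × ℝ)) :=
  {L | ∃ m n : ℤ, ∃ c : ℝ, c = C * (Real.sqrt μ * K ^ (-(1 / 4) : ℝ)) ∧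
    L = square (m * (c / 2), n * (c / 2)) c ∧ (L ∩ Sig).Nonempty}

/-- `𝓛 = 𝓛₁ ∪ 𝓛₂ ∪ 𝓛₃`. -/
def famL (φ : ℝ × ℝ → ℝ) (C C' ε' μ K : ℝ) : Set (Set (ℝ × ℝ)) :=
  famL1 φ C C' ε' μ K ∪ famL2 φ C C' ε' μ K ∪ famL3 C μ K

/-- The family of all finite intersections `L₁ ∩ ⋯ ∩ L_m`, `m ≥ 1`, of members of `𝓛`. -/
def famLbar (φ : ℝ × ℝ → ℝ) (C C' ε' μ K : ℝ) : Set (Set (ℝ × ℝ)) :=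
  {Δ | ∃ S : Finset (Set (ℝ × ℝ)), S.Nonempty ∧ (S : Set (Set (ℝ × ℝ))) ⊆ famL φ C C' ε' μ K ∧
    Δ = ⋂₀ (S : Set (Set (ℝ × ℝ)))}

/-- `N` bounds the overlap of the intersection families: uniformly in the phase `φ` and in all
parameters for which the rectangles are longer than wide, at most `N` members of the family contain
any given point of `Σ`. -/
def OverlapBound (C C' : ℝ) (N : ℕ) : Prop :=
  ∀ φ : ℝ × ℝ → ℝ, IsHyp 3 φ → ∀ μ K ε' : ℝ, 1 ≤ μ → 1 ≤ K → 0 < ε' →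
    2 * rad μ K < K ^ (-ε') / 2 → ∀ z ∈ Sig,
      {Δ | Δ ∈ famLbar φ C C' ε' μ K ∧ z ∈ Δ}.encard ≤ N

/-! ### Broad points

A decomposition `f = ∑_τ f_τ` is given by the functions `f c`, where `c` runs over the centres of
the caps. -/

open Classical in
/-- `f_Δ = ∑_{τ ⊆ Δ} f_τ`. -/
def partIn (μ K : ℝ) (𝒯 : Finset (ℝ × ℝ)) (f : ℝ × ℝ → ℝ × ℝ → ℂ) (Δ : Set (ℝ × ℝ)) :
    ℝ × ℝ → ℂ :=
  ∑ c ∈ 𝒯 with cap μ K c ⊆ Δ, f c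

/-- `ξ` is `α`-broad for `E_φ f`. -/
def IsBroad (φ : ℝ × ℝ → ℝ) (C C' ε' μ K : ℝ) (𝒯 : Finset (ℝ × ℝ)) (α : ℝ)
    (f : ℝ × ℝ → ℝ × ℝ → ℂ) (ξ : Space) : Prop :=
  ∀ Δ ∈ famLbar φ C C' ε' μ K, ‖ext φ (partIn μ K 𝒯 f Δ) ξ‖ ≤ α * ‖ext φ (∑ c ∈ 𝒯, f c) ξ‖

open Classical in
/-- The broad part `Br_α E_φ f`. -/
def Br (φ : ℝ × ℝ → ℝ) (C C' ε' μ K : ℝ) (𝒯 : Finset (ℝ × ℝ)) (α : ℝ)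
    (f : ℝ × ℝ → ℝ × ℝ → ℂ) (ξ : Space) : ℝ :=
  if IsBroad φ C C' ε' μ K 𝒯 α f ξ then ‖ext φ (∑ c ∈ 𝒯, f c) ξ‖ else 0

/-- The bilinear expression: the maximum of `|E_φ f_{τ₁}|^{1/2} |E_φ f_{τ₂}|^{1/2}` over all pairs of
strongly separated caps (`0` if there is no such pair). -/
def Bil (φ : ℝ × ℝ → ℝ) (μ K : ℝ) (𝒯 : Finset (ℝ × ℝ)) (f : ℝ × ℝ → ℝ × ℝ → ℂ)
    (ξ : Space) : ℝ :=
  ⨆ p : {p : (ℝ × ℝ) × (ℝ × ℝ) // p.1 ∈ 𝒯 ∧ p.2 ∈ 𝒯 ∧ StronglySeparated φ μ K p.1 p.2},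
    Real.sqrt ‖ext φ (f p.1.1) ξ‖ * Real.sqrt ‖ext φ (f p.1.2) ξ‖

/-! ### Tubes and wave packets -/

/-- The cube `B_R = [-R,R]³`. -/
def cube (R : ℝ) : Set Space := {ξ | ∀ i, |ξ i| ≤ R}

/-- A decomposition of `Σ` into squares `θ` of side length `R^{-1/2}` with pairwise disjoint
interiors, given by the set of their centres. -/
structure IsSmallCapDecomposition (R : ℝ) (Θ : Finset (ℝ × ℝ)) : Prop where
  center_mem : ∀ ω ∈ Θ, ω ∈ Sig
  disjoint : ∀ ω ∈ Θ, ∀ ω' ∈ Θ, ω ≠ ω' →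
    Disjoint (interior (square ω (R ^ (-(1 / 2) : ℝ)))) (interior (square ω' (R ^ (-(1 / 2) : ℝ))))
  cover : Sig ⊆ ⋃ ω ∈ Θ, square ω (R ^ (-(1 / 2) : ℝ))

/-- The unit normal to the graph of `φ` above `ω`, in direction `(∇φ(ω), -1)`. -/
def normal (φ : ℝ × ℝ → ℝ) (ω : ℝ × ℝ) : Space :=
  (Real.sqrt (1 + dx φ ω ^ 2 + dy φ ω ^ 2))⁻¹ • !₂[dx φ ω, dy φ ω, -1]

/-- The solid tube with centre `p`, unit direction `n`, radius `ρ` and length `ℓ`. -/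
def solidTube (n p : Space) (ρ ℓ : ℝ) : Set Space :=
  {ξ | |inner ℝ (ξ - p) n| ≤ ℓ / 2 ∧ ‖ξ - p - (inner ℝ (ξ - p) n : ℝ) • n‖ ≤ ρ}

/-- A tube is recorded by the centre `ω` of the small cap `θ` it belongs to and its own centre. -/
structure Tube where
  ω : ℝ × ℝ
  pt : Space

/-- The direction of a tube. -/
def Tube.dir (φ : ℝ × ℝ → ℝ) (T : Tube) : Space := normal φ T.ω

/-- The tube `lam • T` with the same centre and direction as `T`; the tube `T` itself (`lam = 1`)
has radius `R^{1/2+δ}` and length `4R`, long enough to run across `B_R`. -/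
def Tube.dilate (φ : ℝ × ℝ → ℝ) (R δ lam : ℝ) (T : Tube) : Set Space :=
  solidTube (T.dir φ) T.pt (lam * R ^ (1 / 2 + δ)) (lam * (4 * R))

/-- The point set of the tube `T`. -/
def Tube.carrier (φ : ℝ × ℝ → ℝ) (R δ : ℝ) (T : Tube) : Set Space := T.dilate φ R δ 1

/-- `𝕋 = ⋃_θ 𝕋(θ)`, where `𝕋(θ)` is a set of `R^{1/2}`-separated tubes of direction `ν(θ)` which
meet `B_R`, such that the thinner tubes of radius `R^{1/2}` with the same axes cover `B_R`. The
tubes are centred at the foot of the perpendicular from the origin to the axis. -/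
structure IsTubeFamily (φ : ℝ × ℝ → ℝ) (R δ : ℝ) (Θ : Finset (ℝ × ℝ)) (𝕋 : Finset Tube) :
    Prop where
  cap_mem : ∀ T ∈ 𝕋, T.ω ∈ Θ
  perp : ∀ T ∈ 𝕋, inner ℝ T.pt (T.dir φ) = 0
  separated : ∀ T ∈ 𝕋, ∀ T' ∈ 𝕋, T.ω = T'.ω → T ≠ T' → R ^ (1 / 2 : ℝ) ≤ dist T.pt T'.pt
  meets : ∀ T ∈ 𝕋, (T.carrier φ R δ ∩ cube R).Nonempty
  cover : ∀ ω ∈ Θ, ∀ ξ ∈ cube R, ∃ T ∈ 𝕋, T.ω = ω ∧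
    ξ ∈ solidTube (T.dir φ) T.pt (R ^ (1 / 2 : ℝ)) (4 * R)

open Classical in
/-- `(F T)_{T ∈ 𝕋}` is an (approximate) wave packet decomposition of `f`, with constant `Cw` in the
`L²` bound of the last field. -/
structure IsWavePacketDecomposition (φ : ℝ × ℝ → ℝ) (R δ Cw : ℝ) (Θ : Finset (ℝ × ℝ))
    (𝕋 : Finset Tube) (f : ℝ × ℝ → ℂ) (F : Tube → ℝ × ℝ → ℂ) : Prop where
  memLp : ∀ T ∈ 𝕋, MemLp (F T) 2 volume
  support_subset : ∀ T ∈ 𝕋, Function.support (F T) ⊆ square T.ω (3 * R ^ (-(1 / 2) : ℝ))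
  small_off_tube : ∀ T ∈ 𝕋, ∀ ξ ∈ cube R \ T.carrier φ R δ,
    ‖ext φ (F T) ξ‖ ≤ R ^ (-1000 : ℝ) * l2norm f
  approx : ∀ ξ ∈ cube R,
    ‖ext φ f ξ - ∑ T ∈ 𝕋, ext φ (F T) ξ‖ ≤ R ^ (-1000 : ℝ) * l2norm f
  orthogonal : ∀ T₁ ∈ 𝕋, ∀ T₂ ∈ 𝕋, T₁.ω = T₂.ω →
    Disjoint (T₁.carrier φ R δ) (T₂.carrier φ R δ) →
    ‖∫ z, F T₁ z * (starRingEnd ℂ) (F T₂ z)‖ ≤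
      R ^ (-1000 : ℝ) * ∫ z in square T₁.ω (3 * R ^ (-(1 / 2) : ℝ)), ‖f z‖ ^ 2
  sum_sq : ∀ ω ∈ Θ, ∑ T ∈ 𝕋 with T.ω = ω, ∫ z in Sig, ‖F T z‖ ^ 2 ≤
      Cw * ∫ z in square ω (3 * R ^ (-(1 / 2) : ℝ)), ‖f z‖ ^ 2

/-! ### The wall, tangential and transversal tubes -/

/-- The zero set `Z(P)`. -/
def zeroSet (P : MvPolynomial (Fin 3) ℝ) : Set Space :=
  {ξ | MvPolynomial.eval (fun i => ξ i) P = 0}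

/-- The gradient of `P`. -/
def polyGrad (P : MvPolynomial (Fin 3) ℝ) (ξ : Space) : Space :=
  WithLp.toLp 2 (fun i => MvPolynomial.eval (fun j => ξ j) (MvPolynomial.pderiv i P))

/-- The tangent space of `Z(P)` at a nonsingular point `ξ`. -/
def tangentSpaceAt (P : MvPolynomial (Fin 3) ℝ) (ξ : Space) : Submodule ℝ Space :=
  (Submodule.span ℝ {polyGrad P ξ})ᗮ

/-- The angle between a vector and a linear subspace. -/
def angleTo (v : Space) (V : Submodule ℝ Space) : ℝ :=
  sInf {t | ∃ w ∈ V, w ≠ 0 ∧ t = InnerProductGeometry.angle v w}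

/-- The wall `W`: the `R^{1/2+δ}`-neighbourhood of `Z(P)`. -/
def wall (P : MvPolynomial (Fin 3) ℝ) (R δ : ℝ) : Set Space :=
  Metric.thickening (R ^ (1 / 2 + δ)) (zeroSet P)

/-- The ball of radius `R^{1-δ}` with centre `b`, dilated by the factor `lam`. -/
def ballJ (R δ lam : ℝ) (b : Space) : Set Space := Metric.closedBall b (lam * R ^ (1 - δ))

/-- `T ∈ 𝕋_{j,tang}`, where `b` is the centre of `B_j`. -/
def IsTang (φ : ℝ × ℝ → ℝ) (R δ : ℝ) (P : MvPolynomial (Fin 3) ℝ) (b : Space) (T : Tube) : Prop :=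
  (T.carrier φ R δ ∩ wall P R δ ∩ ballJ R δ 1 b).Nonempty ∧
  ∀ ζ ∈ zeroSet P, polyGrad P ζ ≠ 0 → ζ ∈ ballJ R δ 2 b ∩ T.dilate φ R δ 10 →
    angleTo (T.dir φ) (tangentSpaceAt P ζ) ≤ R ^ (-(1 / 2) + 2 * δ)

/-- `T ∈ 𝕋_{j,trans}`, where `b` is the centre of `B_j`. -/
def IsTrans (φ : ℝ × ℝ → ℝ) (R δ : ℝ) (P : MvPolynomial (Fin 3) ℝ) (b : Space) (T : Tube) : Prop :=
  (T.carrier φ R δ ∩ wall P R δ ∩ ballJ R δ 1 b).Nonempty ∧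
  ∃ ζ ∈ zeroSet P, polyGrad P ζ ≠ 0 ∧ ζ ∈ ballJ R δ 2 b ∩ T.dilate φ R δ 10 ∧
    R ^ (-(1 / 2) + 2 * δ) < angleTo (T.dir φ) (tangentSpaceAt P ζ)

open Classical in
/-- `f_{τ,j,tang} = ∑_{T ∈ 𝕋_{j,tang}} f_{τ,T}`, as a family indexed by the caps. -/
def tangPart (φ : ℝ × ℝ → ℝ) (R δ : ℝ) (P : MvPolynomial (Fin 3) ℝ) (b : Space) (𝕋 : Finset Tube)
    (F : ℝ × ℝ → Tube → ℝ × ℝ → ℂ) (c : ℝ × ℝ) : ℝ × ℝ → ℂ :=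
  ∑ T ∈ 𝕋 with IsTang φ R δ P b T, F c T

open Classical in
/-- The family `f_{τ,j,trans} = ∑_{T ∈ 𝕋_{j,trans}} f_{τ,T}` for `τ ∈ I`, and `0` for `τ ∉ I`; its
sum is `f_{I,j,trans}`. -/
def transPart (φ : ℝ × ℝ → ℝ) (R δ : ℝ) (P : MvPolynomial (Fin 3) ℝ) (b : Space) (𝕋 : Finset Tube)
    (F : ℝ × ℝ → Tube → ℝ × ℝ → ℂ) (I : Finset (ℝ × ℝ)) (c : ℝ × ℝ) : ℝ × ℝ → ℂ :=
  if c ∈ I then ∑ T ∈ 𝕋 with IsTrans φ R δ P b T, F c T else 0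

end HypRestr

end

noncomputable section

namespace HypRestr

open MeasureTheory Set

/-! ### Derivatives of phase functions -/

/-! Put X = |E f(ξ)|; only a broad point ξ with X above the error term matters. Each E f_τ(ξ) is a
tangential plus a transversal part up to a negligible error, because a tube which is neither misses
ξ (`norm_ext_sub_tang_sub_trans_le`). If two strongly separated caps both have tangential part above
X/K^100, the bilinear term dominates. Otherwise the caps with large tangential part are pairwise not
strongly separated, and the geometric core `exists_cover_of_not_stronglySeparated` puts them inside
O(K^{3ε'}) members of 𝓛. Let I consist of the caps contained in none of these members; there the
tangential parts are negligible. The caps outside I are removed by inclusion-exclusion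
(`norm_sum_covered_le`): every intersection that occurs belongs to the family closed under
intersections, so broadness bounds its contribution by αX, and bounded overlap kills all
intersections of more than N sets. Hence |E f_{I,trans}(ξ)| ≥ X/2. The same comparison holds for the
caps inside any Δ, so ξ stays broad for f_{I,trans} with a slightly worse constant (`Br_le`).

The geometry starts from one fixed point z₁. A point not strongly separated from z₁ lies in a large
square around z₁ or, up to interchanging the coordinates, has t² small and A(z) close to A(z₁)
(`near_or_branch`). Smallness of t² means closeness to the level curve x = g(y) of φ_y - A(z₁)φ_x
through z₁. Since A is a root of φ_xx A² - 2φ_xy A + φ_yy, the quantity g' + A(z₁) is comparable to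
the variation of A along the curve (`slope_add_bounds`), so the points in question sit where |g' +
A(z₁)| ≤ r. On windows of length K^{-2ε'}, g' is within r of a polynomial of degree less than M
(this is what many derivatives are for), so these points fall into boundedly many groups
(`abs_le_of_rootsBelow_eq`). Along each group the curve is straight up to O(r) and A nearly
constant, so the group lies over one component of a shadow and is covered by O(K^{ε'}) rectangles.
Derivative bounds uniform in φ come from the differential equation of the curve
(`exists_bound_integralCurve`).

Overlap constants exist because A is Lipschitz: a rectangle through a point is determined by the
point up to bounded integer offsets (`exists_offsets_of_mem_rectangles`). -/

/-- The interior of `2Σ`. -/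
def openSig2 : Set (ℝ × ℝ) := Ioo (-2) 2 ×ˢ Ioo (-2) 2

theorem isOpen_openSig2 : IsOpen openSig2 := isOpen_Ioo.prod isOpen_Ioo

theorem convex_openSig2 : Convex ℝ openSig2 := (convex_Ioo _ _).prod (convex_Ioo _ _)

theorem convex_Sig : Convex ℝ Sig := (convex_Icc _ _).prod (convex_Icc _ _)

theorem openSig2_subset : openSig2 ⊆ Sig2 := prod_mono Ioo_subset_Icc_self Ioo_subset_Icc_self

theorem Sig_subset_openSig2 : Sig ⊆ openSig2 :=
  prod_mono (Icc_subset_Ioo (by norm_num) (by norm_num))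
    (Icc_subset_Ioo (by norm_num) (by norm_num))

theorem zero_mem_openSig2 : (0 : ℝ × ℝ) ∈ openSig2 := by
  constructor <;> constructor <;> norm_num

theorem norm_le_of_mem_openSig2 {z : ℝ × ℝ} (hz : z ∈ openSig2) : ‖z‖ ≤ 2 := by
  rw [Prod.norm_def, Real.norm_eq_abs, Real.norm_eq_abs]
  exact max_le (abs_le.2 ⟨hz.1.1.le, hz.1.2.le⟩) (abs_le.2 ⟨hz.2.1.le, hz.2.2.le⟩)

/-- The two coordinates of a vector of the plane. -/
def coord (z : ℝ × ℝ) (i : Fin 2) : ℝ := if i = 0 then z.1 else z.2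

theorem sum_coord_smul_unitVec (z : ℝ × ℝ) : ∑ i : Fin 2, coord z i • unitVec i = z := by
  simp [Fin.sum_univ_two, coord, unitVec]

theorem abs_coord_le (z : ℝ × ℝ) (i : Fin 2) : |coord z i| ≤ ‖z‖ := by
  unfold coord
  split_ifs
  · exact norm_fst_le z
  · exact norm_snd_le z

/-- Expanding every argument in the coordinate basis gives 2^n terms. This turns the bounds on
partial derivatives in `IsHyp` into operator norm bounds. -/
theorem norm_le_of_unitVec {n : ℕ} (f : (ℝ × ℝ) [×n]→L[ℝ] ℝ) {c : ℝ} (hc : 0 ≤ c)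
    (h : ∀ v : Fin n → Fin 2, |f (fun i => unitVec (v i))| ≤ c) : ‖f‖ ≤ 2 ^ n * c := by
  refine f.opNorm_le_bound (by positivity) fun m => ?_
  have e : f m = ∑ v : Fin n → Fin 2, (∏ i, coord (m i) (v i)) * f (fun i => unitVec (v i)) := by
    conv_lhs => rw [show m = fun i => ∑ j : Fin 2, coord (m i) j • unitVec j from
      funext fun i => (sum_coord_smul_unitVec (m i)).symm]
    rw [f.map_sum]
    exact Finset.sum_congr rfl fun v _ => by rw [f.map_smul_univ, smul_eq_mul]
  rw [e]
  refine (norm_sum_le _ _).trans ((Finset.sum_le_sum (g := fun _ => (∏ i, ‖m i‖) * c)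
    fun v _ => ?_).trans_eq ?_)
  · rw [norm_mul, Real.norm_eq_abs, Finset.abs_prod]
    exact mul_le_mul (Finset.prod_le_prod (fun _ _ => abs_nonneg _) fun i _ => abs_coord_le _ _)
      (h v) (norm_nonneg _) (Finset.prod_nonneg fun _ _ => norm_nonneg _)
  · simp
    ring

/-- The derivative of `g` in the direction `e`. -/
def pd (e : ℝ × ℝ) (g : ℝ × ℝ → ℝ) (z : ℝ × ℝ) : ℝ := fderiv ℝ g z e

theorem contDiffOn_pd {g : ℝ × ℝ → ℝ} {m : ℕ} (hg : ContDiffOn ℝ (m + 1 : ℕ) g openSig2)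
    (e : ℝ × ℝ) : ContDiffOn ℝ m (pd e g) openSig2 :=
  (hg.fderiv_of_isOpen isOpen_openSig2 (by norm_cast)).clm_apply contDiffOn_const

/-- A unit directional derivative costs one order and no constant. On an open set `fderiv`, which
defines `dx` and `dy`, agrees with the derivative within the set; this is why everything takes place
on `openSig2`. -/
theorem norm_iteratedFDerivWithin_pd_le {g : ℝ × ℝ → ℝ} {m : ℕ}
    (hg : ContDiffOn ℝ (m + 1 : ℕ) g openSig2) {e : ℝ × ℝ} (he : ‖e‖ ≤ 1) {z : ℝ × ℝ}
    (hz : z ∈ openSig2) :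
    ‖iteratedFDerivWithin ℝ m (pd e g) openSig2 z‖ ≤
      ‖iteratedFDerivWithin ℝ (m + 1) g openSig2 z‖ := by
  have hu := isOpen_openSig2.uniqueDiffOn (𝕜 := ℝ)
  have h1 := norm_iteratedFDerivWithin_clm_apply_const (c := e) (n := m) (N := m)
    ((hg.fderiv_of_isOpen isOpen_openSig2 (m := m) (by norm_cast)) z hz) hu hz le_rfl
  have h2 := norm_iteratedFDerivWithin_fderivWithin (𝕜 := ℝ) (f := g) (n := m) hu hz
  rw [iteratedFDerivWithin_congr (f₁ := fderivWithin ℝ g openSig2) (f := fderiv ℝ g)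
    (fun w hw => fderivWithin_of_isOpen isOpen_openSig2 hw) hz] at h2
  rw [h2] at h1
  refine h1.trans ?_
  exact mul_le_of_le_one_left (norm_nonneg _) he

variable {M : ℕ} {φ : ℝ × ℝ → ℝ}

namespace IsHyp

theorem mono (hφ : IsHyp M φ) {m : ℕ} (h3 : 3 ≤ m) (hm : m ≤ M) : IsHyp m φ where
  three_le := h3
  contDiffOn := hφ.contDiffOn.of_le (by exact_mod_cast hm)
  map_zero := hφ.map_zero
  dx_zero := hφ.dx_zero
  dy_zero := hφ.dy_zero
  dxx_zero := hφ.dxx_zero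
  dxy_zero := hφ.dxy_zero
  dyx_zero := hφ.dyx_zero
  dyy_zero := hφ.dyy_zero
  bound n h h' := hφ.bound n h (h'.trans hm)

theorem contDiffOn_open (hφ : IsHyp M φ) : ContDiffOn ℝ M φ openSig2 :=
  hφ.contDiffOn.mono openSig2_subset

theorem norm_iter_le (hφ : IsHyp M φ) {n : ℕ} (h3 : 3 ≤ n) (hn : n ≤ M) {z : ℝ × ℝ}
    (hz : z ∈ openSig2) :
    ‖iteratedFDerivWithin ℝ n φ openSig2 z‖ ≤ 2 ^ n * (1 / 10 ^ 5) := by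
  have h : openSig2 =ᶠ[nhds z] Sig2 := by
    filter_upwards [isOpen_openSig2.mem_nhds hz] with w hw
    exact propext ⟨fun _ => openSig2_subset hw, fun _ => hw⟩
  rw [iteratedFDerivWithin_congr_set h]
  exact norm_le_of_unitVec _ (by norm_num) (hφ.bound n h3 hn z (openSig2_subset hz))

theorem contDiffOn_pd_pd (hφ : IsHyp M φ) (e e' : ℝ × ℝ) :
    ContDiffOn ℝ (M - 2 : ℕ) (pd e (pd e' φ)) openSig2 := by
  have h3 := hφ.three_le
  refine HypRestr.contDiffOn_pd (HypRestr.contDiffOn_pd ?_ e') e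
  rw [show M - 2 + 1 + 1 = M by omega]
  exact hφ.contDiffOn_open

theorem contDiffOn_pd (hφ : IsHyp M φ) (e : ℝ × ℝ) :
    ContDiffOn ℝ (M - 1 : ℕ) (pd e φ) openSig2 := by
  have h3 := hφ.three_le
  refine HypRestr.contDiffOn_pd ?_ e
  rw [show M - 1 + 1 = M by omega]
  exact hφ.contDiffOn_open

theorem norm_iter_pd_pd_le (hφ : IsHyp M φ) {e e' : ℝ × ℝ} (he : ‖e‖ ≤ 1) (he' : ‖e'‖ ≤ 1)
    {n : ℕ} (h1 : 1 ≤ n) (hn : n + 2 ≤ M) {z : ℝ × ℝ} (hz : z ∈ openSig2) :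
    ‖iteratedFDerivWithin ℝ n (pd e (pd e' φ)) openSig2 z‖ ≤ 2 ^ (n + 2) * (1 / 10 ^ 5) := by
  have hc : ContDiffOn ℝ (n + 1 + 1 : ℕ) φ openSig2 :=
    hφ.contDiffOn_open.of_le (by exact_mod_cast hn)
  exact (norm_iteratedFDerivWithin_pd_le (HypRestr.contDiffOn_pd hc e') he hz).trans
    ((norm_iteratedFDerivWithin_pd_le hc he' hz).trans (hφ.norm_iter_le (by omega) hn hz))

/-- Mean value inequality: the third derivatives have norm at most 2^3 / 10^5. -/
theorem pd_pd_lip (hφ : IsHyp M φ) {e e' : ℝ × ℝ} (he : ‖e‖ ≤ 1) (he' : ‖e'‖ ≤ 1)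
    {z w : ℝ × ℝ} (hz : z ∈ openSig2) (hw : w ∈ openSig2) :
    |pd e (pd e' φ) z - pd e (pd e' φ) w| ≤ 1 / 10 ^ 4 * ‖z - w‖ := by
  have h3 := hφ.three_le
  rw [← Real.norm_eq_abs]
  refine convex_openSig2.norm_image_sub_le_of_norm_fderivWithin_le (𝕜 := ℝ) (fun x hx => ?_)
    (fun x hx => ?_) hw hz
  · exact (hφ.contDiffOn_pd_pd e e').differentiableOn
      (by exact_mod_cast (show M - 2 ≠ 0 by omega)) x hx
  · rw [← norm_iteratedFDerivWithin_one _ (isOpen_openSig2.uniqueDiffOn x hx)]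
    refine (hφ.norm_iter_pd_pd_le he he' le_rfl (by omega) hx).trans (by norm_num)

theorem norm_unit_fst : ‖((1, 0) : ℝ × ℝ)‖ ≤ 1 := by simp [Prod.norm_def]

theorem norm_unit_snd : ‖((0, 1) : ℝ × ℝ)‖ ≤ 1 := by simp [Prod.norm_def]

theorem dxx_lip (hφ : IsHyp M φ) {z w : ℝ × ℝ} (hz : z ∈ openSig2) (hw : w ∈ openSig2) :
    |dx (dx φ) z - dx (dx φ) w| ≤ 1 / 10 ^ 4 * ‖z - w‖ :=
  hφ.pd_pd_lip norm_unit_fst norm_unit_fst hz hw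

theorem dxy_lip (hφ : IsHyp M φ) {z w : ℝ × ℝ} (hz : z ∈ openSig2) (hw : w ∈ openSig2) :
    |dx (dy φ) z - dx (dy φ) w| ≤ 1 / 10 ^ 4 * ‖z - w‖ :=
  hφ.pd_pd_lip norm_unit_fst norm_unit_snd hz hw

theorem dyy_lip (hφ : IsHyp M φ) {z w : ℝ × ℝ} (hz : z ∈ openSig2) (hw : w ∈ openSig2) :
    |dy (dy φ) z - dy (dy φ) w| ≤ 1 / 10 ^ 4 * ‖z - w‖ :=
  hφ.pd_pd_lip norm_unit_snd norm_unit_snd hz hw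

theorem abs_dxx_le (hφ : IsHyp M φ) {z : ℝ × ℝ} (hz : z ∈ openSig2) :
    |dx (dx φ) z| ≤ 1 / 5000 := by
  have h := hφ.dxx_lip hz zero_mem_openSig2
  rw [hφ.dxx_zero, sub_zero, sub_zero] at h
  linarith [norm_le_of_mem_openSig2 hz]

theorem abs_dxy_sub_one_le (hφ : IsHyp M φ) {z : ℝ × ℝ} (hz : z ∈ openSig2) :
    |dx (dy φ) z - 1| ≤ 1 / 5000 := by
  have h := hφ.dxy_lip hz zero_mem_openSig2
  rw [hφ.dxy_zero, sub_zero] at h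
  linarith [norm_le_of_mem_openSig2 hz]

theorem abs_dyy_le (hφ : IsHyp M φ) {z : ℝ × ℝ} (hz : z ∈ openSig2) :
    |dy (dy φ) z| ≤ 1 / 5000 := by
  have h := hφ.dyy_lip hz zero_mem_openSig2
  rw [hφ.dyy_zero, sub_zero, sub_zero] at h
  linarith [norm_le_of_mem_openSig2 hz]

theorem dyx_eq (hφ : IsHyp M φ) {z : ℝ × ℝ} (hz : z ∈ openSig2) :
    dy (dx φ) z = dx (dy φ) z := by
  have h3 := hφ.three_le
  have hc : ContDiffAt ℝ M φ z := (hφ.contDiffOn_open z hz).contDiffAt (isOpen_openSig2.mem_nhds hz)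
  have hs := hc.isSymmSndFDerivAt (by
    rw [minSmoothness_of_isRCLikeNormedField]; exact_mod_cast (show 2 ≤ M by omega))
  have hd : DifferentiableAt ℝ (fderiv ℝ φ) z :=
    (hc.fderiv_right (m := 1) (by norm_cast; omega)).differentiableAt (by norm_num)
  have e (u v : ℝ × ℝ) : fderiv ℝ (fun w => fderiv ℝ φ w u) z v = fderiv ℝ (fderiv ℝ φ) z v u := by
    rw [fderiv_clm_apply hd (differentiableAt_const u)]
    simp
  change fderiv ℝ (fun w => fderiv ℝ φ w (1, 0)) z (0, 1) =
    fderiv ℝ (fun w => fderiv ℝ φ w (0, 1)) z (1, 0)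
  rw [e, e]
  exact hs _ _

theorem fderiv_apply_eq (g : ℝ × ℝ → ℝ) (z v : ℝ × ℝ) :
    fderiv ℝ g z v = v.1 * dx g z + v.2 * dy g z := by
  have : v = v.1 • ((1, 0) : ℝ × ℝ) + v.2 • ((0, 1) : ℝ × ℝ) := by ext <;> simp
  conv_lhs => rw [this, map_add, map_smul, map_smul]
  rfl

theorem differentiableAt_pd (hφ : IsHyp M φ) (e : ℝ × ℝ) {z : ℝ × ℝ} (hz : z ∈ openSig2) :
    DifferentiableAt ℝ (pd e φ) z := by
  have h3 := hφ.three_le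
  exact ((hφ.contDiffOn_pd e z hz).contDiffAt (isOpen_openSig2.mem_nhds hz)).differentiableAt
      (by exact_mod_cast (show M - 1 ≠ 0 by omega))

theorem differentiableAt_dx (hφ : IsHyp M φ) {z : ℝ × ℝ} (hz : z ∈ openSig2) :
    DifferentiableAt ℝ (dx φ) z := hφ.differentiableAt_pd _ hz

theorem differentiableAt_dy (hφ : IsHyp M φ) {z : ℝ × ℝ} (hz : z ∈ openSig2) :
    DifferentiableAt ℝ (dy φ) z := hφ.differentiableAt_pd _ hz

/-- The Hessian differs from the antidiagonal matrix by at most 1/5000 per entry, so ∇φ is the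
interchange of coordinates up to a small Lipschitz error. -/
theorem dx_lip (hφ : IsHyp M φ) {z w : ℝ × ℝ} (hz : z ∈ openSig2) (hw : w ∈ openSig2) :
    |dx φ z - dx φ w - (z.2 - w.2)| ≤ 1 / 1000 * ‖z - w‖ := by
  have h := convex_openSig2.norm_image_sub_le_of_norm_hasFDerivWithin_le (𝕜 := ℝ)
    (f := fun p => dx φ p - p.2) (C := 1 / 1000)
    (f' := fun p => fderiv ℝ (dx φ) p - ContinuousLinearMap.snd ℝ ℝ ℝ) (fun p hp =>
      ((hφ.differentiableAt_dx hp).hasFDerivAt.sub hasFDerivAt_snd).hasFDerivWithinAt)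
    (fun p hp => ?_) hw hz
  · rw [Real.norm_eq_abs] at h
    convert! h using 2
    ring
  · refine ContinuousLinearMap.opNorm_le_bound _ (by norm_num) fun v => ?_
    rw [sub_apply, fderiv_apply_eq, ContinuousLinearMap.coe_snd',
      hφ.dyx_eq hp]
    have h1 := hφ.abs_dxx_le hp
    have h2 := hφ.abs_dxy_sub_one_le hp
    calc ‖v.1 * dx (dx φ) p + v.2 * dx (dy φ) p - v.2‖
        = ‖v.1 * dx (dx φ) p + v.2 * (dx (dy φ) p - 1)‖ := by ring_nf
      _ ≤ ‖v.1‖ * |dx (dx φ) p| + ‖v.2‖ * |dx (dy φ) p - 1| := by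
          refine (norm_add_le _ _).trans ?_
          simp [Real.norm_eq_abs]
      _ ≤ ‖v‖ * (1 / 5000) + ‖v‖ * (1 / 5000) := by
          gcongr
          · exact norm_fst_le v
          · exact norm_snd_le v
      _ ≤ 1 / 1000 * ‖v‖ := by linarith [norm_nonneg v]

theorem dy_lip (hφ : IsHyp M φ) {z w : ℝ × ℝ} (hz : z ∈ openSig2) (hw : w ∈ openSig2) :
    |dy φ z - dy φ w - (z.1 - w.1)| ≤ 1 / 1000 * ‖z - w‖ := by
  have h := convex_openSig2.norm_image_sub_le_of_norm_hasFDerivWithin_le (𝕜 := ℝ)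
    (f := fun p => dy φ p - p.1) (C := 1 / 1000)
    (f' := fun p => fderiv ℝ (dy φ) p - ContinuousLinearMap.fst ℝ ℝ ℝ) (fun p hp =>
      ((hφ.differentiableAt_dy hp).hasFDerivAt.sub hasFDerivAt_fst).hasFDerivWithinAt)
    (fun p hp => ?_) hw hz
  · rw [Real.norm_eq_abs] at h
    convert! h using 2
    ring
  · refine ContinuousLinearMap.opNorm_le_bound _ (by norm_num) fun v => ?_
    rw [sub_apply, fderiv_apply_eq, ContinuousLinearMap.coe_fst']
    have h1 := hφ.abs_dyy_le hp
    have h2 := hφ.abs_dxy_sub_one_le hp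
    calc ‖v.1 * dx (dy φ) p + v.2 * dy (dy φ) p - v.1‖
        = ‖v.1 * (dx (dy φ) p - 1) + v.2 * dy (dy φ) p‖ := by ring_nf
      _ ≤ ‖v.1‖ * |dx (dy φ) p - 1| + ‖v.2‖ * |dy (dy φ) p| := by
          refine (norm_add_le _ _).trans ?_
          simp [Real.norm_eq_abs]
      _ ≤ ‖v‖ * (1 / 5000) + ‖v‖ * (1 / 5000) := by
          gcongr
          · exact norm_fst_le v
          · exact norm_snd_le v
      _ ≤ 1 / 1000 * ‖v‖ := by linarith [norm_nonneg v]

/-- The quotient defining A is the rationalised form of the small root (φ_xy - √H)/φ_xx and makes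
sense also where φ_xx vanishes. From here on only the quadratic equation matters, not the square
root. -/
theorem fA_root (hφ : IsHyp M φ) {z : ℝ × ℝ} (hz : z ∈ openSig2) :
    dx (dx φ) z * fA φ z ^ 2 - 2 * dx (dy φ) z * fA φ z + dy (dy φ) z = 0 := by
  have h1 := abs_le.1 (hφ.abs_dxx_le hz)
  have h2 := abs_le.1 (hφ.abs_dxy_sub_one_le hz)
  have h3 := abs_le.1 (hφ.abs_dyy_le hz)
  have hH : 0 ≤ hess φ z := by unfold hess; nlinarith
  have hs := Real.sq_sqrt hH
  have hs0 := Real.sqrt_nonneg (hess φ z)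
  unfold fA
  set s := Real.sqrt (hess φ z)
  unfold hess at hs
  have : dx (dy φ) z + s ≠ 0 := by linarith
  field_simp
  linear_combination (dy (dy φ) z) * hs

theorem abs_fA_le (hφ : IsHyp M φ) {z : ℝ × ℝ} (hz : z ∈ openSig2) : |fA φ z| ≤ 1 / 1000 := by
  have h2 := abs_le.1 (hφ.abs_dxy_sub_one_le hz)
  have hs0 := Real.sqrt_nonneg (hess φ z)
  unfold fA
  rw [abs_div, abs_of_pos (show 0 < dx (dy φ) z + √(hess φ z) by linarith),
    div_le_iff₀ (by linarith)]
  linarith [hφ.abs_dyy_le hz]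

theorem fA_lip (hφ : IsHyp M φ) {z w : ℝ × ℝ} (hz : z ∈ openSig2) (hw : w ∈ openSig2) :
    |fA φ z - fA φ w| ≤ 1 / 1000 * ‖z - w‖ := by
  have r1 := hφ.fA_root hz
  have r2 := hφ.fA_root hw
  have a1 := hφ.abs_fA_le hz
  have a2 := hφ.abs_fA_le hw
  have l1 := hφ.dxx_lip hz hw
  have l2 := hφ.dxy_lip hz hw
  have l3 := hφ.dyy_lip hz hw
  have b1 := abs_le.1 (hφ.abs_dxx_le hz)
  have b2 := abs_le.1 (hφ.abs_dxy_sub_one_le hz)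
  set a := dx (dx φ) z
  set b := dx (dy φ) z
  set c := dy (dy φ) z
  set a' := dx (dx φ) w
  set b' := dx (dy φ) w
  set c' := dy (dy φ) w
  set A := fA φ z
  set A' := fA φ w
  set n := ‖z - w‖
  have hn : 0 ≤ n := norm_nonneg _
  -- The difference of the two quadratic equations factors, with cofactor close to 2; no square root
  -- has to be differentiated.
  have key : (A - A') * (2 * b - a * (A + A')) = (a - a') * A' ^ 2 - 2 * (b - b') * A' + (c - c') := by
    linear_combination r2 - r1
  have hden : 1 ≤ 2 * b - a * (A + A') := by
    have := abs_le.1 a1; have := abs_le.1 a2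
    nlinarith
  have hA2 : A' ^ 2 ≤ 1 := by
    rw [← sq_abs]; nlinarith [abs_nonneg A']
  calc |A - A'| ≤ |A - A'| * (2 * b - a * (A + A')) := le_mul_of_one_le_right (abs_nonneg _) hden
    _ = |(a - a') * A' ^ 2 - 2 * (b - b') * A' + (c - c')| := by
        rw [← key, abs_mul, abs_of_pos (by linarith : 0 < 2 * b - a * (A + A'))]
    _ ≤ |a - a'| * A' ^ 2 + 2 * |b - b'| * |A'| + |c - c'| := by
        refine (abs_add_le _ _).trans (add_le_add_left ((abs_sub _ _).trans ?_) _)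
        rw [abs_mul, abs_mul, abs_mul, abs_of_nonneg (sq_nonneg A'), abs_two]
    _ ≤ (1 / 10 ^ 4 * n) * 1 + 2 * (1 / 10 ^ 4 * n) * 1 + 1 / 10 ^ 4 * n := by
        gcongr
        linarith
    _ ≤ 1 / 1000 * n := by linarith

end IsHyp

/-! ### Interchanging the coordinates -/

theorem dx_comp_swap (g : ℝ × ℝ → ℝ) : dx (g ∘ Prod.swap) = dy g ∘ Prod.swap := by
  funext z
  have h := (ContinuousLinearEquiv.prodComm ℝ ℝ ℝ).comp_right_fderiv (f := g) (x := z)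
  change fderiv ℝ (g ∘ Prod.swap) z = _ at h
  simp only [dx, h]
  rfl

theorem dy_comp_swap (g : ℝ × ℝ → ℝ) : dy (g ∘ Prod.swap) = dx g ∘ Prod.swap := by
  funext z
  have h := (ContinuousLinearEquiv.prodComm ℝ ℝ ℝ).comp_right_fderiv (f := g) (x := z)
  change fderiv ℝ (g ∘ Prod.swap) z = _ at h
  simp only [dy, h]
  rfl

theorem swap_mem_openSig2 {z : ℝ × ℝ} (hz : z ∈ openSig2) : z.swap ∈ openSig2 := ⟨hz.2, hz.1⟩

theorem swap_mem_Sig {z : ℝ × ℝ} (hz : z ∈ Sig) : z.swap ∈ Sig := ⟨hz.2, hz.1⟩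

theorem swap_preimage_Sig2 : Prod.swap ⁻¹' Sig2 = Sig2 := by
  ext z; exact ⟨fun h => ⟨h.2, h.1⟩, fun h => ⟨h.2, h.1⟩⟩

theorem uniqueDiffOn_Sig2 : UniqueDiffOn ℝ Sig2 :=
  (uniqueDiffOn_Icc (by norm_num)).prod (uniqueDiffOn_Icc (by norm_num))

/-- The class is symmetric in the coordinates. Composing with the swap interchanges A with B and t²
with t¹, so the second family of curves needs no separate argument. -/
theorem IsHyp.comp_swap (hφ : IsHyp M φ) : IsHyp M (φ ∘ Prod.swap) where
  three_le := hφ.three_le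
  contDiffOn := by
    refine hφ.contDiffOn.comp (t := Sig2) ?_ fun z hz => ⟨hz.2, hz.1⟩
    exact (ContinuousLinearEquiv.prodComm ℝ ℝ ℝ).contDiff.contDiffOn
  map_zero := hφ.map_zero
  dx_zero := by rw [dx_comp_swap]; exact hφ.dy_zero
  dy_zero := by rw [dy_comp_swap]; exact hφ.dx_zero
  dxx_zero := by rw [dx_comp_swap, dx_comp_swap]; exact hφ.dyy_zero
  dxy_zero := by rw [dy_comp_swap, dx_comp_swap]; exact hφ.dyx_zero
  dyx_zero := by rw [dx_comp_swap, dy_comp_swap]; exact hφ.dxy_zero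
  dyy_zero := by rw [dy_comp_swap, dy_comp_swap]; exact hφ.dxx_zero
  bound n h3 hn z hz v := by
    have h := (ContinuousLinearEquiv.prodComm ℝ ℝ ℝ).iteratedFDerivWithin_comp_right φ
      uniqueDiffOn_Sig2 (x := z) ⟨hz.2, hz.1⟩ n
    change iteratedFDerivWithin ℝ n (φ ∘ Prod.swap) (Prod.swap ⁻¹' Sig2) z = _ at h
    rw [swap_preimage_Sig2] at h
    rw [h, ContinuousMultilinearMap.compContinuousLinearMap_apply]
    -- On `Fin 2`, `Fin.rev` exchanges the two coordinate indices.
    have := hφ.bound n h3 hn z.swap ⟨hz.2, hz.1⟩ (fun i => Fin.rev (v i))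
    convert! this using 3
    funext i
    generalize v i = k
    fin_cases k <;> simp [unitVec]

theorem fA_comp_swap (hφ : IsHyp M φ) {z : ℝ × ℝ} (hz : z ∈ openSig2) :
    fA (φ ∘ Prod.swap) z = fB φ z.swap := by
  have h := hφ.dyx_eq (swap_mem_openSig2 hz)
  simp only [fA, fB, hess, dx_comp_swap, dy_comp_swap, Function.comp_apply, h]
  ring_nf

theorem t2_comp_swap (hφ : IsHyp M φ) {z : ℝ × ℝ} (hz : z ∈ openSig2) (z₁ z₂ : ℝ × ℝ) :
    t2 (φ ∘ Prod.swap) z z₁ z₂ = t1 φ z.swap z₁.swap z₂.swap := by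
  simp only [t1, t2, dx_comp_swap, dy_comp_swap, Function.comp_apply, fA_comp_swap hφ hz]

/-! ### Coordinates adapted to a strip -/

section Coordinates

variable (b : ℝ) (z w : ℝ × ℝ)

theorem one_le_sqrt_one_add_sq : 1 ≤ √(1 + b ^ 2) :=
  Real.one_le_sqrt.2 (by nlinarith [sq_nonneg b])

theorem abs_le_sqrt_one_add_sq : |b| ≤ √(1 + b ^ 2) :=
  Real.abs_le_sqrt (by linarith)

theorem abs_div_sqrt_le {x : ℝ} : |x / √(1 + b ^ 2)| ≤ |x| := by
  have h := one_le_sqrt_one_add_sq b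
  rw [abs_div, abs_of_pos (show 0 < √(1 + b ^ 2) by linarith)]
  exact div_le_self (abs_nonneg _) h

theorem abs_mul_div_sqrt_le {x : ℝ} : |b * x / √(1 + b ^ 2)| ≤ |x| := by
  have h := one_le_sqrt_one_add_sq b
  rw [abs_div, abs_mul, abs_of_pos (show 0 < √(1 + b ^ 2) by linarith),
    div_le_iff₀ (by linarith), mul_comm]
  exact mul_le_mul_of_nonneg_left (abs_le_sqrt_one_add_sq b) (abs_nonneg _)

theorem along_sub : along b z - along b w = along b (z - w) := by
  simp only [along, Prod.fst_sub, Prod.snd_sub]; ring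

theorem across_sub : across b z - across b w = across b (z - w) := by
  simp only [across, Prod.fst_sub, Prod.snd_sub]; ring

theorem abs_along_le : |along b z| ≤ 2 * ‖z‖ := by
  have : along b z = -(b * z.1 / √(1 + b ^ 2)) + z.2 / √(1 + b ^ 2) := by
    unfold along; ring
  rw [this]
  refine (abs_add_le _ _).trans ?_
  rw [abs_neg]
  have h1 : |z.1| ≤ ‖z‖ := norm_fst_le z
  have h2 : |z.2| ≤ ‖z‖ := norm_snd_le z
  linarith [abs_mul_div_sqrt_le b (x := z.1), abs_div_sqrt_le b (x := z.2)]

theorem abs_across_le : |across b z| ≤ 2 * ‖z‖ := by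
  have : across b z = z.1 / √(1 + b ^ 2) + b * z.2 / √(1 + b ^ 2) := by
    unfold across; ring
  rw [this]
  refine (abs_add_le _ _).trans ?_
  have h1 : |z.1| ≤ ‖z‖ := norm_fst_le z
  have h2 : |z.2| ≤ ‖z‖ := norm_snd_le z
  linarith [abs_mul_div_sqrt_le b (x := z.2), abs_div_sqrt_le b (x := z.1)]

/-- The two coordinates are orthonormal, so the inverse change of variables is a rotation, with
entries at most 1. -/
theorem norm_le_along_add_across : ‖z‖ ≤ |along b z| + |across b z| := by
  have hs : √(1 + b ^ 2) * √(1 + b ^ 2) = 1 + b ^ 2 := Real.mul_self_sqrt (by positivity)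
  have h0 : √(1 + b ^ 2) ≠ 0 := by have := one_le_sqrt_one_add_sq b; positivity
  have e1 : z.1 = across b z / √(1 + b ^ 2) - b * along b z / √(1 + b ^ 2) := by
    unfold across along
    field_simp
    rw [Real.sq_sqrt (by positivity)]
    ring
  have e2 : z.2 = along b z / √(1 + b ^ 2) + b * across b z / √(1 + b ^ 2) := by
    unfold across along
    field_simp
    rw [Real.sq_sqrt (by positivity)]
    ring
  rw [Prod.norm_def, Real.norm_eq_abs, Real.norm_eq_abs]
  refine max_le ?_ ?_
  · rw [e1]
    refine (abs_sub _ _).trans ?_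
    linarith [abs_mul_div_sqrt_le b (x := along b z), abs_div_sqrt_le b (x := across b z)]
  · rw [e2]
    refine (abs_add_le _ _).trans ?_
    linarith [abs_mul_div_sqrt_le b (x := across b z), abs_div_sqrt_le b (x := along b z)]

end Coordinates

theorem norm_le_one_of_mem_Sig {z : ℝ × ℝ} (hz : z ∈ Sig) : ‖z‖ ≤ 1 := by
  rw [Prod.norm_def, Real.norm_eq_abs, Real.norm_eq_abs]
  exact max_le (abs_le.2 hz.1) (abs_le.2 hz.2)

/-! ### Components of the shadows -/

section Shadow

variable {a : ℝ × ℝ → ℝ} {C C' ε' μ K : ℝ} {k j : ℤ}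

theorem rad_pos (hμ : 1 ≤ μ) (hK : 1 ≤ K) : 0 < rad μ K := by
  unfold rad
  have : 0 < √μ := Real.sqrt_pos.2 (by linarith)
  positivity

theorem shadow0_subset : shadow0 a C C' μ K k j ⊆ Icc (-2) 2 := by
  rintro _ ⟨z, hz, rfl⟩
  refine abs_le.1 ((abs_along_le _ z).trans ?_)
  linarith [norm_le_one_of_mem_Sig hz.2.1]

theorem shadow1_subset : shadow1 a C C' μ K k j ⊆ Icc (-2 - rad μ K) (2 + rad μ K) := by
  rintro u ⟨u₀, h, hu⟩
  have h1 := shadow0_subset h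
  have h2 := abs_le.1 hu
  exact ⟨by linarith [h1.1], by linarith [h1.2]⟩

theorem shadow0_subset_shadow1 (hr : 0 ≤ rad μ K) :
    shadow0 a C C' μ K k j ⊆ shadow1 a C C' μ K k j :=
  fun u hu => ⟨u, hu, by simpa using hr⟩

variable (a C C' μ K k j) in
/-- The component of the shadow through `u`. -/
def shadowComp (u : ℝ) : Set ℝ := connectedComponentIn (shadow1 a C C' μ K k j) u

variable (a C C' μ K k j) in
/-- The length of the component of the shadow through `u`. -/
def compLen (u : ℝ) : ℝ :=
  sSup (shadowComp a C C' μ K k j u) - sInf (shadowComp a C C' μ K k j u)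

variable (a C C' ε' μ K k j) in
/-- The length of the pieces of the component of the shadow through `u`. -/
def pieceLen (u : ℝ) : ℝ :=
  compLen a C C' μ K k j u / pieces K ε' (compLen a C C' μ K k j u)

variable (a C C' ε' μ K k j) in
/-- The `i`-th prolonged rectangle over the component of the shadow through `u`. -/
def rect (u : ℝ) (i : ℕ) : Set (ℝ × ℝ) :=
  {z | z ∈ strip C C' μ K k j ∧ along (level C μ K k) z ∈
    Icc (sInf (shadowComp a C C' μ K k j u) + i * pieceLen a C C' ε' μ K k j u - rad μ K)
      (sInf (shadowComp a C C' μ K k j u) + (i + 1) * pieceLen a C C' ε' μ K k j u + rad μ K)}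

theorem mem_rectangles_iff {L : Set (ℝ × ℝ)} : L ∈ rectangles a C C' ε' μ K ↔
    ∃ k j : ℤ, ∃ u ∈ shadow1 a C C' μ K k j, ∃ i : ℕ,
      i < pieces K ε' (compLen a C C' μ K k j u) ∧ L = rect a C C' ε' μ K k j u i := by
  constructor
  · rintro ⟨k, j, u, hu, J, rfl, i, hi, rfl⟩
    exact ⟨k, j, u, hu, i, hi, rfl⟩
  · rintro ⟨k, j, u, hu, i, hi, rfl⟩
    exact ⟨k, j, u, hu, _, rfl, i, hi, rfl⟩

variable {u : ℝ}

theorem mem_shadowComp (hu : u ∈ shadow1 a C C' μ K k j) : u ∈ shadowComp a C C' μ K k j u :=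
  mem_connectedComponentIn hu

theorem shadowComp_subset : shadowComp a C C' μ K k j u ⊆ shadow1 a C C' μ K k j :=
  connectedComponentIn_subset _ _

theorem bddBelow_shadowComp : BddBelow (shadowComp a C C' μ K k j u) :=
  bddBelow_Icc.mono (shadowComp_subset.trans shadow1_subset)

theorem bddAbove_shadowComp : BddAbove (shadowComp a C C' μ K k j u) :=
  bddAbove_Icc.mono (shadowComp_subset.trans shadow1_subset)

theorem compLen_le (hu : u ∈ shadow1 a C C' μ K k j) :
    compLen a C C' μ K k j u ≤ 4 + 2 * rad μ K := by
  have hne : (shadowComp a C C' μ K k j u).Nonempty := ⟨u, mem_shadowComp hu⟩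
  have h1 : sSup (shadowComp a C C' μ K k j u) ≤ 2 + rad μ K :=
    csSup_le hne fun x hx => (shadow1_subset (shadowComp_subset hx)).2
  have h2 : -2 - rad μ K ≤ sInf (shadowComp a C C' μ K k j u) :=
    le_csInf hne fun x hx => (shadow1_subset (shadowComp_subset hx)).1
  unfold compLen
  linarith

/-- A component contains the whole r-neighbourhood of some point of `shadow0`. -/
theorem two_mul_rad_le_compLen (hr : 0 ≤ rad μ K) (hu : u ∈ shadow1 a C C' μ K k j) :
    2 * rad μ K ≤ compLen a C C' μ K k j u := by
  obtain ⟨u₀, hu₀, h⟩ := hu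
  have hsub : Icc (u₀ - rad μ K) (u₀ + rad μ K) ⊆ shadowComp a C C' μ K k j u := by
    refine isPreconnected_Icc.subset_connectedComponentIn ?_ fun x hx => ⟨u₀, hu₀, ?_⟩
    · have := abs_le.1 h
      exact ⟨by linarith, by linarith⟩
    · exact abs_le.2 ⟨by linarith [hx.1], by linarith [hx.2]⟩
  have h1 := le_csSup bddAbove_shadowComp (hsub (right_mem_Icc.2 (by linarith)))
  have h2 := csInf_le bddBelow_shadowComp (hsub (left_mem_Icc.2 (by linarith)))
  unfold compLen
  linarith

theorem Ioo_subset_shadowComp (hu : u ∈ shadow1 a C C' μ K k j) :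
    Ioo (sInf (shadowComp a C C' μ K k j u)) (sSup (shadowComp a C C' μ K k j u)) ⊆
      shadowComp a C C' μ K k j u := by
  have hne : (shadowComp a C C' μ K k j u).Nonempty := ⟨u, mem_shadowComp hu⟩
  intro x hx
  obtain ⟨y, hy, hyx⟩ := exists_lt_of_csInf_lt hne hx.1
  obtain ⟨y', hy', hyx'⟩ := exists_lt_of_lt_csSup hne hx.2
  exact isPreconnected_connectedComponentIn.ordConnected.out hy hy' ⟨hyx.le, hyx'.le⟩

theorem pieces_pos (hr : 0 < rad μ K) (hK : 1 ≤ K) (hu : u ∈ shadow1 a C C' μ K k j) :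
    0 < pieces K ε' (compLen a C C' μ K k j u) := by
  have := two_mul_rad_le_compLen hr.le hu
  refine Nat.ceil_pos.2 (div_pos (by linarith) ?_)
  have : 0 < K := by linarith
  positivity

/-- With at least two pieces, minimality of their number makes each longer than K^{-ε'}/4 > r; a
single piece is the whole component, of length at least 2r. Prolonging by r therefore reaches only
neighbouring pieces. -/
theorem rad_le_pieceLen (hr : 0 < rad μ K) (hK : 1 ≤ K) (hrK : 2 * rad μ K < K ^ (-ε') / 2)
    (hu : u ∈ shadow1 a C C' μ K k j) : rad μ K ≤ pieceLen a C C' ε' μ K k j u := by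
  have h2 := two_mul_rad_le_compLen hr.le hu
  have hp := pieces_pos (ε' := ε') hr hK hu
  unfold pieceLen
  rw [le_div_iff₀ (by exact_mod_cast hp)]
  rcases Nat.lt_or_ge 1 (pieces K ε' (compLen a C C' μ K k j u)) with h | h
  · have hlt : (pieces K ε' (compLen a C C' μ K k j u) : ℝ) <
        compLen a C C' μ K k j u / (K ^ (-ε') / 2) + 1 :=
      Nat.ceil_lt_add_one (div_nonneg (by linarith) (by linarith))
    have h' : (2 : ℝ) ≤ pieces K ε' (compLen a C C' μ K k j u) := by exact_mod_cast h
    have h3 : (pieces K ε' (compLen a C C' μ K k j u) : ℝ) / 2 <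
        compLen a C C' μ K k j u / (K ^ (-ε') / 2) := by linarith
    rw [lt_div_iff₀ (by linarith)] at h3
    nlinarith
  · have : (pieces K ε' (compLen a C C' μ K k j u) : ℝ) ≤ 1 := by exact_mod_cast h
    nlinarith

end Shadow

/-! ### Bounded overlap -/

section Overlap

variable {a : ℝ × ℝ → ℝ} {C C' ε' μ K : ℝ}

theorem exists_int_offset {x y κ : ℝ} (κ' : ℕ) (h : |x - y| ≤ κ) (hκ : κ + 1 ≤ κ') {n : ℤ}
    (hn : y = n) : ∃ m ∈ Finset.Icc (-(κ' : ℤ)) κ', n = ⌊x⌋ + m := by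
  refine ⟨n - ⌊x⌋, ?_, by ring⟩
  subst hn
  have h1 := Int.floor_le x
  have h2 := Int.lt_floor_add_one x
  have h3 := abs_le.1 h
  rw [Finset.mem_Icc]
  constructor
  · have : (-(κ' : ℝ)) ≤ ((n - ⌊x⌋ : ℤ) : ℝ) := by push_cast; linarith
    exact_mod_cast this
  · have : ((n - ⌊x⌋ : ℤ) : ℝ) ≤ (κ' : ℝ) := by push_cast; linarith
    exact_mod_cast this

/-- A rectangle through `z` is determined, up to bounded integer offsets, by `z`. -/
theorem exists_offsets_of_mem_rectangles (hC : 1 ≤ C) (hC' : 1 ≤ C')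
    (ha : ∀ z ∈ Sig, ∀ w ∈ Sig, |a z - a w| ≤ 1 / 1000 * ‖z - w‖) (hμ : 1 ≤ μ) (hK : 1 ≤ K)
    (hrK : 2 * rad μ K < K ^ (-ε') / 2) {z : ℝ × ℝ} (hz : z ∈ Sig) {L : Set (ℝ × ℝ)}
    (hL : L ∈ rectangles a C C' ε' μ K) (hzL : z ∈ L) {κ : ℕ} (hκ : 1 + (3 + 2 * C') / C + 1 ≤ κ) :
    ∃ m₁ ∈ Finset.Icc (-(κ : ℤ)) κ, ∃ m₂ ∈ Finset.Icc (-2 : ℤ) 2, ∃ m₃ ∈ Finset.Icc (-1 : ℤ) 1,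
    ∃ m₄ ∈ Finset.Icc (-3 : ℤ) 3, ∃ (k j : ℤ) (p : ℝ),
      k = ⌊a z / (C * rad μ K)⌋ + m₁ ∧
      j = ⌊across (level C μ K k) z / (C' * rad μ K)⌋ + m₂ ∧
      p = along (level C μ K k) z + m₃ * (3 / 2 * rad μ K) ∧
      L = rect a C C' ε' μ K k j p
        (⌊(along (level C μ K k) z - sInf (shadowComp a C C' μ K k j p)) /
          pieceLen a C C' ε' μ K k j p⌋ + m₄).toNat := by
  have hr := rad_pos hμ hK
  obtain ⟨k, j, u, hu, i, hi, rfl⟩ := mem_rectangles_iff.1 hL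
  set r := rad μ K with hrdef
  set v := along (level C μ K k) z with hv
  have hd := rad_le_pieceLen hr hK hrK hu
  have hlen := two_mul_rad_le_compLen hr.le hu
  have hp := pieces_pos (ε' := ε') hr hK hu
  have hIoo := Ioo_subset_shadowComp hu
  have hmul : (pieces K ε' (compLen a C C' μ K k j u) : ℝ) * pieceLen a C C' ε' μ K k j u =
      compLen a C C' μ K k j u := mul_div_cancel₀ _ (by exact_mod_cast hp.ne')
  have hlen' : compLen a C C' μ K k j u = sSup (shadowComp a C C' μ K k j u) -
    sInf (shadowComp a C C' μ K k j u) := rfl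
  have hzs := hzL.1
  have hzv := hzL.2
  rw [← hv, ← hrdef] at hzv
  set lo := sInf (shadowComp a C C' μ K k j u) with hlo
  set hh := sSup (shadowComp a C C' μ K k j u) with hhh
  set d := pieceLen a C C' ε' μ K k j u with hddef
  have hi' : (i : ℝ) + 1 ≤ pieces K ε' (compLen a C C' μ K k j u) := by exact_mod_cast hi
  have hd0 : 0 < d := by linarith
  have hvlo : lo - r ≤ v := by nlinarith [hzv.1, mul_nonneg (Nat.cast_nonneg (α := ℝ) i) hd0.le]
  have hvhi : v ≤ hh + r := by nlinarith [hzv.2]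
  -- The point v may lie up to r outside the component, whose length is at least 2r. A shift by 3r/2
  -- towards it lands strictly inside, which names the component in terms of z alone.
  obtain ⟨m₃, hm₃, hpm⟩ : ∃ m₃ ∈ Finset.Icc (-1 : ℤ) 1,
      v + m₃ * (3 / 2 * r) ∈ shadowComp a C C' μ K k j u := by
    rcases le_or_gt v lo with h | h
    · exact ⟨1, by simp, hIoo ⟨by push_cast; linarith, by push_cast; linarith⟩⟩
    · rcases le_or_gt hh v with h' | h'
      · exact ⟨-1, by simp, hIoo ⟨by push_cast; linarith, by push_cast; linarith⟩⟩
      · exact ⟨0, by simp, hIoo ⟨by push_cast; linarith, by push_cast; linarith⟩⟩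
  set p := v + m₃ * (3 / 2 * r) with hpdef
  have hcomp : shadowComp a C C' μ K k j u = shadowComp a C C' μ K k j p :=
    connectedComponentIn_eq hpm
  have hlen_eq : pieceLen a C C' ε' μ K k j p = d := by
    rw [hddef]; unfold pieceLen compLen; rw [hcomp]
  have hrect : rect a C C' ε' μ K k j u i = rect a C C' ε' μ K k j p i := by
    unfold rect; rw [hcomp, hlen_eq]
  obtain ⟨u₀, ⟨w, hw, rfl⟩, hu₀⟩ := shadowComp_subset hpm
  have hm₃' : |(m₃ : ℝ)| ≤ 1 := by
    rw [Finset.mem_Icc] at hm₃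
    rw [abs_le]
    exact ⟨by exact_mod_cast hm₃.1, by exact_mod_cast hm₃.2⟩
  have hpv : |p - v| ≤ 3 / 2 * r := by
    rw [hpdef, add_sub_cancel_left, abs_mul, abs_of_pos (by linarith : 0 < 3 / 2 * r)]
    exact mul_le_of_le_one_left (by linarith) hm₃'
  -- Along the strip w is within r of p, and p within 3r/2 of z; across it both points lie in a
  -- strip of width 2C'r. So z is O(r)-close to the level region and a(z) nearly determines k.
  have hzw : ‖z - w‖ ≤ (3 + 2 * C') * r := by
    refine (norm_le_along_add_across (level C μ K k) _).trans ?_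
    rw [← along_sub, ← across_sub]
    have h1 : |along (level C μ K k) z - along (level C μ K k) w| ≤ 5 / 2 * r := by
      rw [← hv]
      have h1 := abs_le.1 hpv
      have h2 := abs_le.1 hu₀
      exact abs_le.2 ⟨by linarith, by linarith⟩
    have h2 : |across (level C μ K k) z - across (level C μ K k) w| ≤ 2 * (C' * r) := by
      have h1 := hzs
      have h2 := hw.1
      simp only [strip, mem_ofPred_eq, mem_Icc, ← hrdef] at h1 h2
      exact abs_le.2 ⟨by linarith, by linarith⟩
    nlinarith
  have hCr : 0 < C * r := by positivity
  have hC'r : 0 < C' * r := by positivity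
  have hak : |a z / (C * r) - k| ≤ 1 + (3 + 2 * C') / C := by
    have h1 := ha z hz w hw.2.1
    have h2 : |a w - k * (C * r)| < C * r := hw.2.2
    have h3 : |a z - k * (C * r)| ≤ C * r + (3 + 2 * C') * r := by
      have := abs_sub_le (a z) (a w) (k * (C * r))
      linarith [norm_nonneg (z - w)]
    have e : a z / (C * r) - k = (a z - k * (C * r)) / (C * r) := by field_simp
    rw [e, abs_div, abs_of_pos hCr, div_le_iff₀ hCr]
    refine h3.trans_eq ?_
    field_simp
  obtain ⟨m₁, hm₁, hk⟩ := exists_int_offset κ hak hκ rfl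
  have hj : |across (level C μ K k) z / (C' * r) - j| ≤ 1 := by
    have h1 := hzs
    simp only [strip, mem_ofPred_eq, mem_Icc, ← hrdef] at h1
    have e : across (level C μ K k) z / (C' * r) - j =
      (across (level C μ K k) z - j * (C' * r)) / (C' * r) := by field_simp
    rw [e, abs_div, abs_of_pos hC'r, div_le_iff₀ hC'r]
    exact abs_le.2 ⟨by linarith, by linarith⟩
  obtain ⟨m₂, hm₂, hjm⟩ := exists_int_offset 2 hj (by norm_num) rfl
  -- The prolongation r is at most the piece length d.
  have hi2 : |(v - lo) / d - i| ≤ 2 := by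
    have e : (v - lo) / d - i = (v - lo - i * d) / d := by field_simp
    rw [e, abs_div, abs_of_pos hd0, div_le_iff₀ hd0]
    exact abs_le.2 ⟨by nlinarith [hzv.1], by nlinarith [hzv.2]⟩
  obtain ⟨m₄, hm₄, him⟩ := exists_int_offset 3 hi2 (by norm_num) (n := (i : ℤ)) (by simp)
  refine ⟨m₁, hm₁, m₂, hm₂, m₃, hm₃, m₄, hm₄, k, j, p, hk, hjm, rfl, ?_⟩
  rw [hrect, hlen_eq, ← hcomp, ← hlo, ← him, Int.toNat_natCast]

theorem encard_rectangles_le (hC : 1 ≤ C) (hC' : 1 ≤ C')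
    (ha : ∀ z ∈ Sig, ∀ w ∈ Sig, |a z - a w| ≤ 1 / 1000 * ‖z - w‖) (hμ : 1 ≤ μ) (hK : 1 ≤ K)
    (hrK : 2 * rad μ K < K ^ (-ε') / 2) {z : ℝ × ℝ} (hz : z ∈ Sig)
    {κ : ℕ} (hκ : 1 + (3 + 2 * C') / C + 1 ≤ κ) :
    {L | L ∈ rectangles a C C' ε' μ K ∧ z ∈ L}.encard ≤
      ((Finset.Icc (-(κ : ℤ)) κ ×ˢ Finset.Icc (-2 : ℤ) 2 ×ˢ Finset.Icc (-1 : ℤ) 1 ×ˢ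
        Finset.Icc (-3 : ℤ) 3).card : ℕ) := by
  set S := Finset.Icc (-(κ : ℤ)) κ ×ˢ Finset.Icc (-2 : ℤ) 2 ×ˢ Finset.Icc (-1 : ℤ) 1 ×ˢ
        Finset.Icc (-3 : ℤ) 3
  let fk (m : ℤ × ℤ × ℤ × ℤ) : ℤ := ⌊a z / (C * rad μ K)⌋ + m.1
  let fj (m : ℤ × ℤ × ℤ × ℤ) : ℤ :=
    ⌊across (level C μ K (fk m)) z / (C' * rad μ K)⌋ + m.2.1
  let fp (m : ℤ × ℤ × ℤ × ℤ) : ℝ := along (level C μ K (fk m)) z + m.2.2.1 * (3 / 2 * rad μ K)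
  let F (m : ℤ × ℤ × ℤ × ℤ) : Set (ℝ × ℝ) :=
    rect a C C' ε' μ K (fk m) (fj m) (fp m) (⌊(along (level C μ K (fk m)) z -
      sInf (shadowComp a C C' μ K (fk m) (fj m) (fp m))) /
        pieceLen a C C' ε' μ K (fk m) (fj m) (fp m)⌋ + m.2.2.2).toNat
  have hsub : {L | L ∈ rectangles a C C' ε' μ K ∧ z ∈ L} ⊆ F '' (S : Set (ℤ × ℤ × ℤ × ℤ)) := by
    rintro L ⟨hL, hzL⟩
    obtain ⟨m₁, h₁, m₂, h₂, m₃, h₃, m₄, h₄, k, j, p, rfl, rfl, rfl, h⟩ :=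
      exists_offsets_of_mem_rectangles hC hC' ha hμ hK hrK hz hL hzL hκ
    refine ⟨(m₁, m₂, m₃, m₄), ?_, h.symm⟩
    rw [Finset.mem_coe, Finset.mem_product, Finset.mem_product, Finset.mem_product]
    exact ⟨h₁, h₂, h₃, h₄⟩
  exact (encard_le_encard hsub).trans ((encard_image_le _ _).trans_eq (encard_coe_eq_coe_finsetCard S))

theorem encard_famL3_le (hC : 0 < C) (hμ : 1 ≤ μ) (hK : 1 ≤ K) (z : ℝ × ℝ) :
    {L | L ∈ famL3 C μ K ∧ z ∈ L}.encard ≤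
      ((Finset.Icc (-2 : ℤ) 2 ×ˢ Finset.Icc (-2 : ℤ) 2).card : ℕ) := by
  set c := C * (√μ * K ^ (-(1 / 4) : ℝ)) with hc
  have hc0 : 0 < c := by
    have : 0 < √μ := Real.sqrt_pos.2 (by linarith)
    positivity
  let F (m : ℤ × ℤ) : Set (ℝ × ℝ) :=
    square ((⌊z.1 / (c / 2)⌋ + m.1 : ℤ) * (c / 2), (⌊z.2 / (c / 2)⌋ + m.2 : ℤ) * (c / 2)) c
  have hsub : {L | L ∈ famL3 C μ K ∧ z ∈ L} ⊆
      F '' ((Finset.Icc (-2 : ℤ) 2 ×ˢ Finset.Icc (-2 : ℤ) 2 : Finset (ℤ × ℤ)) : Set (ℤ × ℤ)) := by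
    rintro L ⟨⟨m, n, c', rfl, rfl, -⟩, hzL⟩
    rw [← hc] at hzL ⊢
    have key (x : ℝ) (m : ℤ) (hx : x ∈ Icc (m * (c / 2) - c / 2) (m * (c / 2) + c / 2)) :
        |x / (c / 2) - m| ≤ 1 := by
      have e : x / (c / 2) - m = (x - m * (c / 2)) / (c / 2) := by field_simp
      rw [e, abs_div, abs_of_pos (half_pos hc0), div_le_iff₀ (half_pos hc0)]
      exact abs_le.2 ⟨by linarith [hx.1], by linarith [hx.2]⟩
    obtain ⟨m₁, h₁, e₁⟩ := exists_int_offset 2 (key _ _ hzL.1) (by norm_num) rfl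
    obtain ⟨m₂, h₂, e₂⟩ := exists_int_offset 2 (key _ _ hzL.2) (by norm_num) rfl
    refine ⟨(m₁, m₂), by
      rw [Finset.mem_coe, Finset.mem_product]; exact ⟨h₁, h₂⟩, ?_⟩
    simp only [F]
    rw [← e₁, ← e₂]
  exact (encard_le_encard hsub).trans ((encard_image_le _ _).trans_eq (encard_coe_eq_coe_finsetCard _))

/-- Needed because A of the swapped phase is identified with B only on `openSig2`, not on the whole
plane. -/
theorem rectangles_congr {a' : ℝ × ℝ → ℝ} (h : ∀ z ∈ Sig, a z = a' z) :
    rectangles a C C' ε' μ K = rectangles a' C C' ε' μ K := by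
  have e (k : ℤ) : levelRegion a C μ K k = levelRegion a' C μ K k := by
    ext z
    constructor
    · rintro ⟨h1, h2⟩; exact ⟨h1, by rwa [← h z h1]⟩
    · rintro ⟨h1, h2⟩; exact ⟨h1, by rwa [h z h1]⟩
  have e1 (k j : ℤ) : shadow1 a C C' μ K k j = shadow1 a' C C' μ K k j := by
    unfold shadow1 shadow0; rw [e]
  unfold rectangles
  simp only [e1]

theorem famL2_eq {M : ℕ} {φ : ℝ × ℝ → ℝ} (hφ : IsHyp M φ) :
    famL2 φ C C' ε' μ K =
      (fun L => Prod.swap ⁻¹' L) '' famL1 (φ ∘ Prod.swap) C C' ε' μ K := by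
  unfold famL2 famL1
  rw [rectangles_congr fun z hz => (fA_comp_swap hφ (Sig_subset_openSig2 hz)).symm]

/-- An intersection containing z is formed from members of 𝓛 containing z. Their number is bounded,
hence so is the number of sets of them. -/
theorem exists_overlapBound (hC : 1 ≤ C) (hC' : 1 ≤ C') : ∃ N : ℕ, OverlapBound C C' N := by
  obtain ⟨κ, hκ⟩ := exists_nat_ge (1 + (3 + 2 * C') / C + 1)
  set n₁ := (Finset.Icc (-(κ : ℤ)) κ ×ˢ Finset.Icc (-2 : ℤ) 2 ×ˢ Finset.Icc (-1 : ℤ) 1 ×ˢ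
    Finset.Icc (-3 : ℤ) 3).card
  set n₃ := (Finset.Icc (-2 : ℤ) 2 ×ˢ Finset.Icc (-2 : ℤ) 2).card
  refine ⟨2 ^ (n₁ + n₁ + n₃), fun φ hφ μ K ε' hμ hK hε' hrK z hz => ?_⟩
  have lip {φ : ℝ × ℝ → ℝ} (hφ : IsHyp 3 φ) :
      ∀ z ∈ Sig, ∀ w ∈ Sig, |fA φ z - fA φ w| ≤ 1 / 1000 * ‖z - w‖ := fun z hz w hw =>
    hφ.fA_lip (Sig_subset_openSig2 hz) (Sig_subset_openSig2 hw)
  have h1 : {L | L ∈ famL1 φ C C' ε' μ K ∧ z ∈ L}.encard ≤ n₁ :=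
    encard_rectangles_le hC hC' (lip hφ) hμ hK hrK hz hκ
  have h2 : {L | L ∈ famL2 φ C C' ε' μ K ∧ z ∈ L}.encard ≤ n₁ := by
    have h := encard_rectangles_le hC hC' (lip hφ.comp_swap) hμ hK hrK (swap_mem_Sig hz) hκ
    refine le_trans (encard_le_encard ?_) ((encard_image_le (fun L => Prod.swap ⁻¹' L) _).trans h)
    rintro L ⟨hL, hzL⟩
    rw [famL2_eq hφ] at hL
    obtain ⟨L, hL, rfl⟩ := hL
    exact ⟨L, ⟨hL, hzL⟩, rfl⟩
  have h3 : {L | L ∈ famL3 C μ K ∧ z ∈ L}.encard ≤ n₃ :=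
    encard_famL3_le (by linarith) hμ hK z
  set G := {L | L ∈ famL φ C C' ε' μ K ∧ z ∈ L} with hG
  have hGle : G.encard ≤ (n₁ + n₁ + n₃ : ℕ) := by
    have e : G = {L | L ∈ famL1 φ C C' ε' μ K ∧ z ∈ L} ∪ {L | L ∈ famL2 φ C C' ε' μ K ∧ z ∈ L} ∪
        {L | L ∈ famL3 C μ K ∧ z ∈ L} := by
      ext L
      simp only [hG, famL, mem_ofPred_eq, mem_union]
      tauto
    rw [e]
    push_cast
    exact (encard_union_le _ _).trans (add_le_add ((encard_union_le _ _).trans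
      (add_le_add h1 h2)) h3)
  have hfin : G.Finite := finite_of_encard_le_coe hGle
  have hsub : {Δ | Δ ∈ famLbar φ C C' ε' μ K ∧ z ∈ Δ} ⊆
      (fun S : Finset (Set (ℝ × ℝ)) => ⋂₀ (S : Set (Set (ℝ × ℝ)))) ''
        (hfin.toFinset.powerset : Set (Finset (Set (ℝ × ℝ)))) := by
    rintro _ ⟨⟨S, -, hS, rfl⟩, hzS⟩
    refine ⟨S, ?_, rfl⟩
    rw [Finset.mem_coe, Finset.mem_powerset]
    intro L hL
    exact hfin.mem_toFinset.2 ⟨hS hL, hzS L hL⟩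
  refine (encard_le_encard hsub).trans ((encard_image_le _ _).trans ?_)
  rw [encard_coe_eq_coe_finsetCard, Finset.card_powerset]
  rw [hfin.encard_eq_coe_toFinset_card] at hGle
  exact_mod_cast Nat.pow_le_pow_right (by norm_num) (by exact_mod_cast hGle)

end Overlap

/-! ### Derivative bounds for the slope field of the level curves -/

theorem exists_bound_iteratedFDerivWithin_inv (N : ℕ) : ∃ B : ℝ, 0 ≤ B ∧ ∀ i ≤ N,
    ∀ x ∈ Icc (1 / 2 : ℝ) 2, ‖iteratedFDerivWithin ℝ i (fun x : ℝ => x⁻¹) (Ioi 0) x‖ ≤ B := by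
  have hc : ContDiffOn ℝ N (fun x : ℝ => x⁻¹) (Ioi 0) :=
    contDiffOn_id.inv fun x hx => ne_of_gt hx
  have h (i : ℕ) (hi : i ≤ N) : ∃ B : ℝ, ∀ x ∈ Icc (1 / 2 : ℝ) 2,
      ‖iteratedFDerivWithin ℝ i (fun x : ℝ => x⁻¹) (Ioi 0) x‖ ≤ B :=
    isCompact_Icc.exists_bound_of_continuousOn
      ((hc.continuousOn_iteratedFDerivWithin (by exact_mod_cast hi)
        isOpen_Ioi.uniqueDiffOn).mono fun x hx => lt_of_lt_of_le (by norm_num) hx.1)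
  choose! B hB using h
  refine ⟨∑ i ∈ Finset.range (N + 1), |B i|, Finset.sum_nonneg fun _ _ => abs_nonneg _,
    fun i hi x hx => ((hB i hi x hx).trans (le_abs_self _)).trans ?_⟩
  exact Finset.single_le_sum (f := fun i => |B i|) (fun _ _ => abs_nonneg _)
    (Finset.mem_range.2 (by omega))

/-- Quotients of functions with bounded derivatives have bounded derivatives. -/
theorem exists_bound_iteratedFDerivWithin_div (N : ℕ) (B : ℝ) (hB : 1 ≤ B) :
    ∃ D : ℝ, ∀ u v : ℝ × ℝ → ℝ, ContDiffOn ℝ N u openSig2 → ContDiffOn ℝ N v openSig2 →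
      (∀ z ∈ openSig2, v z ∈ Icc (1 / 2 : ℝ) 2) →
      (∀ i ≤ N, ∀ z ∈ openSig2, ‖iteratedFDerivWithin ℝ i u openSig2 z‖ ≤ B) →
      (∀ i ≤ N, ∀ z ∈ openSig2, ‖iteratedFDerivWithin ℝ i v openSig2 z‖ ≤ B) →
      ∀ i ≤ N, ∀ z ∈ openSig2,
        ‖iteratedFDerivWithin ℝ i (fun z => u z * (v z)⁻¹) openSig2 z‖ ≤ D := by
  obtain ⟨E, hE0, hE⟩ := exists_bound_iteratedFDerivWithin_inv N
  have hu := isOpen_openSig2.uniqueDiffOn (𝕜 := ℝ)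
  refine ⟨∑ i ∈ Finset.range (N + 1), (2 : ℝ) ^ N * B * (N.factorial * E * B ^ N),
    fun u v hcu hcv hv hub hvb n hn z hz => ?_⟩
  have hmaps : MapsTo v openSig2 (Ioi 0) := fun z hz => lt_of_lt_of_le (by norm_num) (hv z hz).1
  have hinv : ContDiffOn ℝ N (fun x : ℝ => x⁻¹) (Ioi 0) :=
    contDiffOn_id.inv fun x hx => ne_of_gt hx
  have h1 (i : ℕ) (hi : i ≤ N) :
      ‖iteratedFDerivWithin ℝ i (fun z => (v z)⁻¹) openSig2 z‖ ≤ N.factorial * E * B ^ N := by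
    have := norm_iteratedFDerivWithin_comp_le hinv hcv (n := i) (by exact_mod_cast hi)
      isOpen_Ioi.uniqueDiffOn hu hmaps hz (C := E) (D := B)
      (fun j hj => hE j (hj.trans hi) _ (hv z hz))
      (fun j hj hj' => (hvb j (hj'.trans hi) z hz).trans (le_self_pow₀ hB (by omega)))
    refine this.trans ?_
    gcongr
  refine (norm_iteratedFDerivWithin_mul_le hcu (hinv.comp hcv hmaps) hu hz
    (n := n) (by exact_mod_cast hn)).trans ?_
  refine (Finset.sum_le_sum (g := fun _ => (2 : ℝ) ^ N * B * (N.factorial * E * B ^ N))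
    fun i hi => ?_).trans ?_
  · rw [Finset.mem_range] at hi
    have : ((n.choose i : ℕ) : ℝ) ≤ 2 ^ N := by
      exact_mod_cast (Nat.choose_le_two_pow n i).trans (Nat.pow_le_pow_right (by norm_num) hn)
    gcongr
    · exact hub i (by omega) z hz
    · exact h1 _ (by omega)
  · exact Finset.sum_le_sum_of_subset_of_nonneg (Finset.range_mono (by omega))
      fun _ _ _ => by positivity

/-- The interval over which the level curves are considered. -/
def curveDom : Set ℝ := Ioo (-(3 / 2)) (3 / 2)

theorem isOpen_curveDom : IsOpen curveDom := isOpen_Ioo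

theorem norm_iteratedFDerivWithin_id_le {i : ℕ} (hi : 1 ≤ i) {y : ℝ} (hy : y ∈ curveDom) :
    ‖iteratedFDerivWithin ℝ i (fun y : ℝ => y) curveDom y‖ ≤ 1 := by
  rw [norm_iteratedFDerivWithin_eq_norm_iteratedDerivWithin]
  have := iteratedDerivWithin_id (n := i) hy isOpen_curveDom.uniqueDiffOn
  change iteratedDerivWithin i (fun y => y) curveDom y = _ at this
  rw [this]
  split_ifs with h1 h2 <;> simp
  omega

/-- Integral curves of a field with bounded derivatives have bounded derivatives. -/
theorem exists_bound_integralCurve (N : ℕ) (B : ℝ) : ∀ n ≤ N, ∃ D : ℝ, 1 ≤ D ∧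
    ∀ (V : ℝ × ℝ → ℝ) (g : ℝ → ℝ), ContDiffOn ℝ N V openSig2 →
      (∀ i ≤ N, ∀ z ∈ openSig2, ‖iteratedFDerivWithin ℝ i V openSig2 z‖ ≤ B) →
      ContDiffOn ℝ (N + 1 : ℕ) g curveDom → MapsTo (fun y => (g y, y)) curveDom openSig2 →
      (∀ y ∈ curveDom, HasDerivAt g (V (g y, y)) y) →
      ∀ i, 1 ≤ i → i ≤ n + 1 → ∀ y ∈ curveDom, ‖iteratedFDerivWithin ℝ i g curveDom y‖ ≤ D := by
  have hu := isOpen_curveDom.uniqueDiffOn (𝕜 := ℝ)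
  -- The equation g' = V(g, y) trades one derivative of g for the composition with V, and so drives
  -- the induction on the order.
  have succ (V : ℝ × ℝ → ℝ) (g : ℝ → ℝ)
      (hd : ∀ y ∈ curveDom, HasDerivAt g (V (g y, y)) y) (i : ℕ) {y : ℝ} (hy : y ∈ curveDom) :
      ‖iteratedFDerivWithin ℝ (i + 1) g curveDom y‖ =
        ‖iteratedFDerivWithin ℝ i (V ∘ fun y => (g y, y)) curveDom y‖ := by
    rw [norm_iteratedFDerivWithin_eq_norm_iteratedDerivWithin,
      norm_iteratedFDerivWithin_eq_norm_iteratedDerivWithin, iteratedDerivWithin_succ',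
      iteratedDerivWithin_congr (g := V ∘ fun y => (g y, y)) (fun t ht => ?_) hy]
    exact (hd t ht).hasDerivWithinAt.derivWithin (hu t ht)
  intro n
  induction n with
  | zero =>
    refine fun _ => ⟨|B| + 1, by linarith [abs_nonneg B], fun V g _ hV _ hm hd i h1 h2 y hy => ?_⟩
    obtain rfl : i = 0 + 1 := by omega
    rw [succ V g hd 0 hy, norm_iteratedFDerivWithin_zero]
    have := hV 0 (Nat.zero_le _) _ (hm hy)
    rw [norm_iteratedFDerivWithin_zero] at this
    rw [Function.comp_apply]
    linarith [le_abs_self B]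
  | succ n ih =>
    intro hn
    obtain ⟨D, hD1, hD⟩ := ih (by omega)
    refine ⟨D + (n + 1).factorial * |B| * D ^ (n + 1), le_add_of_le_of_nonneg hD1 (by positivity),
      fun V g hVc hV hg hm hd i h1 h2 y hy => ?_⟩
    have hB := hD V g hVc hV hg hm hd
    rcases Nat.lt_or_ge i (n + 2) with h | h
    · exact (hB i h1 (by omega) y hy).trans (le_add_of_nonneg_right (by positivity))
    · obtain rfl : i = n + 1 + 1 := by omega
      rw [succ V g hd _ hy]
      have hγ : ContDiffOn ℝ N (fun y => (g y, y)) curveDom :=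
        (hg.of_le (by norm_cast; omega)).prodMk contDiffOn_id
      -- The Faà di Bruno bound for order n + 1 of the composition uses the curve only up to order n
      -- + 1, which the induction hypothesis covers.
      refine (norm_iteratedFDerivWithin_comp_le hVc hγ (n := n + 1) (by exact_mod_cast hn)
        (isOpen_openSig2.uniqueDiffOn) hu hm hy (C := |B|) (D := D)
        (fun j hj => (hV j (by omega) _ (hm hy)).trans (le_abs_self B)) fun j hj hj' => ?_).trans
        (le_add_of_nonneg_left (by linarith))
      rw [iteratedFDerivWithin_prodMk (n := N) ((hg.of_le (by norm_cast; omega)) y hy)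
        contDiffWithinAt_fun_id hu hy (by norm_cast; omega), ContinuousMultilinearMap.opNorm_prod]
      refine (max_le (hB j hj hj' y hy) ?_).trans (le_self_pow₀ hD1 (by omega))
      exact (norm_iteratedFDerivWithin_id_le hj hy).trans hD1

/-! ### Level curves -/

/-- `φ_y - A φ_x`, whose level curves carry the caps that are not separated. -/
def levelFun (φ : ℝ × ℝ → ℝ) (A : ℝ) (z : ℝ × ℝ) : ℝ := dy φ z - A * dx φ z

/-- The `x`-derivative of `levelFun`. -/
def levelFunX (φ : ℝ × ℝ → ℝ) (A : ℝ) (z : ℝ × ℝ) : ℝ := dx (dy φ) z - A * dx (dx φ) z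

/-- The `y`-derivative of `levelFun`. -/
def levelFunY (φ : ℝ × ℝ → ℝ) (A : ℝ) (z : ℝ × ℝ) : ℝ := dy (dy φ) z - A * dy (dx φ) z

section Level

variable {M : ℕ} {φ : ℝ × ℝ → ℝ} {A : ℝ}

theorem levelFunX_mem (hφ : IsHyp M φ) (hA : |A| ≤ 1 / 1000) {z : ℝ × ℝ} (hz : z ∈ openSig2) :
    levelFunX φ A z ∈ Icc (99 / 100 : ℝ) (101 / 100) := by
  have h1 := abs_le.1 (hφ.abs_dxy_sub_one_le hz)
  have h2 : |A * dx (dx φ) z| ≤ 1 / 1000 * (1 / 5000) := by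
    rw [abs_mul]
    exact mul_le_mul hA (hφ.abs_dxx_le hz) (abs_nonneg _) (by norm_num)
  have h3 := abs_le.1 h2
  unfold levelFunX
  constructor <;> linarith

theorem levelFun_sub_sub_le (hφ : IsHyp M φ) (hA : |A| ≤ 1 / 1000) {z w : ℝ × ℝ}
    (hz : z ∈ openSig2) (hw : w ∈ openSig2) :
    |levelFun φ A z - levelFun φ A w - (z.1 - w.1)| ≤ 3 / 1000 * ‖z - w‖ := by
  have h1 := hφ.dy_lip hz hw
  have h2 := hφ.dx_lip hz hw
  have h3 : |z.2 - w.2| ≤ ‖z - w‖ := norm_snd_le (z - w)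
  have h4 : |dx φ z - dx φ w| ≤ 2 * ‖z - w‖ := by
    have := abs_add_le (dx φ z - dx φ w - (z.2 - w.2)) (z.2 - w.2)
    rw [sub_add_cancel] at this
    linarith [norm_nonneg (z - w)]
  have h5 : |A * (dx φ z - dx φ w)| ≤ 1 / 1000 * (2 * ‖z - w‖) := by
    rw [abs_mul]
    exact mul_le_mul hA h4 (abs_nonneg _) (by norm_num)
  have e : levelFun φ A z - levelFun φ A w - (z.1 - w.1) =
      (dy φ z - dy φ w - (z.1 - w.1)) - A * (dx φ z - dx φ w) := by
    unfold levelFun; ring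
  rw [e]
  refine (abs_sub _ _).trans ?_
  linarith

/-- The function is x up to a small Lipschitz error, hence injective on horizontal lines with
Lipschitz inverse. This gives both uniqueness of the level curve and the distance to it. -/
theorem abs_sub_le_levelFun (hφ : IsHyp M φ) (hA : |A| ≤ 1 / 1000) {x x' y : ℝ}
    (hz : (x, y) ∈ openSig2) (hw : (x', y) ∈ openSig2) :
    |x - x'| ≤ 2 * |levelFun φ A (x, y) - levelFun φ A (x', y)| := by
  have h := levelFun_sub_sub_le hφ hA hz hw
  have hn : ‖((x, y) : ℝ × ℝ) - (x', y)‖ = |x - x'| := by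
    simp [Prod.norm_def]
  rw [hn] at h
  have := abs_sub_abs_le_abs_sub (x - x') (levelFun φ A (x, y) - levelFun φ A (x', y))
  rw [abs_sub_comm (x - x')] at this
  linarith [abs_nonneg (x - x')]

theorem contDiffOn_levelFun (hφ : IsHyp M φ) :
    ContDiffOn ℝ (M - 1 : ℕ) (levelFun φ A) openSig2 :=
  (hφ.contDiffOn_pd (0, 1)).sub (contDiffOn_const.mul (hφ.contDiffOn_pd (1, 0)))

theorem hasFDerivAt_levelFun (hφ : IsHyp M φ) {z : ℝ × ℝ} (hz : z ∈ openSig2) :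
    HasFDerivAt (levelFun φ A) (levelFunX φ A z • ContinuousLinearMap.fst ℝ ℝ ℝ +
      levelFunY φ A z • ContinuousLinearMap.snd ℝ ℝ ℝ) z := by
  have h := (hφ.differentiableAt_dy hz).hasFDerivAt.sub
    ((hφ.differentiableAt_dx hz).hasFDerivAt.const_mul A)
  convert! h using 1
  ext
  · simp [levelFunX, dx]
  · simp [levelFunY, dy]

theorem exists_levelCurve_point (hφ : IsHyp M φ) (hA : |A| ≤ 1 / 1000) {z₁ : ℝ × ℝ}
    (hz₁ : z₁ ∈ Sig) {y : ℝ} (hy : y ∈ curveDom) :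
    ∃ x ∈ curveDom, levelFun φ A (x, y) = levelFun φ A z₁ := by
  have hmem {x : ℝ} (hx : x ∈ Icc (-(7 / 5) : ℝ) (7 / 5)) : (x, y) ∈ openSig2 :=
    ⟨⟨by linarith [hx.1], by linarith [hx.2]⟩, ⟨by linarith [hy.1], by linarith [hy.2]⟩⟩
  have hcont : ContinuousOn (fun x => levelFun φ A (x, y)) (Icc (-(7 / 5)) (7 / 5)) :=
    (contDiffOn_levelFun hφ).continuousOn.comp (by fun_prop) fun x hx => hmem hx
  -- The error 3/100 is smaller than 7/5 - 1, so the values at x = ±7/5 lie on both sides of the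
  -- value at z₁.
  have hn {x : ℝ} (hx : x ∈ Icc (-(7 / 5) : ℝ) (7 / 5)) :
      |levelFun φ A (x, y) - levelFun φ A z₁ - (x - z₁.1)| ≤ 3 / 100 := by
    refine (levelFun_sub_sub_le hφ hA (hmem hx) (Sig_subset_openSig2 hz₁)).trans ?_
    have := norm_sub_le ((x, y) : ℝ × ℝ) z₁
    linarith [norm_le_of_mem_openSig2 (hmem hx), norm_le_one_of_mem_Sig hz₁]
  have h1 := abs_le.1 (hn (left_mem_Icc.2 (by norm_num)))
  have h2 := abs_le.1 (hn (right_mem_Icc.2 (by norm_num)))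
  obtain ⟨x, hx, h⟩ := intermediate_value_Icc (by norm_num) hcont
    (show levelFun φ A z₁ ∈ Icc _ _ from
      ⟨by linarith [hz₁.1.1, hz₁.1.2], by linarith [hz₁.1.1, hz₁.1.2]⟩)
  exact ⟨x, ⟨by linarith [hx.1], by linarith [hx.2]⟩, h⟩

/-- Here g is only a pointwise choice of solutions. The implicit function theorem gives a smooth
local solution, and uniqueness on horizontal lines forces g to coincide with it. -/
theorem contDiffAt_levelCurve (hφ : IsHyp M φ) (hA : |A| ≤ 1 / 1000) {g : ℝ → ℝ} {c : ℝ}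
    (hg : ∀ y ∈ curveDom, g y ∈ curveDom ∧ levelFun φ A (g y, y) = c) {y : ℝ}
    (hy : y ∈ curveDom) : ContDiffAt ℝ (M - 1 : ℕ) g y := by
  have h3 := hφ.three_le
  have hmem {y : ℝ} (hy : y ∈ curveDom) {x : ℝ} (hx : x ∈ curveDom) : (x, y) ∈ openSig2 :=
    ⟨⟨by linarith [hx.1], by linarith [hx.2]⟩, ⟨by linarith [hy.1], by linarith [hy.2]⟩⟩
  have hz := hmem hy (hg y hy).1
  have hc : ContDiffAt ℝ (M - 1 : ℕ) (levelFun φ A ∘ Prod.swap) (y, g y) := by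
    refine ContDiffAt.comp _ ?_ (ContinuousLinearEquiv.prodComm ℝ ℝ ℝ).contDiff.contDiffAt
    exact ((contDiffOn_levelFun hφ) _ hz).contDiffAt (isOpen_openSig2.mem_nhds hz)
  have hpn : ((M - 1 : ℕ) : WithTop ℕ∞) ≠ 0 := by exact_mod_cast (show M - 1 ≠ 0 by omega)
  have hX : levelFunX φ A (g y, y) ≠ 0 := by
    have := (levelFunX_mem hφ hA hz).1
    intro h0
    linarith
  have hinv : (fderiv ℝ (levelFun φ A ∘ Prod.swap) (y, g y) ∘L
      ContinuousLinearMap.inr ℝ ℝ ℝ).IsInvertible := by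
    refine ⟨ContinuousLinearEquiv.unitsEquivAut ℝ (Units.mk0 _ hX), ?_⟩
    have hd : HasFDerivAt (levelFun φ A ∘ Prod.swap) _ (y, g y) :=
      (hasFDerivAt_levelFun (A := A) hφ hz).comp (y, g y)
      (ContinuousLinearEquiv.prodComm ℝ ℝ ℝ).hasFDerivAt
    rw [hd.fderiv]
    ext
    simp
  set ψ := hc.implicitFunction hpn hinv with hψ
  have hψc : ContDiffAt ℝ (M - 1 : ℕ) ψ y := hc.contDiffAt_implicitFunction hpn hinv
  have hψy : ψ y = g y := hc.implicitFunction_apply_self hpn hinv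
  have hψe : ∀ᶠ t in nhds y, (levelFun φ A ∘ Prod.swap) (t, ψ t) =
      (levelFun φ A ∘ Prod.swap) (y, g y) := hc.eventually_apply_implicitFunction hpn hinv
  refine hψc.congr_of_eventuallyEq ?_
  have hψd : ∀ᶠ t in nhds y, ψ t ∈ curveDom :=
    hψc.continuousAt.eventually (isOpen_curveDom.mem_nhds (by rw [hψy]; exact (hg y hy).1))
  filter_upwards [hψe, hψd, isOpen_curveDom.mem_nhds hy] with t h1 h2 h3
  have h4 : levelFun φ A (ψ t, t) = levelFun φ A (g y, y) := h1
  have h5 := abs_sub_le_levelFun hφ hA (hmem h3 (hg t h3).1) (hmem h3 h2)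
  rw [h4, (hg t h3).2, (hg y hy).2, sub_self, abs_zero, mul_zero] at h5
  exact sub_eq_zero.1 (abs_nonpos_iff.1 h5)

/-- The slope of the level curves. -/
def slope (φ : ℝ × ℝ → ℝ) (A : ℝ) (z : ℝ × ℝ) : ℝ := -levelFunY φ A z * (levelFunX φ A z)⁻¹

theorem curve_mem {x y : ℝ} (hx : x ∈ curveDom) (hy : y ∈ curveDom) : (x, y) ∈ openSig2 :=
  ⟨⟨by linarith [hx.1], by linarith [hx.2]⟩, ⟨by linarith [hy.1], by linarith [hy.2]⟩⟩

theorem hasDerivAt_levelCurve (hφ : IsHyp M φ) (hA : |A| ≤ 1 / 1000) {g : ℝ → ℝ} {c : ℝ}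
    (hg : ∀ y ∈ curveDom, g y ∈ curveDom ∧ levelFun φ A (g y, y) = c) {y : ℝ}
    (hy : y ∈ curveDom) : HasDerivAt g (slope φ A (g y, y)) y := by
  have h3 := hφ.three_le
  have hz := curve_mem (hg y hy).1 hy
  have hd : HasDerivAt g (deriv g y) y := ((contDiffAt_levelCurve hφ hA hg hy).differentiableAt
    (by exact_mod_cast (show M - 1 ≠ 0 by omega))).hasDerivAt
  have h1 := HasFDerivAt.comp_hasDerivAt (f := fun t => (g t, t)) y
    (hasFDerivAt_levelFun (A := A) hφ hz) (hd.prodMk (hasDerivAt_id y))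
  have h2 : HasDerivAt (levelFun φ A ∘ fun t => (g t, t)) 0 y := by
    refine (hasDerivAt_const y c).congr_of_eventuallyEq ?_
    filter_upwards [isOpen_curveDom.mem_nhds hy] with t ht
    exact (hg t ht).2
  have h4 := h1.unique h2
  simp at h4
  have hX : levelFunX φ A (g y, y) ≠ 0 := by
    have := (levelFunX_mem hφ hA hz).1
    intro h0
    linarith
  have : deriv g y = slope φ A (g y, y) := by
    unfold slope
    field_simp
    linarith
  rwa [this] at hd

/-- The left side is minus the polynomial φ_xx A² - 2φ_xy A + φ_yy in the constant A. As `fA` is a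
root at z, the factor A - `fA` splits off. -/
theorem slope_add_eq (hφ : IsHyp M φ) {z : ℝ × ℝ} (hz : z ∈ openSig2) (hX : levelFunX φ A z ≠ 0) :
    (slope φ A z + A) * levelFunX φ A z =
      (A - fA φ z) * (2 * dx (dy φ) z - dx (dx φ) z * (A + fA φ z)) := by
  have h := hφ.fA_root hz
  have e : (slope φ A z + A) * levelFunX φ A z = -levelFunY φ A z + A * levelFunX φ A z := by
    unfold slope
    field_simp
  rw [e]
  unfold levelFunX levelFunY
  rw [hφ.dyx_eq hz]
  linear_combination -h

/-- The cofactor is about 2 and the x-derivative about 1. The upper bound places non-separated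
points where the slope is nearly -A; the lower bound converts straightness of the curve back into
constancy of `fA`. -/
theorem slope_add_bounds (hφ : IsHyp M φ) (hA : |A| ≤ 1 / 1000) {z : ℝ × ℝ} (hz : z ∈ openSig2) :
    |fA φ z - A| ≤ |slope φ A z + A| ∧ |slope φ A z + A| ≤ 3 * |fA φ z - A| := by
  have hX := levelFunX_mem hφ hA hz
  have e := slope_add_eq (A := A) hφ hz (by linarith [hX.1])
  have h1 := abs_le.1 (hφ.abs_dxx_le hz)
  have h2 := abs_le.1 (hφ.abs_dxy_sub_one_le hz)
  have h3 := abs_le.1 (hφ.abs_fA_le hz)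
  have h4 := abs_le.1 hA
  have h5 : |dx (dx φ) z * (A + fA φ z)| ≤ 1 / 5000 * (2 / 1000) := by
    rw [abs_mul]
    exact mul_le_mul (hφ.abs_dxx_le hz) (abs_le.2 ⟨by linarith, by linarith⟩) (abs_nonneg _)
      (by norm_num)
  have h6 := abs_le.1 h5
  have e' := congrArg abs e
  rw [abs_mul, abs_mul, abs_sub_comm A, abs_of_pos (by linarith [hX.1] : 0 < levelFunX φ A z),
    abs_of_pos (by linarith : 0 < 2 * dx (dy φ) z - dx (dx φ) z * (A + fA φ z))] at e'
  set X := levelFunX φ A z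
  set Y := 2 * dx (dy φ) z - dx (dx φ) z * (A + fA φ z)
  have hY1 : 199 / 100 ≤ Y := by linarith
  have hY2 : Y ≤ 201 / 100 := by linarith
  constructor
  · nlinarith [hX.2, abs_nonneg (slope φ A z + A), abs_nonneg (fA φ z - A)]
  · nlinarith [hX.1, abs_nonneg (slope φ A z + A), abs_nonneg (fA φ z - A)]

theorem contDiffOn_levelFunX (hφ : IsHyp M φ) :
    ContDiffOn ℝ (M - 2 : ℕ) (levelFunX φ A) openSig2 :=
  (hφ.contDiffOn_pd_pd (1, 0) (0, 1)).sub
    (contDiffOn_const.mul (hφ.contDiffOn_pd_pd (1, 0) (1, 0)))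

theorem contDiffOn_levelFunY (hφ : IsHyp M φ) :
    ContDiffOn ℝ (M - 2 : ℕ) (levelFunY φ A) openSig2 :=
  (hφ.contDiffOn_pd_pd (0, 1) (0, 1)).sub
    (contDiffOn_const.mul (hφ.contDiffOn_pd_pd (0, 1) (1, 0)))

theorem norm_iteratedFDerivWithin_sub_mul_le {u v : ℝ × ℝ → ℝ} {n : ℕ} {B : ℝ}
    (hA : |A| ≤ 1 / 1000) (hu : ContDiffOn ℝ n u openSig2) (hv : ContDiffOn ℝ n v openSig2)
    {z : ℝ × ℝ} (hz : z ∈ openSig2) (hub : ‖iteratedFDerivWithin ℝ n u openSig2 z‖ ≤ B)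
    (hvb : ‖iteratedFDerivWithin ℝ n v openSig2 z‖ ≤ B) :
    ‖iteratedFDerivWithin ℝ n (fun z => u z - A * v z) openSig2 z‖ ≤ 2 * B := by
  have hd := isOpen_openSig2.uniqueDiffOn (𝕜 := ℝ)
  have h1 := iteratedFDerivWithin_const_smul_apply (a := A) (hv z hz) hd hz
  have h2 := iteratedFDerivWithin_sub_apply (f := u) (g := A • v) (hu z hz)
    ((hv.const_smul A) z hz) hd hz
  change iteratedFDerivWithin ℝ n (fun z => u z - A * v z) openSig2 z = _ at h2
  rw [h2, h1]
  refine (norm_sub_le _ _).trans ?_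
  rw [norm_smul, Real.norm_eq_abs]
  nlinarith [norm_nonneg (iteratedFDerivWithin ℝ n v openSig2 z), abs_nonneg A]

/-- Order zero comes from the closeness of the Hessian to its value at the origin, positive orders
from the bounds in `IsHyp`. -/
theorem abs_second_le (hφ : IsHyp M φ) {n : ℕ} (hn : n ≤ M - 2) {z : ℝ × ℝ} (hz : z ∈ openSig2) :
    ∀ e ∈ ({(1, 0), (0, 1)} : Set (ℝ × ℝ)), ∀ e' ∈ ({(1, 0), (0, 1)} : Set (ℝ × ℝ)),
      ‖iteratedFDerivWithin ℝ n (pd e (pd e' φ)) openSig2 z‖ ≤ 2 ^ M := by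
  have h3 := hφ.three_le
  intro e he e' he'
  have hM : (2 : ℝ) ≤ 2 ^ M := by
    calc (2 : ℝ) = 2 ^ 1 := by norm_num
      _ ≤ 2 ^ M := pow_le_pow_right₀ (by norm_num) (by omega)
  rcases Nat.eq_zero_or_pos n with rfl | h
  · rw [norm_iteratedFDerivWithin_zero, Real.norm_eq_abs]
    refine le_trans ?_ hM
    have h1 := hφ.abs_dxx_le hz
    have h2 := hφ.abs_dyy_le hz
    have h4 := abs_le.1 (hφ.abs_dxy_sub_one_le hz)
    have h5 := hφ.dyx_eq hz
    have h6 : |dx (dy φ) z| ≤ 2 := abs_le.2 ⟨by linarith, by linarith⟩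
    rcases he with rfl | rfl <;> rcases he' with rfl | rfl
    · exact h1.trans (by norm_num)
    · exact h6
    · exact (congrArg abs h5).trans_le h6
    · exact h2.trans (by norm_num)
  · have hn1 {e : ℝ × ℝ} (he : e ∈ ({(1, 0), (0, 1)} : Set (ℝ × ℝ))) : ‖e‖ ≤ 1 := by
      rcases he with rfl | rfl <;> simp [Prod.norm_def]
    refine (hφ.norm_iter_pd_pd_le (hn1 he) (hn1 he') h (by omega) hz).trans ?_
    calc (2 : ℝ) ^ (n + 2) * (1 / 10 ^ 5) ≤ 2 ^ (n + 2) * 1 := by gcongr; norm_num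
      _ ≤ 2 ^ M := by rw [mul_one]; exact pow_le_pow_right₀ (by norm_num) (by omega)

/-- What matters is that the constant depends on M only: the final threshold for K must not depend
on φ or on the level A. -/
theorem exists_bound_slope (M : ℕ) : ∃ D : ℝ, ∀ φ : ℝ × ℝ → ℝ, IsHyp M φ → ∀ A : ℝ,
    |A| ≤ 1 / 1000 → ContDiffOn ℝ (M - 2 : ℕ) (slope φ A) openSig2 ∧
      ∀ i ≤ M - 2, ∀ z ∈ openSig2, ‖iteratedFDerivWithin ℝ i (slope φ A) openSig2 z‖ ≤ D := by
  obtain ⟨D, hD⟩ := exists_bound_iteratedFDerivWithin_div (M - 2) (2 * 2 ^ M)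
    (by have : (1 : ℝ) ≤ 2 ^ M := one_le_pow₀ (by norm_num)
        linarith)
  refine ⟨D, fun φ hφ A hA => ?_⟩
  have hX (z) (hz : z ∈ openSig2) := levelFunX_mem hφ hA hz
  refine ⟨(contDiffOn_levelFunY hφ).neg.mul ((contDiffOn_levelFunX hφ).inv fun z hz => by
    have := (hX z hz).1
    intro h0
    linarith), ?_⟩
  refine hD (fun z => -levelFunY φ A z) (levelFunX φ A) (contDiffOn_levelFunY hφ).neg
    (contDiffOn_levelFunX hφ) (fun z hz => ⟨by linarith [(hX z hz).1], by linarith [(hX z hz).2]⟩)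
    (fun i hi z hz => ?_) (fun i hi z hz => ?_)
  · have hneg := iteratedFDerivWithin_neg_apply (𝕜 := ℝ) (f := levelFunY φ A) (i := i)
      isOpen_openSig2.uniqueDiffOn hz
    change iteratedFDerivWithin ℝ i (fun z => -levelFunY φ A z) openSig2 z = _ at hneg
    rw [hneg, norm_neg]
    exact norm_iteratedFDerivWithin_sub_mul_le hA
      ((hφ.contDiffOn_pd_pd (0, 1) (0, 1)).of_le (by exact_mod_cast hi))
      ((hφ.contDiffOn_pd_pd (0, 1) (1, 0)).of_le (by exact_mod_cast hi)) hz
      (abs_second_le hφ hi hz _ (by simp) _ (by simp))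
      (abs_second_le hφ hi hz _ (by simp) _ (by simp))
  · exact norm_iteratedFDerivWithin_sub_mul_le hA
      ((hφ.contDiffOn_pd_pd (1, 0) (0, 1)).of_le (by exact_mod_cast hi))
      ((hφ.contDiffOn_pd_pd (1, 0) (1, 0)).of_le (by exact_mod_cast hi)) hz
      (abs_second_le hφ hi hz _ (by simp) _ (by simp))
      (abs_second_le hφ hi hz _ (by simp) _ (by simp))

/-- The level curve through a point of `Σ`, as a graph with controlled derivatives. -/
theorem exists_levelCurve (M : ℕ) : ∃ D : ℝ, 1 ≤ D ∧ ∀ φ : ℝ × ℝ → ℝ, IsHyp M φ → ∀ A : ℝ,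
    |A| ≤ 1 / 1000 → ∀ z₁ ∈ Sig, ∃ g : ℝ → ℝ,
      (∀ y ∈ curveDom, g y ∈ curveDom ∧ levelFun φ A (g y, y) = levelFun φ A z₁) ∧
      (∀ y ∈ curveDom, HasDerivAt g (slope φ A (g y, y)) y) ∧
      ContDiffOn ℝ (M - 2 : ℕ) (fun y => slope φ A (g y, y)) curveDom ∧
      ∀ y ∈ curveDom, |iteratedDerivWithin (M - 2) (fun y => slope φ A (g y, y)) curveDom y| ≤ D := by
  obtain ⟨B, hB⟩ := exists_bound_slope M
  obtain ⟨D, hD1, hD⟩ := exists_bound_integralCurve (M - 2) B (M - 2) le_rfl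
  refine ⟨D, hD1, fun φ hφ A hA z₁ hz₁ => ?_⟩
  have h3 := hφ.three_le
  have hex (y : ℝ) (hy : y ∈ curveDom) := exists_levelCurve_point hφ hA hz₁ hy
  choose! g hg using hex
  have hd (y : ℝ) (hy : y ∈ curveDom) := hasDerivAt_levelCurve hφ hA hg hy
  have hgc : ContDiffOn ℝ (M - 1 : ℕ) g curveDom := fun y hy =>
    (contDiffAt_levelCurve hφ hA hg hy).contDiffWithinAt
  have hm : MapsTo (fun y => (g y, y)) curveDom openSig2 := fun y hy => curve_mem (hg y hy).1 hy
  obtain ⟨hs1, hs2⟩ := hB φ hφ A hA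
  refine ⟨g, hg, hd, hs1.comp ((hgc.of_le (by norm_cast; omega)).prodMk contDiffOn_id) hm,
    fun y hy => ?_⟩
  -- Order M - 2 of the slope along the curve is order M - 1 of g itself.
  have h := hD (slope φ A) g hs1 hs2 (by rw [show M - 2 + 1 = M - 1 by omega]; exact hgc) hm hd
    (M - 2 + 1) (by omega) le_rfl y hy
  rw [norm_iteratedFDerivWithin_eq_norm_iteratedDerivWithin, iteratedDerivWithin_succ',
    iteratedDerivWithin_congr (g := fun y => slope φ A (g y, y)) (fun t ht => ?_) hy] at h
  · exact h
  · exact (hd t ht).hasDerivWithinAt.derivWithin (isOpen_curveDom.uniqueDiffOn t ht)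

end Level

/-! ### Sublevel sets of functions with bounded derivatives -/

/-- Taylor polynomial of order N - 1 at the left endpoint; the factorial in the remainder is thrown
away. -/
theorem exists_polynomial_approx {h : ℝ → ℝ} {N : ℕ} (hN : 1 ≤ N)
    (hc : ContDiffOn ℝ N h curveDom) {D : ℝ}
    (hD : ∀ y ∈ curveDom, |iteratedDerivWithin N h curveDom y| ≤ D) {s ℓ : ℝ} (hℓ : 0 < ℓ)
    (hsub : Icc s (s + ℓ) ⊆ curveDom) :
    ∃ Q : Polynomial ℝ, Q.natDegree ≤ N ∧ ∀ y ∈ Icc s (s + ℓ), |h y - Q.eval y| ≤ D * ℓ ^ N := by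
  obtain ⟨n, rfl⟩ : ∃ n, N = n + 1 := ⟨N - 1, by omega⟩
  have hs : s ∈ curveDom := hsub (left_mem_Icc.2 (by linarith))
  have hD0 : 0 ≤ D := (abs_nonneg _).trans (hD s hs)
  refine ⟨∑ k ∈ Finset.range (n + 1), Polynomial.C (((k.factorial : ℝ)⁻¹) *
    iteratedDerivWithin k h (Icc s (s + ℓ)) s) * (Polynomial.X - Polynomial.C s) ^ k,
    ?_, fun y hy => ?_⟩
  · refine Polynomial.natDegree_sum_le_of_forall_le _ _ fun k hk => ?_
    rw [Finset.mem_range] at hk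
    refine (Polynomial.natDegree_C_mul_le _ _).trans ?_
    rw [Polynomial.natDegree_pow, Polynomial.natDegree_X_sub_C]
    omega
  · have hT := taylor_mean_remainder_bound (n := n) (C := D) (by linarith : s ≤ s + ℓ)
      (by exact_mod_cast hc.mono hsub) hy fun t ht => ?_
    · rw [taylor_within_apply, Real.norm_eq_abs] at hT
      have e : (∑ k ∈ Finset.range (n + 1), Polynomial.C (((k.factorial : ℝ)⁻¹) *
          iteratedDerivWithin k h (Icc s (s + ℓ)) s) *
          (Polynomial.X - Polynomial.C s) ^ k).eval y = ∑ k ∈ Finset.range (n + 1),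
          ((k.factorial : ℝ)⁻¹ * (y - s) ^ k) • iteratedDerivWithin k h (Icc s (s + ℓ)) s := by
        rw [Polynomial.eval_finsetSum]
        refine Finset.sum_congr rfl fun k _ => ?_
        simp only [Polynomial.eval_mul, Polynomial.eval_C, Polynomial.eval_pow,
          Polynomial.eval_sub, Polynomial.eval_X, smul_eq_mul]
        ring
      rw [e]
      refine hT.trans ((div_le_self ?_ ?_).trans ?_)
      · exact mul_nonneg hD0 (pow_nonneg (by linarith [hy.1]) _)
      · exact_mod_cast Nat.one_le_iff_ne_zero.2 n.factorial_ne_zero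
      · refine mul_le_mul_of_nonneg_left ?_ hD0
        exact pow_le_pow_left₀ (by linarith [hy.1]) (by linarith [hy.2]) _
    -- Taylor's theorem wants derivatives within the closed window, the hypothesis has them within
    -- `curveDom`; both equal the full derivative.
    · have hcA : ContDiffAt ℝ (n + 1 : ℕ) h t :=
        (hc t (hsub ht)).contDiffAt (isOpen_curveDom.mem_nhds (hsub ht))
      have := hD t (hsub ht)
      rwa [iteratedDerivWithin_of_isOpen isOpen_curveDom (hsub ht),
        ← iteratedDerivWithin_eq_iteratedDeriv (uniqueDiffOn_Icc (by linarith)) hcA ht] at this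

/-- The number of roots of `S` below `y`. -/
def rootsBelow (S : Polynomial ℝ) (y : ℝ) : ℕ := {x ∈ S.roots.toFinset | x < y}.card

theorem rootsBelow_le (S : Polynomial ℝ) (y : ℝ) : rootsBelow S y ≤ S.natDegree :=
  (Finset.card_filter_le _ _).trans ((Multiset.toFinset_card_le _).trans S.card_roots')

/-- The polynomial Q² - (3r)² is negative where |h| ≤ r and positive where |h| > 4r; squaring treats
both signs of Q at once. An excursion above 4r between y and y' thus produces a root in between, and
the root counts differ. -/
theorem abs_le_of_rootsBelow_eq {h : ℝ → ℝ} {Q : Polynomial ℝ} {r s e y y' : ℝ} (hr : 0 < r)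
    (hQ : ∀ t ∈ Icc s e, |h t - Q.eval t| ≤ r) (hy : y ∈ Icc s e) (hy' : y' ∈ Icc s e)
    (h1 : |h y| ≤ r) (h2 : |h y'| ≤ r)
    (hrt : rootsBelow (Q ^ 2 - Polynomial.C ((3 * r) ^ 2)) y =
      rootsBelow (Q ^ 2 - Polynomial.C ((3 * r) ^ 2)) y') :
    ∀ t ∈ Icc y y', |h t| ≤ 4 * r := by
  intro t ht
  set S := Q ^ 2 - Polynomial.C ((3 * r) ^ 2) with hS
  have hev (x : ℝ) : S.eval x = (Q.eval x) ^ 2 - (3 * r) ^ 2 := by simp [hS]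
  have hneg {x : ℝ} (hx : x ∈ Icc s e) (hhx : |h x| ≤ r) : S.eval x < 0 := by
    rw [hev, sub_neg, sq_lt_sq, abs_of_pos (by linarith : 0 < 3 * r)]
    have := abs_le.1 (hQ x hx)
    have := abs_le.1 hhx
    exact (abs_le.2 ⟨by linarith, by linarith⟩ : |Q.eval x| ≤ 2 * r).trans_lt (by linarith)
  by_contra hcon
  push Not at hcon
  have hte : t ∈ Icc s e := ⟨hy.1.trans ht.1, ht.2.trans hy'.2⟩
  have hpos : 0 < S.eval t := by
    rw [hev, sub_pos, sq_lt_sq, abs_of_pos (by linarith : 0 < 3 * r)]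
    have h3 := hQ t hte
    have h4 := abs_sub_abs_le_abs_sub (h t) (Q.eval t)
    linarith
  obtain ⟨ρ, hρ, hρ0⟩ := intermediate_value_Icc ht.1 S.continuous.continuousOn
    (show (0 : ℝ) ∈ Icc _ _ from ⟨(hneg hy h1).le, hpos.le⟩)
  have hρ0' : S.eval ρ = 0 := hρ0
  have hS0 : S ≠ 0 := by
    intro h0
    rw [h0] at hpos
    simp at hpos
  have hρy' : ρ ≠ y' := by
    rintro rfl
    linarith [hneg hy' h2]
  refine absurd hrt (ne_of_lt (Finset.card_lt_card (Finset.ssubset_iff_of_subset ?_ |>.2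
    ⟨ρ, ?_, ?_⟩)))
  · intro x hx
    rw [Finset.mem_filter] at hx ⊢
    exact ⟨hx.1, hx.2.trans_le (ht.1.trans ht.2)⟩
  · rw [Finset.mem_filter, Multiset.mem_toFinset, Polynomial.mem_roots hS0]
    exact ⟨hρ0', lt_of_le_of_ne (hρ.2.trans ht.2) hρy'⟩
  · rw [Finset.mem_filter]
    exact fun hx => absurd hρ.1 (not_le.2 hx.2)

/-! ### Covering caps by rectangles -/

section Cover

variable {a : ℝ × ℝ → ℝ} {C C' ε' μ K : ℝ}

theorem norm_sub_le_of_mem_cap {c z : ℝ × ℝ} (hz : z ∈ cap μ K c) : ‖z - c‖ ≤ √μ / K / 2 := by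
  rw [Prod.norm_def, Real.norm_eq_abs, Real.norm_eq_abs]
  obtain ⟨⟨h1, h2⟩, -⟩ := hz
  exact max_le (abs_le.2 ⟨by simpa using (by linarith [h1.1] : -(√μ / K / 2) ≤ z.1 - c.1),
    by simpa using (by linarith [h1.2] : z.1 - c.1 ≤ √μ / K / 2)⟩)
    (abs_le.2 ⟨by simpa using (by linarith [h2.1] : -(√μ / K / 2) ≤ z.2 - c.2),
    by simpa using (by linarith [h2.2] : z.2 - c.2 ≤ √μ / K / 2)⟩)

theorem exists_int_near (x : ℝ) {q : ℝ} (hq : 0 < q) : ∃ k : ℤ, |x - k * q| ≤ q / 2 := by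
  refine ⟨round (x / q), ?_⟩
  have h := abs_sub_round (x / q)
  have e : x - round (x / q) * q = (x / q - round (x / q)) * q := by field_simp
  rw [e, abs_mul, abs_of_pos hq]
  nlinarith

theorem abs_across_le_abs (b : ℝ) (z : ℝ × ℝ) : |across b z| ≤ |z.1 + b * z.2| :=
  abs_div_sqrt_le b

/-- The points of `Σ` which can be joined to `z₀` inside a level region and nearly parallel to the
corresponding direction lie, together with their caps, in the rectangles of a single component. -/
theorem exists_cover_of_segments (hC : 1 ≤ C) (hC' : 10 * C ≤ C') (hε' : 0 < ε') (hμ : 1 ≤ μ)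
    (hK : 1 ≤ K) (hcap : √μ / K ≤ rad μ K) (hr1 : rad μ K ≤ 1) {A : ℝ}
    {z₀ : ℝ × ℝ} {Y : Set (ℝ × ℝ)} (hz₀ : z₀ ∈ Sig)
    (hY : ∀ z ∈ Y, z ∈ Sig ∧ |(z.1 - z₀.1) + A * (z.2 - z₀.2)| ≤ C * rad μ K ∧
      ∀ w ∈ segment ℝ z₀ z, |a w - A| < C * rad μ K / 2) :
    ∃ 𝓒 : Finset (Set (ℝ × ℝ)), (𝓒 : Set (Set (ℝ × ℝ))) ⊆ rectangles a C C' ε' μ K ∧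
      (𝓒.card : ℝ) ≤ 13 * K ^ ε' ∧ ∀ z ∈ Y, ∃ L ∈ 𝓒, cap μ K z ⊆ L := by
  classical
  have hr := rad_pos hμ hK
  set r := rad μ K with hrdef
  have hKε : 1 ≤ K ^ ε' := Real.one_le_rpow hK hε'.le
  rcases Y.eq_empty_or_nonempty with rfl | ⟨z', hz'⟩
  · exact ⟨∅, by simp, by simp; positivity, by simp⟩
  -- The nearest level is within Cr/2 of A, which is why the hypothesis asks for Cr/2: together they
  -- give the radius Cr of the level region.
  obtain ⟨k, hk⟩ := exists_int_near A (show 0 < C * r by positivity)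
  change |A - level C μ K k| ≤ _ at hk
  set b := level C μ K k with hb
  obtain ⟨j, hj⟩ := exists_int_near (across b z₀) (show 0 < C' * r by nlinarith)
  have hCr : C * r ≤ C' * r / 10 := by nlinarith
  -- Replacing A by the level costs at most Cr/2 times the height difference 2, so the total is 2Cr
  -- ≤ C'r/5. With z₀ within C'r/2 of the axis, this leaves room for the caps inside the strip.
  have hdiff {z : ℝ × ℝ} (hz : z ∈ Y) : |across b (z - z₀)| ≤ C' * r / 5 := by
    obtain ⟨h1, h2, -⟩ := hY z hz
    refine (abs_across_le_abs b _).trans ?_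
    have e : (z - z₀).1 + b * (z - z₀).2 =
        ((z.1 - z₀.1) + A * (z.2 - z₀.2)) - (A - b) * (z.2 - z₀.2) := by
      simp only [Prod.fst_sub, Prod.snd_sub]; ring
    rw [e]
    refine (abs_sub _ _).trans ?_
    rw [abs_mul]
    have h3 : |z.2 - z₀.2| ≤ 2 :=
      abs_le.2 ⟨by linarith [h1.2.1, hz₀.2.2], by linarith [h1.2.2, hz₀.2.1]⟩
    have h4 : |A - b| * |z.2 - z₀.2| ≤ C * r / 2 * 2 :=
      mul_le_mul hk h3 (abs_nonneg _) (by positivity)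
    linarith
  have hseg {z : ℝ × ℝ} (hz : z ∈ Y) {w : ℝ × ℝ} (hw : w ∈ segment ℝ z₀ z) :
      w ∈ strip C C' μ K k j ∩ levelRegion a C μ K k := by
    obtain ⟨h1, h2, h3⟩ := hY z hz
    refine ⟨?_, convex_Sig.segment_subset hz₀ h1 hw, ?_⟩
    · rw [segment_eq_image'] at hw
      obtain ⟨θ, hθ, rfl⟩ := hw
      have e : across b (z₀ + θ • (z - z₀)) = across b z₀ + θ * across b (z - z₀) := by
        simp only [across, Prod.fst_add, Prod.snd_add, Prod.smul_fst, Prod.smul_snd, smul_eq_mul]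
        ring
      have h5 : |θ * across b (z - z₀)| ≤ C' * r / 5 := by
        rw [abs_mul, abs_of_nonneg hθ.1]
        exact (mul_le_of_le_one_left (abs_nonneg _) hθ.2).trans (hdiff hz)
      have h6 := abs_le.1 h5
      have h7 := abs_le.1 hj
      change across b _ ∈ Icc _ _
      rw [e]
      exact ⟨by linarith, by linarith⟩
    · have h4 := h3 w hw
      have := abs_sub_le (a w) A b
      change |a w - b| < C * r
      linarith
  set u := along b z₀ with hu
  have hus : u ∈ shadow1 a C C' μ K k j :=
    shadow0_subset_shadow1 hr.le ⟨z₀, hseg hz' (left_mem_segment ℝ _ _), rfl⟩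
  have hcont : Continuous (along b) := by unfold along; fun_prop
  have hcomp {z : ℝ × ℝ} (hz : z ∈ Y) : along b z ∈ shadowComp a C C' μ K k j u := by
    -- The projected segments are connected subsets of the shadow through the common point u, so
    -- they all lie in its component.
    have hpre : IsPreconnected (along b '' segment ℝ z₀ z) :=
      (convex_segment z₀ z).isPreconnected.image _ hcont.continuousOn
    refine hpre.subset_connectedComponentIn ⟨z₀, left_mem_segment ℝ _ _, rfl⟩ ?_
      ⟨z, right_mem_segment ℝ _ _, rfl⟩
    rintro _ ⟨w, hw, rfl⟩
    exact shadow0_subset_shadow1 hr.le ⟨w, hseg hz hw, rfl⟩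
  set p := pieces K ε' (compLen a C C' μ K k j u) with hp
  have hp0 : 0 < p := pieces_pos hr hK hus
  refine ⟨(Finset.range p).image fun i => rect a C C' ε' μ K k j u i, ?_, ?_, fun z hz => ?_⟩
  · intro L hL
    rw [Finset.mem_coe, Finset.mem_image] at hL
    obtain ⟨i, hi, rfl⟩ := hL
    exact mem_rectangles_iff.2 ⟨k, j, u, hus, i, Finset.mem_range.1 hi, rfl⟩
  · have h1 : (((Finset.range p).image fun i => rect a C C' ε' μ K k j u i).card : ℝ) ≤ p := by
      exact_mod_cast Finset.card_image_le.trans (Finset.card_range p).le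
    have h0 := two_mul_rad_le_compLen hr.le hus
    have hKpos : 0 < K ^ (-ε') := by positivity
    have h2 : (p : ℝ) < compLen a C C' μ K k j u / (K ^ (-ε') / 2) + 1 :=
      Nat.ceil_lt_add_one (div_nonneg (by linarith) (by linarith))
    have h3 : compLen a C C' μ K k j u / (K ^ (-ε') / 2) ≤ 6 / (K ^ (-ε') / 2) := by
      gcongr
      linarith [compLen_le hus]
    have h4 : 6 / (K ^ (-ε') / 2) = 12 * K ^ ε' := by
      rw [Real.rpow_neg (by linarith)]
      field_simp
      norm_num
    linarith
  · set lo := sInf (shadowComp a C C' μ K k j u) with hlo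
    set d := pieceLen a C C' ε' μ K k j u with hd
    have hp0' : (0 : ℝ) < p := by exact_mod_cast hp0
    have hd0 : 0 < d := div_pos (by linarith [two_mul_rad_le_compLen hr.le hus]) hp0'
    have hpd : p * d = compLen a C C' μ K k j u := mul_div_cancel₀ _ hp0'.ne'
    have hvlo : lo ≤ along b z := csInf_le bddBelow_shadowComp (hcomp hz)
    have hvhi : along b z ≤ lo + p * d := by
      have := le_csSup bddAbove_shadowComp (hcomp hz)
      rw [hpd]
      unfold compLen
      linarith
    -- The floor gives the index, except at the upper end of the component, which goes to the last
    -- piece.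
    obtain ⟨i, hi, hi1, hi2⟩ : ∃ i < p, lo + i * d ≤ along b z ∧ along b z ≤ lo + (i + 1) * d := by
      rcases eq_or_lt_of_le hvhi with h | h
      · obtain ⟨n, hn⟩ : ∃ n, p = n + 1 := ⟨p - 1, by omega⟩
        rw [hn] at h ⊢
        refine ⟨n, by omega, ?_, ?_⟩
        · rw [h]
          push_cast
          linarith
        · rw [h]
          push_cast
          exact le_rfl
      · have hv0 : 0 ≤ (along b z - lo) / d := div_nonneg (by linarith) hd0.le
        refine ⟨⌊(along b z - lo) / d⌋₊, ?_, ?_, ?_⟩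
        · rw [Nat.floor_lt hv0, div_lt_iff₀ hd0]
          linarith
        · have := Nat.floor_le hv0
          rw [le_div_iff₀ hd0] at this
          linarith
        · have := (Nat.lt_floor_add_one ((along b z - lo) / d)).le
          rw [div_le_iff₀ hd0] at this
          linarith
    -- The prolongation by r absorbs the part of the cap that sticks out of the piece.
    refine ⟨_, Finset.mem_image_of_mem _ (Finset.mem_range.2 hi), fun x hx => ?_⟩
    have hn := norm_sub_le_of_mem_cap hx
    have hal := abs_le.1 ((abs_along_le b (x - z)).trans (by linarith : _ ≤ r))
    have hac := abs_le.1 ((abs_across_le b (x - z)).trans (by linarith : _ ≤ r))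
    rw [← along_sub] at hal
    rw [← across_sub] at hac
    have h7 := abs_le.1 hj
    have h8 := abs_le.1 (hdiff hz)
    rw [← across_sub] at h8
    refine ⟨?_, ?_⟩
    · change across b _ ∈ Icc _ _
      have : r ≤ C' * r / 10 := by nlinarith
      exact ⟨by linarith, by linarith⟩
    · change along b _ ∈ Icc _ _
      exact ⟨by linarith, by linarith⟩

end Cover

/-! ### Points not strongly separated from a fixed point -/

section Branch

variable {C C' ε' μ K : ℝ} {M : ℕ} {φ : ℝ × ℝ → ℝ}

/-- The points of `Σ` which are not separated from `z₁` along the first family of curves. -/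
def branchSet (φ : ℝ × ℝ → ℝ) (μ K : ℝ) (z₁ : ℝ × ℝ) : Set (ℝ × ℝ) :=
  {z | z ∈ Sig ∧ |t2 φ z₁ z₁ z| < 50 * (√μ / K) ∧ |fA φ z - fA φ z₁| ≤ rad μ K / 10}

theorem mem_curveDom_of_abs_le {y : ℝ} (hy : y ∈ Icc (-1 : ℝ) 1) : y ∈ curveDom :=
  ⟨by linarith [hy.1], by linarith [hy.2]⟩

/-- Here t² is the increment of the level function from the curve to z, so the horizontal distance
is at most 100 μ^{1/2}/K ≤ r/50. Over that distance `fA` hardly changes, and the slope follows. -/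
theorem near_curve_of_mem_branchSet (hφ : IsHyp M φ)
    (hcap : √μ / K ≤ rad μ K / 5000) {z₁ : ℝ × ℝ} (hz₁ : z₁ ∈ Sig) {g : ℝ → ℝ}
    (hg : ∀ y ∈ curveDom, g y ∈ curveDom ∧
      levelFun φ (fA φ z₁) (g y, y) = levelFun φ (fA φ z₁) z₁)
    {z : ℝ × ℝ} (hz : z ∈ branchSet φ μ K z₁) :
    |z.1 - g z.2| ≤ rad μ K / 50 ∧ |slope φ (fA φ z₁) (g z.2, z.2) + fA φ z₁| ≤ rad μ K := by
  obtain ⟨hzS, ht, hzA⟩ := hz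
  have hA := hφ.abs_fA_le (Sig_subset_openSig2 hz₁)
  have hy := mem_curveDom_of_abs_le hzS.2
  have hγ := curve_mem (hg _ hy).1 hy
  have e : t2 φ z₁ z₁ z = levelFun φ (fA φ z₁) (z.1, z.2) - levelFun φ (fA φ z₁) (g z.2, z.2) := by
    rw [(hg _ hy).2]
    unfold t2 levelFun
    ring
  have h1 := abs_sub_le_levelFun hφ hA (Sig_subset_openSig2 hzS) hγ
  rw [← e] at h1
  have h2 : |z.1 - g z.2| ≤ rad μ K / 50 := by linarith
  refine ⟨h2, ?_⟩
  have h3 := hφ.fA_lip hγ (Sig_subset_openSig2 hzS)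
  have hn : ‖((g z.2, z.2) : ℝ × ℝ) - z‖ = |z.1 - g z.2| := by
    rw [abs_sub_comm]
    simp [Prod.norm_def]
  rw [hn] at h3
  have h4 := (slope_add_bounds hφ hA hγ).2
  have h5 := abs_sub_le (fA φ (g z.2, z.2)) (fA φ z) (fA φ z₁)
  linarith [abs_nonneg (z.1 - g z.2)]

/-- If the slope of the level curve stays close to `-A` between two points of `branchSet`, then the
segment between them stays in the level region. -/
theorem segment_facts (hφ : IsHyp M φ) (hC : 40 ≤ C) (hr : 0 < rad μ K)
    (hcap : √μ / K ≤ rad μ K / 5000) {z₁ : ℝ × ℝ} (hz₁ : z₁ ∈ Sig) {g : ℝ → ℝ}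
    (hg : ∀ y ∈ curveDom, g y ∈ curveDom ∧
      levelFun φ (fA φ z₁) (g y, y) = levelFun φ (fA φ z₁) z₁)
    (hgd : ∀ y ∈ curveDom, HasDerivAt g (slope φ (fA φ z₁) (g y, y)) y)
    {z₀ z : ℝ × ℝ} (hz₀ : z₀ ∈ branchSet φ μ K z₁) (hz : z ∈ branchSet φ μ K z₁)
    (hsl : ∀ t ∈ uIcc z₀.2 z.2, |slope φ (fA φ z₁) (g t, t) + fA φ z₁| ≤ 4 * rad μ K) :
    |(z.1 - z₀.1) + fA φ z₁ * (z.2 - z₀.2)| ≤ C * rad μ K ∧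
      ∀ w ∈ segment ℝ z₀ z, |fA φ w - fA φ z₁| < C * rad μ K / 2 := by
  set r := rad μ K with hrdef
  set A := fA φ z₁ with hAdef
  have hA : |A| ≤ 1 / 1000 := hφ.abs_fA_le (Sig_subset_openSig2 hz₁)
  have hsub : uIcc z₀.2 z.2 ⊆ Icc (-1 : ℝ) 1 :=
    ordConnected_Icc.uIcc_subset hz₀.1.2 hz.1.2
  -- The derivative of g(t) + A t is at most 4r over a length of at most 2: the curve is a line of
  -- direction (-A, 1) up to 8r.
  have hu {t : ℝ} (ht : t ∈ uIcc z₀.2 z.2) :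
      |g t + A * t - (g z₀.2 + A * z₀.2)| ≤ 8 * r := by
    have h := (convex_uIcc z₀.2 z.2).norm_image_sub_le_of_norm_hasDerivWithin_le
      (f := fun t => g t + A * t) (f' := fun t => slope φ A (g t, t) + A) (C := 4 * r)
      (fun x hx => ((hgd x (mem_curveDom_of_abs_le (hsub hx))).add
        ((hasDerivAt_id x).const_mul A |>.congr_deriv (mul_one A))).hasDerivWithinAt)
      (fun x hx => hsl x hx) left_mem_uIcc ht
    rw [Real.norm_eq_abs, Real.norm_eq_abs] at h
    have h1 := hsub ht
    have h2 := hz₀.1.2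
    have h3 : |t - z₀.2| ≤ 2 := abs_le.2 ⟨by linarith [h1.1, h2.2], by linarith [h1.2, h2.1]⟩
    refine h.trans ?_
    nlinarith [abs_nonneg (t - z₀.2)]
  have n₀ := (near_curve_of_mem_branchSet hφ hcap hz₁ hg hz₀).1
  have n₁ := (near_curve_of_mem_branchSet hφ hcap hz₁ hg hz).1
  have hend : |(z.1 - z₀.1) + A * (z.2 - z₀.2)| ≤ 9 * r := by
    have h1 := abs_le.1 n₀
    have h2 := abs_le.1 n₁
    have h3 := abs_le.1 (hu right_mem_uIcc)
    exact abs_le.2 ⟨by linarith, by linarith⟩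
  refine ⟨hend.trans (by nlinarith), fun w hw => ?_⟩
  have hwS := convex_Sig.segment_subset hz₀.1 hz.1 hw
  rw [segment_eq_image'] at hw
  obtain ⟨θ, hθ, rfl⟩ := hw
  set w := z₀ + θ • (z - z₀) with hwdef
  have hw1 : w.1 = z₀.1 + θ * (z.1 - z₀.1) := rfl
  have hw2 : w.2 = z₀.2 + θ * (z.2 - z₀.2) := rfl
  have hwu : w.2 ∈ uIcc z₀.2 z.2 := by
    rw [← segment_eq_uIcc, segment_eq_image']
    exact ⟨θ, hθ, rfl⟩
  have hwd := mem_curveDom_of_abs_le hwS.2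
  have h4 : |(w.1 + A * w.2) - (z₀.1 + A * z₀.2)| ≤ 9 * r := by
    have e : (w.1 + A * w.2) - (z₀.1 + A * z₀.2) =
        θ * ((z.1 - z₀.1) + A * (z.2 - z₀.2)) := by rw [hw1, hw2]; ring
    rw [e, abs_mul, abs_of_nonneg hθ.1]
    exact (mul_le_of_le_one_left (abs_nonneg _) hθ.2).trans hend
  -- The segment and the curve follow the same direction, so `fA` at w can be compared with `fA` on
  -- the curve, where the slope controls it. The sum stays below Cr/2 since C ≥ 40.
  have h5 : |w.1 - g w.2| ≤ 18 * r := by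
    have h1 := abs_le.1 n₀
    have h2 := abs_le.1 h4
    have h3 := abs_le.1 (hu hwu)
    exact abs_le.2 ⟨by linarith, by linarith⟩
  have hγ := curve_mem (hg _ hwd).1 hwd
  have h6 := hφ.fA_lip (Sig_subset_openSig2 hwS) hγ
  have hn : ‖w - ((g w.2, w.2) : ℝ × ℝ)‖ = |w.1 - g w.2| := by simp [Prod.norm_def]
  rw [hn] at h6
  have h7 := (slope_add_bounds hφ hA hγ).1
  have h8 := hsl _ hwu
  have h9 := abs_sub_le (fA φ w) (fA φ (g w.2, w.2)) A
  nlinarith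

/-- Points with equally many roots below their height form one group. The slope condition persists
between any two of them, so a group lies over a single component, and there are at most 2N + 1
groups. -/
theorem exists_cover_window (hφ : IsHyp M φ) (hC : 40 ≤ C) (hC' : 10 * C ≤ C')
    (hε' : 0 < ε') (hμ : 1 ≤ μ) (hK : 1 ≤ K) (hcap : √μ / K ≤ rad μ K / 5000)
    (hr1 : rad μ K ≤ 1) {z₁ : ℝ × ℝ} (hz₁ : z₁ ∈ Sig) {g : ℝ → ℝ}
    (hg : ∀ y ∈ curveDom, g y ∈ curveDom ∧
      levelFun φ (fA φ z₁) (g y, y) = levelFun φ (fA φ z₁) z₁)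
    (hgd : ∀ y ∈ curveDom, HasDerivAt g (slope φ (fA φ z₁) (g y, y)) y)
    {s e : ℝ} {Q : Polynomial ℝ} {N : ℕ} (hQN : Q.natDegree ≤ N)
    (hQ : ∀ y ∈ Icc s e, |slope φ (fA φ z₁) (g y, y) + fA φ z₁ - Q.eval y| ≤ rad μ K) :
    ∃ 𝓒 : Finset (Set (ℝ × ℝ)), (𝓒 : Set (Set (ℝ × ℝ))) ⊆ famL1 φ C C' ε' μ K ∧
      (𝓒.card : ℝ) ≤ (2 * N + 1) * (13 * K ^ ε') ∧
      ∀ z ∈ branchSet φ μ K z₁, z.2 ∈ Icc s e → ∃ L ∈ 𝓒, cap μ K z ⊆ L := by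
  classical
  have hr := rad_pos hμ hK
  set S := Q ^ 2 - Polynomial.C ((3 * rad μ K) ^ 2) with hS
  have hSN : S.natDegree ≤ 2 * N := by
    rw [hS, Polynomial.natDegree_sub_C]
    exact Polynomial.natDegree_pow_le_of_le 2 hQN
  have hgroup (i : ℕ) : ∃ 𝓒 : Finset (Set (ℝ × ℝ)),
      (𝓒 : Set (Set (ℝ × ℝ))) ⊆ famL1 φ C C' ε' μ K ∧ (𝓒.card : ℝ) ≤ 13 * K ^ ε' ∧
      ∀ z ∈ {z | z ∈ branchSet φ μ K z₁ ∧ z.2 ∈ Icc s e ∧ rootsBelow S z.2 = i},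
        ∃ L ∈ 𝓒, cap μ K z ⊆ L := by
    set Y := {z | z ∈ branchSet φ μ K z₁ ∧ z.2 ∈ Icc s e ∧ rootsBelow S z.2 = i}
    rcases Y.eq_empty_or_nonempty with h | ⟨z₀, hz₀⟩
    · rw [h]
      exact ⟨∅, by simp, by simp; positivity, by simp⟩
    · refine exists_cover_of_segments (A := fA φ z₁) (by linarith) hC' hε' hμ hK (by linarith)
        hr1 hz₀.1.1 fun z hz => ⟨hz.1.1, ?_⟩
      refine segment_facts hφ hC hr hcap hz₁ hg hgd hz₀.1 hz.1 fun t ht => ?_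
      have n₀ := (near_curve_of_mem_branchSet hφ hcap hz₁ hg hz₀.1).2
      have n₁ := (near_curve_of_mem_branchSet hφ hcap hz₁ hg hz.1).2
      rcases le_total z₀.2 z.2 with h | h
      · rw [uIcc_of_le h] at ht
        exact abs_le_of_rootsBelow_eq (h := fun t => slope φ (fA φ z₁) (g t, t) + fA φ z₁) hr hQ
          hz₀.2.1 hz.2.1 n₀ n₁ (hz₀.2.2.trans hz.2.2.symm) t ht
      · rw [uIcc_of_ge h] at ht
        exact abs_le_of_rootsBelow_eq (h := fun t => slope φ (fA φ z₁) (g t, t) + fA φ z₁) hr hQ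
          hz.2.1 hz₀.2.1 n₁ n₀ (hz.2.2.trans hz₀.2.2.symm) t ht
  choose 𝓒 h1 h2 h3 using hgroup
  refine ⟨(Finset.range (2 * N + 1)).biUnion 𝓒, ?_, ?_, fun z hz hzs => ?_⟩
  · intro L hL
    rw [Finset.mem_coe, Finset.mem_biUnion] at hL
    obtain ⟨i, -, hi⟩ := hL
    exact h1 i hi
  · have : ((((Finset.range (2 * N + 1)).biUnion 𝓒).card : ℕ) : ℝ) ≤
        ∑ i ∈ Finset.range (2 * N + 1), ((𝓒 i).card : ℝ) := by
      exact_mod_cast Finset.card_biUnion_le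
    refine this.trans ((Finset.sum_le_sum fun i _ => h2 i).trans_eq ?_)
    simp
  · obtain ⟨L, hL, hLz⟩ := h3 (rootsBelow S z.2) z ⟨hz, hzs, rfl⟩
    refine ⟨L, Finset.mem_biUnion.2 ⟨_, ?_, hL⟩, hLz⟩
    rw [Finset.mem_range]
    exact Nat.lt_succ_of_le ((rootsBelow_le S z.2).trans hSN)

/-- Windows of length K^{-2ε'} balance two demands: only O(K^{2ε'}) are needed, and the Taylor error
D K^{-2ε'(M-2)} is at most r. The third factor K^{ε'} counts the pieces of a component. -/
theorem exists_cover_branch (M : ℕ) : ∃ D : ℝ, 1 ≤ D ∧ ∀ C C' ε' μ K : ℝ, 40 ≤ C → 10 * C ≤ C' →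
    0 < ε' → 1 ≤ μ → 1 ≤ K → √μ / K ≤ rad μ K / 5000 → rad μ K ≤ 1 →
    K ^ (-(2 * ε')) ≤ 1 / 4 → D * (K ^ (-(2 * ε'))) ^ (M - 2) ≤ K ^ (-(3 / 4) : ℝ) →
    ∀ φ : ℝ × ℝ → ℝ, IsHyp M φ → ∀ z₁ ∈ Sig,
    ∃ 𝓒 : Finset (Set (ℝ × ℝ)), (𝓒 : Set (Set (ℝ × ℝ))) ⊆ famL1 φ C C' ε' μ K ∧
      (𝓒.card : ℝ) ≤ 78 * M * K ^ (3 * ε') ∧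
      ∀ z ∈ branchSet φ μ K z₁, ∃ L ∈ 𝓒, cap μ K z ⊆ L := by
  classical
  obtain ⟨D, hD1, hD⟩ := exists_levelCurve M
  refine ⟨D, hD1, fun C C' ε' μ K hC hC' hε' hμ hK hcap hr1 hℓ hDK φ hφ z₁ hz₁ => ?_⟩
  have hr := rad_pos hμ hK
  have h3 := hφ.three_le
  have hA := hφ.abs_fA_le (Sig_subset_openSig2 hz₁)
  obtain ⟨g, hg, hgd, hgc, hgb⟩ := hD φ hφ (fA φ z₁) hA z₁ hz₁
  have hK0 : 0 < K := by linarith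
  set ℓ := K ^ (-(2 * ε')) with hℓdef
  have hℓ0 : 0 < ℓ := by positivity
  have hrK : K ^ (-(3 / 4) : ℝ) ≤ rad μ K := by
    unfold rad
    exact le_mul_of_one_le_left (by positivity) (Real.one_le_sqrt.2 hμ)
  -- The extra window takes care of the height y = 1.
  set nw := ⌊2 / ℓ⌋₊ + 1 with hnw
  have hwin (w : ℕ) (hw : w < nw) : ∃ 𝓒 : Finset (Set (ℝ × ℝ)),
      (𝓒 : Set (Set (ℝ × ℝ))) ⊆ famL1 φ C C' ε' μ K ∧
      (𝓒.card : ℝ) ≤ (2 * (M - 2 : ℕ) + 1) * (13 * K ^ ε') ∧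
      ∀ z ∈ branchSet φ μ K z₁, z.2 ∈ Icc (-1 + w * ℓ) (-1 + w * ℓ + ℓ) →
        ∃ L ∈ 𝓒, cap μ K z ⊆ L := by
    have hw' : (w : ℝ) * ℓ ≤ 2 := by
      rw [← le_div_iff₀ hℓ0]
      exact (Nat.le_floor_iff (by positivity)).1 (Nat.lt_succ_iff.1 hw)
    have hw0 : 0 ≤ (w : ℝ) * ℓ := by positivity
    -- The last window may pass 1 by ℓ ≤ 1/4 and still stays inside `curveDom`.
    obtain ⟨Q, hQd, hQ⟩ := exists_polynomial_approx (by omega : 1 ≤ M - 2) hgc hgb hℓ0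
      (s := -1 + w * ℓ) (fun t ht => ⟨by linarith [ht.1], by linarith [ht.2]⟩)
    refine exists_cover_window hφ hC hC' hε' hμ hK hcap hr1 hz₁ hg hgd
      (Q := Q + Polynomial.C (fA φ z₁)) (by rwa [Polynomial.natDegree_add_C]) fun y hy => ?_
    have h := hQ y hy
    rw [Polynomial.eval_add, Polynomial.eval_C]
    rw [show slope φ (fA φ z₁) (g y, y) + fA φ z₁ - (Q.eval y + fA φ z₁) =
      slope φ (fA φ z₁) (g y, y) - Q.eval y by ring]
    linarith
  choose! 𝓒 h1 h2 h4 using hwin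
  refine ⟨(Finset.range nw).biUnion 𝓒, ?_, ?_, fun z hz => ?_⟩
  · intro L hL
    rw [Finset.mem_coe, Finset.mem_biUnion] at hL
    obtain ⟨i, hi, hL⟩ := hL
    exact h1 i (Finset.mem_range.1 hi) hL
  · have h5 : ((((Finset.range nw).biUnion 𝓒).card : ℕ) : ℝ) ≤
        ∑ i ∈ Finset.range nw, ((𝓒 i).card : ℝ) := by
      exact_mod_cast Finset.card_biUnion_le
    refine h5.trans ((Finset.sum_le_sum fun i hi => h2 i (Finset.mem_range.1 hi)).trans ?_)
    rw [Finset.sum_const, Finset.card_range, nsmul_eq_mul]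
    have hinv : ℓ⁻¹ = K ^ (2 * ε') := by rw [hℓdef, Real.rpow_neg hK0.le, inv_inv]
    have hK1 : 1 ≤ K ^ (2 * ε') := Real.one_le_rpow hK (by linarith)
    have h6 : (nw : ℝ) ≤ 3 * K ^ (2 * ε') := by
      rw [hnw]
      push_cast
      have := Nat.floor_le (show 0 ≤ 2 / ℓ by positivity)
      rw [div_eq_mul_inv, hinv] at this ⊢
      linarith
    have h7 : (2 * ((M - 2 : ℕ) : ℝ) + 1) ≤ 2 * M := by
      rw [Nat.cast_sub (by omega)]
      push_cast
      linarith
    have h8 : K ^ (3 * ε') = K ^ (2 * ε') * K ^ ε' := by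
      rw [← Real.rpow_add hK0]; ring_nf
    rw [h8]
    calc (nw : ℝ) * ((2 * ((M - 2 : ℕ) : ℝ) + 1) * (13 * K ^ ε'))
        ≤ (3 * K ^ (2 * ε')) * ((2 * M) * (13 * K ^ ε')) := by gcongr
      _ = 78 * M * (K ^ (2 * ε') * K ^ ε') := by ring
  · have hy := hz.1.2
    have h5 : 0 ≤ (z.2 + 1) / ℓ := div_nonneg (by linarith [hy.1]) hℓ0.le
    have hlt : ⌊(z.2 + 1) / ℓ⌋₊ < nw := by
      refine Nat.lt_succ_of_le (Nat.floor_le_floor ?_)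
      gcongr
      linarith [hy.2]
    obtain ⟨L, hL, hLz⟩ := h4 ⌊(z.2 + 1) / ℓ⌋₊ hlt z hz ⟨by
        have := Nat.floor_le h5
        rw [le_div_iff₀ hℓ0] at this
        linarith, by
        have := (Nat.lt_floor_add_one ((z.2 + 1) / ℓ)).le
        rw [div_le_iff₀ hℓ0] at this
        linarith⟩
    exact ⟨L, Finset.mem_biUnion.2 ⟨_, Finset.mem_range.2 hlt, hL⟩, hLz⟩

theorem swap_preimage_cap (c : ℝ × ℝ) : Prod.swap ⁻¹' cap μ K c.swap = cap μ K c := by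
  ext z
  constructor
  · rintro ⟨⟨h1, h2⟩, h3, h4⟩; exact ⟨⟨h2, h1⟩, h4, h3⟩
  · rintro ⟨⟨h1, h2⟩, h3, h4⟩; exact ⟨⟨h2, h1⟩, h4, h3⟩

/-- Two points which are not strongly separated are close to each other, or not separated along
one of the two families of curves. -/
theorem near_or_branch (hφ : IsHyp M φ) (hC : 16000 ≤ C) (hμ : 1 ≤ μ) (hK : 1 ≤ K)
    {z₁ z : ℝ × ℝ} (hz₁ : z₁ ∈ Sig) (hz : z ∈ Sig) (hsep : ¬ StronglySeparated φ μ K z₁ z) :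
    ‖z - z₁‖ ≤ C * (√μ * K ^ (-(1 / 4) : ℝ)) / 8 ∨ z ∈ branchSet φ μ K z₁ ∨
      z.swap ∈ branchSet (φ ∘ Prod.swap) μ K z₁.swap := by
  have hK0 : 0 < K := by linarith
  have hsμ : 1 ≤ √μ := Real.one_le_sqrt.2 hμ
  by_contra hcon
  push Not at hcon
  obtain ⟨hfar, hb1, hb2⟩ := hcon
  set σ := √μ / K with hσ
  set c := √μ * K ^ (-(1 / 4) : ℝ) with hc
  set n := ‖z - z₁‖ with hn
  have hσ0 : 0 < σ := by positivity
  have hc0 : 0 < c := by positivity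
  -- The product of the two scales is exactly μ/K, which explains the pair of exponents 1/4 and 3/4:
  -- at distance c, a cap-sized error determines A up to order r.
  have hσc : σ ≤ c * rad μ K := by
    have e : c * rad μ K = √μ * σ := by
      rw [hc, hσ, rad]
      have : K ^ (-(1 / 4) : ℝ) * K ^ (-(3 / 4) : ℝ) = K⁻¹ := by
        rw [← Real.rpow_add hK0, ← Real.rpow_neg_one]; norm_num
      calc √μ * K ^ (-(1 / 4) : ℝ) * (√μ * K ^ (-(3 / 4) : ℝ))
          = √μ * √μ * (K ^ (-(1 / 4) : ℝ) * K ^ (-(3 / 4) : ℝ)) := by ring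
        _ = _ := by rw [this]; ring
    rw [e]
    exact le_mul_of_one_le_left hσ0.le hsμ
  have hσc' : σ ≤ c := by
    rw [hσ, hc, div_eq_mul_inv]
    gcongr
    rw [← Real.rpow_neg_one]
    exact Real.rpow_le_rpow_of_exponent_le hK (by norm_num)
  -- This is where C ≥ 16000 is needed.
  have hnc : 2000 * c < n := by nlinarith
  have hne : z₁ ≠ z := by
    rintro rfl
    simp [hn] at hnc
    linarith
  have hz₁' := Sig_subset_openSig2 hz₁
  have hz' := Sig_subset_openSig2 hz
  have hmax := not_le.1 fun h => hsep ⟨hne, h⟩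
  rw [max_lt_iff, min_lt_iff, min_lt_iff] at hmax
  have hP := hφ.dx_lip hz' hz₁'
  have hQ := hφ.dy_lip hz' hz₁'
  have hA₁ := hφ.abs_fA_le hz₁'
  have hA := hφ.abs_fA_le hz'
  have hswap {w : ℝ × ℝ} (hw : w ∈ openSig2) : fA (φ ∘ Prod.swap) w.swap = fB φ w :=
    (fA_comp_swap hφ (swap_mem_openSig2 hw)).trans (by rw [Prod.swap_swap])
  have hB₁ := hφ.comp_swap.abs_fA_le (swap_mem_openSig2 hz₁')
  have hB := hφ.comp_swap.abs_fA_le (swap_mem_openSig2 hz')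
  rw [hswap hz₁'] at hB₁
  rw [hswap hz'] at hB
  have hnot2 : ¬ |fA φ z - fA φ z₁| ≤ rad μ K / 10 ∨ ¬ |t2 φ z₁ z₁ z| < 50 * σ := by
    by_contra h
    push Not at h
    exact hb1 ⟨hz, h.2, h.1⟩
  have hnot1 : ¬ |fB φ z - fB φ z₁| ≤ rad μ K / 10 ∨ ¬ |t1 φ z₁ z₁ z| < 50 * σ := by
    by_contra h
    push Not at h
    refine hb2 ⟨swap_mem_Sig hz, ?_, ?_⟩
    · rw [t2_comp_swap hφ (swap_mem_openSig2 hz₁')]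
      simpa using h.2
    · rw [hswap hz', hswap hz₁']
      exact h.1
  unfold t1 t2 at hmax
  unfold t1 at hnot1
  unfold t2 at hnot2
  set P := dx φ z - dx φ z₁
  set Q := dy φ z - dy φ z₁
  -- P is nearly the difference in y and Q that in x, so the larger coordinate difference shows up
  -- in one of them.
  have hmn : n ≤ |P| + n / 1000 ∨ n ≤ |Q| + n / 1000 := by
    have h1 : |z.2 - z₁.2| ≤ |P| + n / 1000 := by
      have := abs_sub_abs_le_abs_sub (z.2 - z₁.2) P
      rw [abs_sub_comm (z.2 - z₁.2) P] at this
      linarith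
    have h2 : |z.1 - z₁.1| ≤ |Q| + n / 1000 := by
      have := abs_sub_abs_le_abs_sub (z.1 - z₁.1) Q
      rw [abs_sub_comm (z.1 - z₁.1) Q] at this
      linarith
    have h3 : n = max |z.1 - z₁.1| |z.2 - z₁.2| := by rw [hn, Prod.norm_def]; rfl
    rcases max_choice |z.1 - z₁.1| |z.2 - z₁.2| with h | h <;> rw [h] at h3
    · right; linarith
    · left; linarith
  have hlin {X Y t : ℝ} (ht : |t| ≤ 1 / 1000) (h : |X - t * Y| < 50 * σ) :
      |X| ≤ 50 * σ + |Y| / 1000 := by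
    have h1 := abs_sub_abs_le_abs_sub X (t * Y)
    rw [abs_mul] at h1
    nlinarith [abs_nonneg Y]
  -- Two nearly vanishing combinations X - tY and X - t'Y with Y large force the coefficients to
  -- agree.
  have hdiff {X Y t t' : ℝ} (h : |X - t * Y| < 50 * σ) (h' : |X - t' * Y| < 50 * σ)
      (hY : 1000 * c ≤ |Y|) : |t' - t| ≤ rad μ K / 10 := by
    have h1 := abs_sub (X - t * Y) (X - t' * Y)
    rw [show X - t * Y - (X - t' * Y) = (t' - t) * Y by ring, abs_mul] at h1
    by_contra h2
    push Not at h2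
    have h3 : rad μ K / 10 * (1000 * c) < 100 * σ := by
      refine lt_of_le_of_lt ?_ (h1.trans_lt (by linarith : _ < 100 * σ))
      exact mul_le_mul h2.le hY (by positivity) (abs_nonneg _)
    nlinarith
  have hPn := abs_nonneg P
  have hQn := abs_nonneg Q
  -- Smallness of the same t at both endpoints makes B (or A) nearly equal there and puts z in a
  -- branch set. In the mixed cases P and Q are both small, against the distance of z from z₁.
  obtain ⟨h1 | h1, h2 | h2⟩ := hmax
  · have e1 := hlin hB₁ h1
    refine hnot1.elim (fun h => h (hdiff h1 h2 ?_)) fun h => h h1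
    rcases hmn with h | h <;> linarith
  · have e1 := hlin hB₁ h1
    have e2 := hlin hA h2
    rcases hmn with h | h <;> linarith
  · have e1 := hlin hA₁ h1
    have e2 := hlin hB h2
    rcases hmn with h | h <;> linarith
  · have e1 := hlin hA₁ h1
    refine hnot2.elim (fun h => h (hdiff h1 h2 ?_)) fun h => h h1
    rcases hmn with h | h <;> linarith

/-- A family of caps no two of which are strongly separated is covered by few members of `𝓛`. -/
theorem exists_cover_of_not_stronglySeparated (M : ℕ) : ∃ D : ℝ, 1 ≤ D ∧ ∀ C C' ε' μ K : ℝ,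
    16000 ≤ C → 10 * C ≤ C' → 0 < ε' → 1 ≤ μ → 1 ≤ K → √μ / K ≤ rad μ K / 5000 → rad μ K ≤ 1 →
    K ^ (-(2 * ε')) ≤ 1 / 4 → D * (K ^ (-(2 * ε'))) ^ (M - 2) ≤ K ^ (-(3 / 4) : ℝ) →
    ∀ φ : ℝ × ℝ → ℝ, IsHyp M φ → ∀ Y : Set (ℝ × ℝ), Y ⊆ Sig →
    (∀ z ∈ Y, ∀ w ∈ Y, ¬ StronglySeparated φ μ K z w) →
    ∃ 𝓒 : Finset (Set (ℝ × ℝ)), (𝓒 : Set (Set (ℝ × ℝ))) ⊆ famL φ C C' ε' μ K ∧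
      (𝓒.card : ℝ) ≤ 157 * M * K ^ (3 * ε') ∧ ∀ z ∈ Y, ∃ L ∈ 𝓒, cap μ K z ⊆ L := by
  classical
  obtain ⟨D, hD1, hD⟩ := exists_cover_branch M
  refine ⟨D, hD1, fun C C' ε' μ K hC hC' hε' hμ hK hcap hr1 hℓ hDK φ hφ Y hYS hY => ?_⟩
  have hK0 : 0 < K := by linarith
  rcases Y.eq_empty_or_nonempty with rfl | ⟨z₁, hz₁⟩
  · exact ⟨∅, by simp, by simp; positivity, by simp⟩
  have hz₁S := hYS hz₁
  obtain ⟨𝓒₁, s₁, c₁, h₁⟩ := hD C C' ε' μ K (by linarith) hC' hε' hμ hK hcap hr1 hℓ hDK φ hφ z₁ hz₁S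
  obtain ⟨𝓒₂, s₂, c₂, h₂⟩ := hD C C' ε' μ K (by linarith) hC' hε' hμ hK hcap hr1 hℓ hDK _
    hφ.comp_swap z₁.swap (swap_mem_Sig hz₁S)
  set c := C * (√μ * K ^ (-(1 / 4) : ℝ)) with hc
  have hc0 : 0 < c := by
    have : 0 < √μ := Real.sqrt_pos.2 (by linarith)
    have : 0 < C := by linarith
    positivity
  obtain ⟨m, hm⟩ := exists_int_near z₁.1 (half_pos hc0)
  obtain ⟨n, hn⟩ := exists_int_near z₁.2 (half_pos hc0)
  have hm' := abs_le.1 hm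
  have hn' := abs_le.1 hn
  set L₃ := square (m * (c / 2), n * (c / 2)) c with hL₃
  have hL₃mem : L₃ ∈ famL3 C μ K := by
    refine ⟨m, n, c, rfl, rfl, z₁, ⟨⟨?_, ?_⟩, ?_, ?_⟩, hz₁S⟩ <;> dsimp only <;> linarith
  refine ⟨𝓒₁ ∪ 𝓒₂.image (fun L => Prod.swap ⁻¹' L) ∪ {L₃}, ?_, ?_, fun z hz => ?_⟩
  · intro L hL
    rw [Finset.mem_coe, Finset.mem_union, Finset.mem_union, Finset.mem_image,
      Finset.mem_singleton] at hL
    rcases hL with (hL | ⟨L, hL, rfl⟩) | rfl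
    · exact Or.inl (Or.inl (s₁ hL))
    · refine Or.inl (Or.inr ?_)
      rw [famL2_eq hφ]
      exact ⟨L, s₂ hL, rfl⟩
    · exact Or.inr hL₃mem
  · have e1 : ((𝓒₁ ∪ 𝓒₂.image (fun L => Prod.swap ⁻¹' L) ∪ {L₃}).card : ℝ) ≤
        𝓒₁.card + 𝓒₂.card + 1 := by
      exact_mod_cast (Finset.card_union_le _ _).trans (add_le_add ((Finset.card_union_le _ _).trans
        (add_le_add le_rfl Finset.card_image_le)) (Finset.card_singleton _).le)
    have e2 : 1 ≤ (M : ℝ) * K ^ (3 * ε') := by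
      have h1 : (1 : ℝ) ≤ M := by exact_mod_cast (by have := hφ.three_le; omega : 1 ≤ M)
      have h2 := Real.one_le_rpow hK (by linarith : 0 ≤ 3 * ε')
      nlinarith
    linarith
  · rcases near_or_branch hφ hC hμ hK hz₁S (hYS hz) (hY z₁ hz₁ z hz) with h | h | h
    · refine ⟨L₃, by simp, fun x hx => ?_⟩
      have hx' := norm_sub_le_of_mem_cap hx
      have hσ : √μ / K ≤ c / 8 := by
        have h1 : √μ / K ≤ √μ * K ^ (-(1 / 4) : ℝ) := by
          rw [div_eq_mul_inv]
          gcongr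
          rw [← Real.rpow_neg_one]
          exact Real.rpow_le_rpow_of_exponent_le hK (by norm_num)
        have h2 : 0 ≤ √μ * K ^ (-(1 / 4) : ℝ) := by positivity
        nlinarith
      have hxz : ‖x - z₁‖ ≤ c / 4 := by
        have := norm_add_le (x - z) (z - z₁)
        rw [sub_add_sub_cancel] at this
        linarith
      have f1 := abs_le.1 ((norm_fst_le (x - z₁)).trans hxz)
      have f2 := abs_le.1 ((norm_snd_le (x - z₁)).trans hxz)
      rw [Prod.fst_sub] at f1
      rw [Prod.snd_sub] at f2
      refine ⟨⟨?_, ?_⟩, ?_, ?_⟩ <;> dsimp only <;> linarith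
    · obtain ⟨L, hL, hLz⟩ := h₁ z h
      exact ⟨L, by simp [hL], hLz⟩
    · obtain ⟨L, hL, hLz⟩ := h₂ _ h
      refine ⟨Prod.swap ⁻¹' L, ?_, ?_⟩
      · exact Finset.mem_union_left _ (Finset.mem_union_right _ (Finset.mem_image_of_mem _ hL))
      · rw [← swap_preimage_cap z]
        exact preimage_mono hLz

end Branch

/-! ### Linearity of the extension operator -/

theorem isCompact_Sig2 : IsCompact Sig2 := isCompact_Icc.prod isCompact_Icc

theorem integrable_ext {φ : ℝ × ℝ → ℝ} (hφ : ContinuousOn φ Sig2) {f : ℝ × ℝ → ℂ}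
    (hf : MemLp f 2 volume) (ξ : Space) :
    Integrable (fun z => f z *
      Complex.exp (-Complex.I * ((ξ 0 * z.1 + ξ 1 * z.2 + ξ 2 * φ z : ℝ) : ℂ)))
      (volume.restrict Sig2) := by
  have : IsFiniteMeasure (volume.restrict Sig2) :=
    ⟨by rw [Measure.restrict_apply_univ]; exact isCompact_Sig2.measure_lt_top⟩
  have h1 : Integrable f (volume.restrict Sig2) := (hf.restrict Sig2).integrable one_le_two
  refine h1.mul_bdd (c := 1) ?_ (Filter.Eventually.of_forall fun z => ?_)
  · refine ContinuousOn.aestronglyMeasurable ?_ isCompact_Sig2.measurableSet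
    fun_prop
  · rw [Complex.norm_exp]
    simp

theorem ext_sum {φ : ℝ × ℝ → ℝ} (hφ : ContinuousOn φ Sig2) {ι : Type*} (s : Finset ι)
    (f : ι → ℝ × ℝ → ℂ) (hf : ∀ i ∈ s, MemLp (f i) 2 volume) (ξ : Space) :
    ext φ (∑ i ∈ s, f i) ξ = ∑ i ∈ s, ext φ (f i) ξ := by
  unfold ext
  rw [← integral_finsetSum s fun i hi => integrable_ext hφ (hf i hi) ξ]
  refine integral_congr_ae (Filter.Eventually.of_forall fun z => ?_)
  simp only [Finset.sum_apply, Finset.sum_mul]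

theorem ext_zero (φ : ℝ × ℝ → ℝ) (ξ : Space) : ext φ 0 ξ = 0 := by simp [ext]

theorem memLp_sum {ι : Type*} (s : Finset ι) (f : ι → ℝ × ℝ → ℂ)
    (hf : ∀ i ∈ s, MemLp (f i) 2 volume) : MemLp (∑ i ∈ s, f i) 2 volume :=
  memLp_finsetSum' s hf

/-! ### Counting separated points -/

theorem card_le_of_injOn_grid {ι : Type*} (s : Finset ι) {d : ℕ} (F : ι → Fin d → ℤ) {B : ℝ}
    (hB : 0 ≤ B) (hF : ∀ i ∈ s, ∀ k, |(F i k : ℝ)| ≤ B) (hinj : Set.InjOn F s) :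
    (s.card : ℝ) ≤ (2 * B + 1) ^ d := by
  classical
  have h1 : s.card ≤ (Fintype.piFinset fun _ : Fin d => Finset.Icc (-⌊B⌋) ⌊B⌋).card := by
    refine Finset.card_le_card_of_injOn F (fun i hi => ?_) hinj
    rw [Finset.mem_coe, Fintype.mem_piFinset]
    intro k
    have h := abs_le.1 (hF i hi k)
    rw [Finset.mem_Icc]
    constructor
    · rw [neg_le, Int.le_floor]
      push_cast
      linarith
    · rw [Int.le_floor]
      exact h.2
  rw [Fintype.card_piFinset_const, Int.card_Icc] at h1
  have h2 : ((⌊B⌋ + 1 - -⌊B⌋).toNat : ℝ) ≤ 2 * B + 1 := by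
    have h0 : 0 ≤ ⌊B⌋ := Int.floor_nonneg.2 hB
    have e : ((⌊B⌋ + 1 - -⌊B⌋).toNat : ℝ) = ((⌊B⌋ + 1 - -⌊B⌋ : ℤ) : ℝ) := by
      exact_mod_cast Int.toNat_of_nonneg (by omega)
    rw [e]
    push_cast
    linarith [Int.floor_le B]
  calc (s.card : ℝ) ≤ ((⌊B⌋ + 1 - -⌊B⌋).toNat : ℝ) ^ d := by exact_mod_cast h1
    _ ≤ _ := by gcongr

theorem abs_sub_lt_of_floor_eq {q x y : ℝ} (hq : 0 < q) (h : ⌊x / q⌋ = ⌊y / q⌋) : |x - y| < q := by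
  have := Int.abs_sub_lt_one_of_floor_eq_floor h
  rw [← sub_div, abs_div, abs_of_pos hq, div_lt_one hq] at this
  exact this

theorem abs_floor_div_le {q x b : ℝ} (hq : 0 < q) (h : |x| ≤ b) : |(⌊x / q⌋ : ℝ)| ≤ b / q + 1 := by
  have h1 := Int.floor_le (x / q)
  have h2 := Int.lt_floor_add_one (x / q)
  have h3 : |x / q| ≤ b / q := by
    rw [abs_div, abs_of_pos hq]
    gcongr
  have h4 := abs_le.1 h3
  exact abs_le.2 ⟨by linarith, by linarith⟩

/-- Two centres in one cell of the grid of mesh 1/(2K) would be closer than 1/K; the crude power K^3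
swallows the constants. -/
theorem card_caps_le {μ K : ℝ} (hK : 49 ≤ K) {𝒯 : Finset (ℝ × ℝ)} (h𝒯 : IsCapFamily μ K 𝒯) :
    (𝒯.card : ℝ) ≤ K ^ 3 := by
  have hK0 : 0 < K := by linarith
  set q := K⁻¹ / 2 with hq
  have hq0 : 0 < q := by positivity
  have h := card_le_of_injOn_grid 𝒯 (fun c => ![⌊c.1 / q⌋, ⌊c.2 / q⌋]) (B := 1 / q + 1)
    (by positivity) (fun c hc k => ?_) (fun c hc c' hc' hcc => ?_)
  · refine h.trans ?_
    have e : 1 / q = 2 * K := by rw [hq]; field_simp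
    rw [e]
    nlinarith [sq_nonneg K]
  · have h1 := h𝒯.center_mem c hc
    fin_cases k
    · exact abs_floor_div_le hq0 (abs_le.2 h1.1)
    · exact abs_floor_div_le hq0 (abs_le.2 h1.2)
  · by_contra hne
    have h1 := congrFun hcc 0
    have h2 := congrFun hcc 1
    have h1 : ⌊c.1 / q⌋ = ⌊c'.1 / q⌋ := h1
    have h2 : ⌊c.2 / q⌋ = ⌊c'.2 / q⌋ := h2
    have h3 := abs_lt.1 (abs_sub_lt_of_floor_eq hq0 h1)
    have h4 := abs_lt.1 (abs_sub_lt_of_floor_eq hq0 h2)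
    have h5 := h𝒯.separated c hc c' hc' hne
    have h6 := Real.le_sqrt' (by positivity) |>.1 h5
    have h7 : (c.1 - c'.1) ^ 2 < q ^ 2 := sq_lt_sq' h3.1 h3.2
    have h8 : (c.2 - c'.2) ^ 2 < q ^ 2 := sq_lt_sq' h4.1 h4.2
    rw [hq] at h7 h8
    nlinarith [sq_nonneg K⁻¹]

theorem interior_square (c : ℝ × ℝ) (s : ℝ) : interior (square c s) =
    Ioo (c.1 - s / 2) (c.1 + s / 2) ×ˢ Ioo (c.2 - s / 2) (c.2 + s / 2) := by
  unfold square
  rw [interior_prod_eq, interior_Icc, interior_Icc]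

theorem norm_normal (φ : ℝ × ℝ → ℝ) (ω : ℝ × ℝ) : ‖normal φ ω‖ = 1 := by
  unfold normal
  rw [norm_smul, EuclideanSpace.norm_eq]
  have h : 0 < √(1 + dx φ ω ^ 2 + dy φ ω ^ 2) := Real.sqrt_pos.2 (by positivity)
  rw [Real.norm_eq_abs, abs_of_pos (by positivity)]
  have e : ∑ i : Fin 3, ‖(!₂[dx φ ω, dy φ ω, -1] : Space) i‖ ^ 2 =
      1 + dx φ ω ^ 2 + dy φ ω ^ 2 := by
    simp [Fin.sum_univ_three]
    ring
  rw [e]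
  exact inv_mul_cancel₀ h.ne'

theorem norm_le_of_mem_cube {R : ℝ} (hR : 0 ≤ R) {ξ : Space} (hξ : ξ ∈ cube R) : ‖ξ‖ ≤ 2 * R := by
  rw [EuclideanSpace.norm_eq]
  refine Real.sqrt_le_iff.2 ⟨by linarith, ?_⟩
  have h (i : Fin 3) : ‖ξ i‖ ^ 2 ≤ R ^ 2 := by
    rw [Real.norm_eq_abs]
    exact pow_le_pow_left₀ (abs_nonneg _) (hξ i) 2
  rw [Fin.sum_univ_three]
  nlinarith [h 0, h 1, h 2]

/-- From a point of the cube, of norm at most 2R, one reaches the centre by at most R across the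
tube and 2R along it. -/
theorem norm_pt_le {φ : ℝ × ℝ → ℝ} {R δ : ℝ} (hR : 1 ≤ R) (hδ : δ ≤ 1 / 2) {T : Tube}
    (hT : (T.carrier φ R δ ∩ cube R).Nonempty) : ‖T.pt‖ ≤ 5 * R := by
  obtain ⟨ξ, ⟨h1, h2⟩, hξ⟩ := hT
  have h3 := norm_le_of_mem_cube (by linarith) hξ
  set t := inner ℝ (ξ - T.pt) (T.dir φ)
  have hrad : R ^ (1 / 2 + δ) ≤ R := by
    calc R ^ (1 / 2 + δ) ≤ R ^ (1 : ℝ) := Real.rpow_le_rpow_of_exponent_le hR (by linarith)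
      _ = R := Real.rpow_one R
  have e : T.pt = ξ - (ξ - T.pt - t • T.dir φ) - t • T.dir φ := by abel
  rw [e]
  have h4 : ‖t • T.dir φ‖ ≤ 2 * R := by
    rw [norm_smul, Tube.dir, norm_normal, mul_one, Real.norm_eq_abs]
    linarith
  have h5 := norm_sub_le (ξ - (ξ - T.pt - t • T.dir φ)) (t • T.dir φ)
  have h6 := norm_sub_le ξ (ξ - T.pt - t • T.dir φ)
  linarith

/-- A tube is determined by the grid cells, of half the respective separation, of its cap centre and
of its own centre: five integers of size O(R). A crude power of R suffices against R^{-1000}. -/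
theorem card_tubes_le {φ : ℝ × ℝ → ℝ} {R δ : ℝ} (hR : 1000 ≤ R) (hδ : δ ≤ 1 / 2)
    {Θ : Finset (ℝ × ℝ)} {𝕋 : Finset Tube} (hΘ : IsSmallCapDecomposition R Θ)
    (h𝕋 : IsTubeFamily φ R δ Θ 𝕋) : (𝕋.card : ℝ) ≤ R ^ 10 := by
  have hR0 : 0 < R := by linarith
  set q := R ^ (-(1 / 2) : ℝ) / 2 with hq
  set p := R ^ (1 / 2 : ℝ) / 2 with hp
  have hq0 : 0 < q := by positivity
  have hp0 : 0 < p := by positivity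
  have hRh : 1 ≤ R ^ (1 / 2 : ℝ) := Real.one_le_rpow (by linarith) (by norm_num)
  have hRle : R ^ (1 / 2 : ℝ) ≤ R := by
    calc R ^ (1 / 2 : ℝ) ≤ R ^ (1 : ℝ) := Real.rpow_le_rpow_of_exponent_le (by linarith)
          (by norm_num)
      _ = R := Real.rpow_one R
  have e1 : 1 / q ≤ 2 * R := by
    have : 1 / q = 2 * R ^ (1 / 2 : ℝ) := by
      rw [hq, Real.rpow_neg hR0.le]
      field_simp
    linarith
  have e2 : 5 * R / p ≤ 10 * R := by
    rw [div_le_iff₀ hp0, hp]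
    nlinarith
  have h := card_le_of_injOn_grid 𝕋 (fun T => ![⌊T.ω.1 / q⌋, ⌊T.ω.2 / q⌋, ⌊T.pt 0 / p⌋,
    ⌊T.pt 1 / p⌋, ⌊T.pt 2 / p⌋]) (B := 10 * R + 1)
    (by positivity) (fun T hT k => ?_) (fun T hT T' hT' hTT => ?_)
  · refine h.trans ?_
    calc (2 * (10 * R + 1) + 1) ^ 5 ≤ (R ^ 2) ^ 5 := by
          gcongr
          nlinarith
      _ = R ^ 10 := by ring
  · have h1 := hΘ.center_mem _ (h𝕋.cap_mem T hT)
    have h2 := norm_pt_le (by linarith) hδ (h𝕋.meets T hT)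
    have h3 (i : Fin 3) : |T.pt i| ≤ 5 * R := (PiLp.norm_apply_le T.pt i).trans h2
    fin_cases k
    · exact (abs_floor_div_le hq0 (abs_le.2 h1.1)).trans (by linarith)
    · exact (abs_floor_div_le hq0 (abs_le.2 h1.2)).trans (by linarith)
    · exact (abs_floor_div_le hp0 (h3 0)).trans (by linarith)
    · exact (abs_floor_div_le hp0 (h3 1)).trans (by linarith)
    · exact (abs_floor_div_le hp0 (h3 2)).trans (by linarith)
  · have k0 : ⌊T.ω.1 / q⌋ = ⌊T'.ω.1 / q⌋ := congrFun hTT 0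
    have k1 : ⌊T.ω.2 / q⌋ = ⌊T'.ω.2 / q⌋ := congrFun hTT 1
    have k2 : ⌊T.pt 0 / p⌋ = ⌊T'.pt 0 / p⌋ := congrFun hTT 2
    have k3 : ⌊T.pt 1 / p⌋ = ⌊T'.pt 1 / p⌋ := congrFun hTT 3
    have k4 : ⌊T.pt 2 / p⌋ = ⌊T'.pt 2 / p⌋ := congrFun hTT 4
    have hω : T.ω = T'.ω := by
      by_contra hne
      have hd := hΘ.disjoint _ (h𝕋.cap_mem T hT) _ (h𝕋.cap_mem T' hT') hne
      have h1 := abs_lt.1 (abs_sub_lt_of_floor_eq hq0 k0)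
      have h2 := abs_lt.1 (abs_sub_lt_of_floor_eq hq0 k1)
      refine (Set.disjoint_left.1 hd : ∀ ⦃a⦄, _ → _) (?_ : T.ω ∈ _) ?_ <;> rw [interior_square] <;>
        refine ⟨⟨?_, ?_⟩, ?_, ?_⟩ <;> linarith
    by_contra hne
    have hs := h𝕋.separated T hT T' hT' hω hne
    have h1 := abs_lt.1 (abs_sub_lt_of_floor_eq hp0 k2)
    have h2 := abs_lt.1 (abs_sub_lt_of_floor_eq hp0 k3)
    have h3 := abs_lt.1 (abs_sub_lt_of_floor_eq hp0 k4)
    rw [EuclideanSpace.dist_eq, Fin.sum_univ_three, Real.dist_eq, Real.dist_eq, Real.dist_eq,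
      sq_abs, sq_abs, sq_abs] at hs
    have h6 := Real.le_sqrt' (by positivity) |>.1 hs
    have h7 : (T.pt 0 - T'.pt 0) ^ 2 < p ^ 2 := sq_lt_sq' h1.1 h1.2
    have h8 : (T.pt 1 - T'.pt 1) ^ 2 < p ^ 2 := sq_lt_sq' h2.1 h2.2
    have h9 : (T.pt 2 - T'.pt 2) ^ 2 < p ^ 2 := sq_lt_sq' h3.1 h3.2
    rw [hp] at h7 h8 h9
    nlinarith [sq_nonneg (R ^ (1 / 2 : ℝ))]

/-! ### Tangential and transversal parts -/

open Classical in
-- Since ξ lies in the wall and in the ball, a tube through ξ meets both, and the angle condition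
-- either holds at all the relevant points or fails at one. Tubes of neither kind thus miss ξ, where
-- their wave packets are tiny.
theorem norm_ext_sub_tang_sub_trans_le {φ : ℝ × ℝ → ℝ} (hφ : ContinuousOn φ Sig2) {R δ Cw : ℝ}
    {Θ : Finset (ℝ × ℝ)} {𝕋 : Finset Tube} {f : ℝ × ℝ → ℂ} {F : Tube → ℝ × ℝ → ℂ}
    (hF : IsWavePacketDecomposition φ R δ Cw Θ 𝕋 f F) {P : MvPolynomial (Fin 3) ℝ} {b ξ : Space}
    (hξ : ξ ∈ cube R) (hξ' : ξ ∈ ballJ R δ 1 b ∩ wall P R δ) :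
    ‖ext φ f ξ - ext φ (∑ T ∈ 𝕋 with IsTang φ R δ P b T, F T) ξ -
        ext φ (∑ T ∈ 𝕋 with IsTrans φ R δ P b T, F T) ξ‖ ≤
      (1 + 𝕋.card) * (R ^ (-1000 : ℝ) * l2norm f) := by
  set E := R ^ (-1000 : ℝ) * l2norm f with hE
  rw [ext_sum hφ _ _ (fun T hT => hF.memLp T (Finset.mem_filter.1 hT).1),
    ext_sum hφ _ _ (fun T hT => hF.memLp T (Finset.mem_filter.1 hT).1)]
  have hE0 : 0 ≤ E := (norm_nonneg _).trans (hF.approx ξ hξ)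
  have hsplit : ∑ T ∈ 𝕋, ext φ (F T) ξ = ∑ T ∈ 𝕋 with IsTang φ R δ P b T, ext φ (F T) ξ +
      ∑ T ∈ 𝕋 with IsTrans φ R δ P b T, ext φ (F T) ξ +
      ∑ T ∈ 𝕋 with ¬ IsTang φ R δ P b T ∧ ¬ IsTrans φ R δ P b T, ext φ (F T) ξ := by
    rw [Finset.sum_filter, Finset.sum_filter, Finset.sum_filter, ← Finset.sum_add_distrib,
      ← Finset.sum_add_distrib]
    refine Finset.sum_congr rfl fun T _ => ?_
    have hdisj : ¬ (IsTang φ R δ P b T ∧ IsTrans φ R δ P b T) := by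
      rintro ⟨⟨-, h⟩, -, ζ, h1, h2, h3, h4⟩
      exact absurd (h ζ h1 h2 h3) (not_le.2 h4)
    by_cases h1 : IsTang φ R δ P b T <;> by_cases h2 : IsTrans φ R δ P b T
    · exact absurd ⟨h1, h2⟩ hdisj
    all_goals simp [h1, h2]
  have hrest : ‖∑ T ∈ 𝕋 with ¬ IsTang φ R δ P b T ∧ ¬ IsTrans φ R δ P b T, ext φ (F T) ξ‖ ≤
      𝕋.card * E := by
    refine (norm_sum_le _ _).trans ((Finset.sum_le_card_nsmul _ _ E fun T hT => ?_).trans ?_)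
    · rw [Finset.mem_filter] at hT
      refine hF.small_off_tube T hT.1 ξ ⟨hξ, fun hc => ?_⟩
      have hne : (T.carrier φ R δ ∩ wall P R δ ∩ ballJ R δ 1 b).Nonempty :=
        ⟨ξ, ⟨hc, hξ'.2⟩, hξ'.1⟩
      refine hT.2.1 ⟨hne, fun ζ h1 h2 h3 => ?_⟩
      by_contra h4
      exact hT.2.2 ⟨hne, ζ, h1, h2, h3, not_le.1 h4⟩
    · rw [nsmul_eq_mul]
      gcongr
      exact Finset.filter_subset _ _
  have happ := hF.approx ξ hξ
  rw [hsplit] at happ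
  set x := ext φ f ξ
  set t := ∑ T ∈ 𝕋 with IsTang φ R δ P b T, ext φ (F T) ξ
  set s := ∑ T ∈ 𝕋 with IsTrans φ R δ P b T, ext φ (F T) ξ
  set w := ∑ T ∈ 𝕋 with ¬ IsTang φ R δ P b T ∧ ¬ IsTrans φ R δ P b T, ext φ (F T) ξ
  rw [show x - t - s = (x - (t + s + w)) + w by ring]
  refine (norm_add_le _ _).trans ?_
  linarith

/-! ### Inclusion-exclusion over the exceptional sets -/

theorem card_filter_card_le {α : Type*} [DecidableEq α] (s : Finset α) (N : ℕ) :
    (s.powerset.filter fun t => t.card ≤ N).card ≤ (N + 1) * (s.card + 1) ^ N := by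
  have h : (s.powerset.filter fun t => t.card ≤ N) ⊆
      (Finset.range (N + 1)).biUnion fun m => s.powersetCard m := by
    intro t ht
    rw [Finset.mem_filter, Finset.mem_powerset] at ht
    rw [Finset.mem_biUnion]
    exact ⟨t.card, Finset.mem_range.2 (by omega), Finset.mem_powersetCard.2 ⟨ht.1, rfl⟩⟩
  refine (Finset.card_le_card h).trans (Finset.card_biUnion_le.trans ?_)
  refine (Finset.sum_le_card_nsmul _ _ ((s.card + 1) ^ N) fun m hm => ?_).trans ?_
  · rw [Finset.card_powersetCard]
    rw [Finset.mem_range] at hm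
    exact (Nat.choose_le_pow s.card m).trans ((Nat.pow_le_pow_left (by omega) m).trans
      (Nat.pow_le_pow_right (by omega) (by omega)))
  · simp

theorem subset_famLbar {φ : ℝ × ℝ → ℝ} {C C' ε' μ K : ℝ} {L : Set (ℝ × ℝ)}
    (hL : L ∈ famL φ C C' ε' μ K) : L ∈ famLbar φ C C' ε' μ K :=
  ⟨{L}, by simp, by simpa using hL, by simp⟩

open Classical in
/-- The caps inside the members of `D` and inside some member of `𝓒` contribute little at a broad
point. -/
theorem norm_sum_covered_le {φ : ℝ × ℝ → ℝ} {C C' ε' μ K B : ℝ} {N : ℕ} {𝒯 : Finset (ℝ × ℝ)}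
    (hK : 0 ≤ K) (h𝒯 : ∀ c ∈ 𝒯, c ∈ Sig)
    (hN : ∀ z ∈ Sig, {Δ | Δ ∈ famLbar φ C C' ε' μ K ∧ z ∈ Δ}.encard ≤ N)
    (a : ℝ × ℝ → ℂ) (hB0 : 0 ≤ B)
    (hB : ∀ Δ ∈ famLbar φ C C' ε' μ K, ‖∑ c ∈ 𝒯 with cap μ K c ⊆ Δ, a c‖ ≤ B)
    (D 𝓒 : Finset (Set (ℝ × ℝ))) (hD : (D : Set (Set (ℝ × ℝ))) ⊆ famL φ C C' ε' μ K)
    (h𝓒 : (𝓒 : Set (Set (ℝ × ℝ))) ⊆ famL φ C C' ε' μ K) :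
    ‖∑ c ∈ 𝒯 with (∀ L ∈ D, cap μ K c ⊆ L) ∧ ∃ L ∈ 𝓒, cap μ K c ⊆ L, a c‖ ≤
      ((N + 1) * (𝓒.card + 1) ^ N : ℕ) * B := by
  set S : Set (ℝ × ℝ) → Finset (ℝ × ℝ) := fun L =>
    {c ∈ 𝒯 | (∀ L' ∈ D, cap μ K c ⊆ L') ∧ cap μ K c ⊆ L} with hS
  have e : {c ∈ 𝒯 | (∀ L ∈ D, cap μ K c ⊆ L) ∧ ∃ L ∈ 𝓒, cap μ K c ⊆ L} = 𝓒.biUnion S := by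
    ext c
    simp only [hS, Finset.mem_filter, Finset.mem_biUnion]
    constructor
    · rintro ⟨h1, h2, L, hL, h3⟩
      exact ⟨L, hL, h1, h2, h3⟩
    · rintro ⟨L, hL, h1, h2, h3⟩
      exact ⟨h1, h2, L, hL, h3⟩
  rw [e, Finset.inclusion_exclusion_sum_biUnion]
  have hterm (t : 𝓒.powerset.filter (·.Nonempty)) :
      ‖(-1) ^ (t.1.card + 1) • ∑ c ∈ t.1.inf' (Finset.mem_filter.1 t.2).2 S, a c‖ ≤
        if t.1.card ≤ N then B else 0 := by
    obtain ⟨t, ht⟩ := t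
    have ht' := Finset.mem_filter.1 ht
    have htsub : t ⊆ 𝓒 := Finset.mem_powerset.1 ht'.1
    have hmem (c : ℝ × ℝ) : c ∈ t.inf' ht'.2 S ↔ ∀ L ∈ t, c ∈ S L := by
      rw [← Finset.singleton_subset_iff]
      simp
    have hnorm (x : ℂ) : ‖(-1) ^ (t.card + 1) • x‖ = ‖x‖ := by
      rcases neg_one_pow_eq_or ℤ (t.card + 1) with h | h <;> rw [h] <;> simp
    dsimp only
    rw [hnorm]
    split_ifs with hcard
    -- The caps lying in all members of D and t are those inside one intersection, which is again in
    -- `famLbar`; this is why broadness is tested on intersections.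
    · have e2 : t.inf' ht'.2 S =
          {c ∈ 𝒯 | cap μ K c ⊆ ⋂₀ ((D ∪ t : Finset (Set (ℝ × ℝ))) : Set (Set (ℝ × ℝ)))} := by
        ext c
        rw [hmem]
        simp only [hS, Finset.mem_filter, Set.subset_sInter_iff, Finset.coe_union, mem_union,
          Finset.mem_coe]
        constructor
        · intro h
          obtain ⟨L₀, hL₀⟩ := ht'.2
          exact ⟨(h L₀ hL₀).1, fun L hL => hL.elim (fun h' => (h L₀ hL₀).2.1 L h')
            fun h' => (h L h').2.2⟩
        · rintro ⟨h1, h2⟩ L hL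
          exact ⟨h1, fun L' hL' => h2 L' (Or.inl hL'), h2 L (Or.inr hL)⟩
      rw [e2]
      refine hB _ ⟨D ∪ t, ?_, ?_, rfl⟩
      · exact ht'.2.mono Finset.subset_union_right
      · rw [Finset.coe_union]
        exact union_subset hD ((Finset.coe_subset.2 htsub).trans h𝓒)
    -- A cap inside more than N distinct members would have its centre in all of them, against the
    -- overlap bound.
    · have e2 : t.inf' ht'.2 S = ∅ := by
        rw [Finset.eq_empty_iff_forall_notMem]
        intro c hc
        rw [hmem] at hc
        obtain ⟨L₀, hL₀⟩ := ht'.2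
        have hc𝒯 : c ∈ 𝒯 := (Finset.mem_filter.1 (hc L₀ hL₀)).1
        have hcc : c ∈ cap μ K c := by
          have hs : 0 ≤ √μ / K / 2 := by positivity
          exact ⟨⟨⟨by linarith, by linarith⟩, by linarith, by linarith⟩, h𝒯 c hc𝒯⟩
        have hsub : (t : Set (Set (ℝ × ℝ))) ⊆ {Δ | Δ ∈ famLbar φ C C' ε' μ K ∧ c ∈ Δ} :=
          fun L hL => ⟨subset_famLbar (h𝓒 (htsub hL)),
            (Finset.mem_filter.1 (hc L hL)).2.2 hcc⟩
        have := (encard_le_encard hsub).trans (hN c (h𝒯 c hc𝒯))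
        rw [encard_coe_eq_coe_finsetCard] at this
        exact hcard (by exact_mod_cast this)
      rw [e2]
      simp
  refine (norm_sum_le _ _).trans ((Finset.sum_le_sum fun t _ => hterm t).trans ?_)
  rw [Finset.sum_coe_sort (𝓒.powerset.filter (·.Nonempty))
    (fun t => if t.card ≤ N then B else 0), ← Finset.sum_filter, Finset.sum_const, nsmul_eq_mul]
  refine mul_le_mul_of_nonneg_right ?_ hB0
  refine Nat.cast_le.2 (le_trans (Finset.card_le_card ?_) (card_filter_card_le 𝓒 N))
  intro t ht
  rw [Finset.mem_filter, Finset.mem_filter] at ht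
  exact Finset.mem_filter.2 ⟨ht.1.1, ht.2⟩

open Classical in
/-- Discarding the caps inside the exceptional sets `𝓒`, and then all but the transversal parts,
changes the relevant sums only a little at a broad point. -/
theorem norm_sum_sub_sum_trans_le {φ : ℝ × ℝ → ℝ} {C C' ε' μ K B τ η : ℝ} {N : ℕ}
    {𝒯 : Finset (ℝ × ℝ)} (hK : 0 ≤ K) (h𝒯 : ∀ c ∈ 𝒯, c ∈ Sig)
    (hN : ∀ z ∈ Sig, {Δ | Δ ∈ famLbar φ C C' ε' μ K ∧ z ∈ Δ}.encard ≤ N)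
    (a t s : ℝ × ℝ → ℂ) (hB0 : 0 ≤ B) (hτ : 0 ≤ τ)
    (hB : ∀ Δ ∈ famLbar φ C C' ε' μ K, ‖∑ c ∈ 𝒯 with cap μ K c ⊆ Δ, a c‖ ≤ B)
    (hη : ∑ c ∈ 𝒯, ‖a c - t c - s c‖ ≤ η) (𝓒 : Finset (Set (ℝ × ℝ)))
    (h𝓒 : (𝓒 : Set (Set (ℝ × ℝ))) ⊆ famL φ C C' ε' μ K)
    (hcov : ∀ c ∈ 𝒯, τ < ‖t c‖ → ∃ L ∈ 𝓒, cap μ K c ⊆ L)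
    (D : Finset (Set (ℝ × ℝ))) (hD : (D : Set (Set (ℝ × ℝ))) ⊆ famL φ C C' ε' μ K) :
    ‖∑ c ∈ 𝒯 with ∀ L ∈ D, cap μ K c ⊆ L, a c - ∑ c ∈ 𝒯 with ∀ L ∈ D, cap μ K c ⊆ L,
      (if c ∈ 𝒯.filter (fun c => ¬ ∃ L ∈ 𝓒, cap μ K c ⊆ L) then s c else 0)‖ ≤
      ((N + 1) * (𝓒.card + 1) ^ N : ℕ) * B + (𝒯.card * τ + η) := by
  have h1 := norm_sum_covered_le hK h𝒯 hN a hB0 hB D 𝓒 hD h𝓒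
  rw [← Finset.filter_filter] at h1
  set W := 𝒯.filter fun c => ∀ L ∈ D, cap μ K c ⊆ L
  have hW𝒯 : W ⊆ 𝒯 := Finset.filter_subset _ _
  clear_value W
  have e1 : ∑ c ∈ W, (if c ∈ 𝒯.filter (fun c => ¬ ∃ L ∈ 𝓒, cap μ K c ⊆ L) then s c else 0) =
      ∑ c ∈ W with ¬ ∃ L ∈ 𝓒, cap μ K c ⊆ L, s c := by
    rw [Finset.sum_filter]
    refine Finset.sum_congr rfl fun c hc => ?_
    simp only [Finset.mem_filter, hW𝒯 hc, true_and]
  rw [e1, ← Finset.sum_filter_add_sum_filter_not W (fun c => ∃ L ∈ 𝓒, cap μ K c ⊆ L),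
    add_sub_assoc, ← Finset.sum_sub_distrib]
  refine (norm_add_le _ _).trans (add_le_add h1 ((norm_sum_le _ _).trans ?_))
  -- A cap outside the cover has tangential part at most τ, so the full and the transversal
  -- contributions nearly agree.
  have h2 : ∀ c ∈ W.filter (fun c => ¬ ∃ L ∈ 𝓒, cap μ K c ⊆ L),
      ‖a c - s c‖ ≤ τ + ‖a c - t c - s c‖ := by
    intro c hc
    rw [Finset.mem_filter] at hc
    have ht : ‖t c‖ ≤ τ := by
      by_contra h
      exact hc.2 (hcov c (hW𝒯 hc.1) (not_le.1 h))
    have := norm_add_le (t c) (a c - t c - s c)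
    rw [show t c + (a c - t c - s c) = a c - s c by ring] at this
    linarith
  refine (Finset.sum_le_sum h2).trans ?_
  refine (Finset.sum_le_sum_of_subset_of_nonneg ((Finset.filter_subset _ _).trans hW𝒯)
    fun c _ _ => by positivity).trans ?_
  rw [Finset.sum_add_distrib, Finset.sum_const, nsmul_eq_mul]
  linarith

/-! ### The bilinear term and the pointwise broad estimate -/

theorem le_Bil {φ : ℝ × ℝ → ℝ} {μ K : ℝ} {𝒯 : Finset (ℝ × ℝ)} (f : ℝ × ℝ → ℝ × ℝ → ℂ) (ξ : Space)
    {c c' : ℝ × ℝ} (hc : c ∈ 𝒯) (hc' : c' ∈ 𝒯) (h : StronglySeparated φ μ K c c') :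
    √‖ext φ (f c) ξ‖ * √‖ext φ (f c') ξ‖ ≤ Bil φ μ K 𝒯 f ξ := by
  -- A real supremum bounds its terms only when the range is bounded; here the index set is finite.
  have hfin : Finite {p : (ℝ × ℝ) × (ℝ × ℝ) // p.1 ∈ 𝒯 ∧ p.2 ∈ 𝒯 ∧
      StronglySeparated φ μ K p.1 p.2} := by
    refine Set.Finite.subset (𝒯 ×ˢ 𝒯).finite_toSet fun p hp => ?_
    rw [Finset.mem_coe, Finset.mem_product]
    exact ⟨hp.1, hp.2.1⟩
  exact le_ciSup (f := fun p : {p : (ℝ × ℝ) × (ℝ × ℝ) // p.1 ∈ 𝒯 ∧ p.2 ∈ 𝒯 ∧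
      StronglySeparated φ μ K p.1 p.2} => √‖ext φ (f p.1.1) ξ‖ * √‖ext φ (f p.1.2) ξ‖)
    (Set.finite_range _).bddAbove ⟨(c, c'), hc, hc', h⟩

theorem Bil_nonneg (φ : ℝ × ℝ → ℝ) (μ K : ℝ) (𝒯 : Finset (ℝ × ℝ)) (f : ℝ × ℝ → ℝ × ℝ → ℂ)
    (ξ : Space) : 0 ≤ Bil φ μ K 𝒯 f ξ :=
  Real.iSup_nonneg fun _ => by positivity

theorem Br_nonneg (φ : ℝ × ℝ → ℝ) (C C' ε' μ K : ℝ) (𝒯 : Finset (ℝ × ℝ)) (α : ℝ)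
    (f : ℝ × ℝ → ℝ × ℝ → ℂ) (ξ : Space) : 0 ≤ Br φ C C' ε' μ K 𝒯 α f ξ := by
  unfold Br
  split_ifs
  · exact norm_nonneg _
  · exact le_rfl

open Classical in
/-- The pointwise broad estimate, with the requirements on the parameters made explicit. -/
theorem Br_le {M N : ℕ} {φ : ℝ × ℝ → ℝ} {C C' ε' μ K α R δ Cw n β : ℝ}
    (hφ : IsHyp M φ) (hK : 49 ≤ K) (hα : K⁻¹ ≤ α) (hR : 1000 ≤ R) (hKR : K ≤ R) (hδ : δ ≤ 1 / 2)
    (hN : ∀ z ∈ Sig, {Δ | Δ ∈ famLbar φ C C' ε' μ K ∧ z ∈ Δ}.encard ≤ N)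
    (hcover : ∀ Y : Set (ℝ × ℝ), Y ⊆ Sig →
      (∀ z ∈ Y, ∀ w ∈ Y, ¬ StronglySeparated φ μ K z w) →
      ∃ 𝓒 : Finset (Set (ℝ × ℝ)), (𝓒 : Set (Set (ℝ × ℝ))) ⊆ famL φ C C' ε' μ K ∧
        (𝓒.card : ℝ) ≤ n ∧ ∀ z ∈ Y, ∃ L ∈ 𝓒, cap μ K z ⊆ L)
    (hnα : (N + 1) * (n + 1) ^ N * α ≤ 1 / 4) (hnβ : 2 * ((N + 1) * (n + 1) ^ N + 2) ≤ β)
    {𝒯 : Finset (ℝ × ℝ)} (h𝒯 : IsCapFamily μ K 𝒯) {f : ℝ × ℝ → ℝ × ℝ → ℂ}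
    (hf : ∀ c ∈ 𝒯, MemLp (f c) 2 volume) {Θ : Finset (ℝ × ℝ)} {𝕋 : Finset Tube}
    (hΘ : IsSmallCapDecomposition R Θ) (h𝕋 : IsTubeFamily φ R δ Θ 𝕋)
    {F : ℝ × ℝ → Tube → ℝ × ℝ → ℂ}
    (hF : ∀ c ∈ 𝒯, IsWavePacketDecomposition φ R δ Cw Θ 𝕋 (f c) (F c))
    (P : MvPolynomial (Fin 3) ℝ) (b ξ : Space) (hξ : ξ ∈ cube R)
    (hξ' : ξ ∈ ballJ R δ 1 b ∩ wall P R δ) :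
    Br φ C C' ε' μ K 𝒯 α f ξ ≤
      2 * (∑ I ∈ 𝒯.powerset, Br φ C C' ε' μ K 𝒯 (β * α) (transPart φ R δ P b 𝕋 F I) ξ
          + K ^ 100 * Bil φ μ K 𝒯 (tangPart φ R δ P b 𝕋 F) ξ
          + R ^ (-900 : ℝ) * ∑ c ∈ 𝒯, l2norm (f c)) := by
  have hK0 : 0 < K := by linarith
  have hR0 : 0 < R := by linarith
  have hα0 : 0 < α := lt_of_lt_of_le (by positivity) hα
  have hcont := hφ.contDiffOn.continuousOn
  set Λ := R ^ (-900 : ℝ) * ∑ c ∈ 𝒯, l2norm (f c) with hΛ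
  have hΛ0 : 0 ≤ Λ := mul_nonneg (by positivity)
    (Finset.sum_nonneg fun _ _ => ENNReal.toReal_nonneg)
  have hBil0 := Bil_nonneg φ μ K 𝒯 (tangPart φ R δ P b 𝕋 F) ξ
  have hsum0 : 0 ≤ ∑ I ∈ 𝒯.powerset,
      Br φ C C' ε' μ K 𝒯 (β * α) (transPart φ R δ P b 𝕋 F I) ξ :=
    Finset.sum_nonneg fun I _ => Br_nonneg _ _ _ _ _ _ _ _ _ _
  set Ssum := ∑ I ∈ 𝒯.powerset, Br φ C C' ε' μ K 𝒯 (β * α) (transPart φ R δ P b 𝕋 F I) ξ with hSs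
  have hKB0 : 0 ≤ K ^ 100 * Bil φ μ K 𝒯 (tangPart φ R δ P b 𝕋 F) ξ := by positivity
  set X := ‖ext φ (∑ c ∈ 𝒯, f c) ξ‖ with hX
  have hX0 : 0 ≤ X := norm_nonneg _
  by_cases hbroad : IsBroad φ C C' ε' μ K 𝒯 α f ξ
  swap
  · unfold Br
    rw [if_neg hbroad]
    positivity
  have hBr : Br φ C C' ε' μ K 𝒯 α f ξ = X := if_pos hbroad
  rw [hBr]
  -- Beyond this case all errors of size Λ can be measured against X.
  rcases le_or_gt X (2 * Λ) with hXΛ | hXΛ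
  · linarith
  have hXpos : 0 < X := by linarith
  set a : ℝ × ℝ → ℂ := fun c => ext φ (f c) ξ with ha
  set t : ℝ × ℝ → ℂ := fun c => ext φ (tangPart φ R δ P b 𝕋 F c) ξ with ht
  set s : ℝ × ℝ → ℂ := fun c => ext φ (∑ T ∈ 𝕋 with IsTrans φ R δ P b T, F c T) ξ with hs
  have hsmem (c : ℝ × ℝ) (hc : c ∈ 𝒯) :
      MemLp (∑ T ∈ 𝕋 with IsTrans φ R δ P b T, F c T) 2 volume :=
    memLp_sum _ _ fun T hT => (hF c hc).memLp T (Finset.mem_filter.1 hT).1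
  have hXa : X = ‖∑ c ∈ 𝒯, a c‖ := by rw [hX, ext_sum hcont 𝒯 f hf]
  have hB : ∀ Δ ∈ famLbar φ C C' ε' μ K, ‖∑ c ∈ 𝒯 with cap μ K c ⊆ Δ, a c‖ ≤ α * X := by
    intro Δ hΔ
    have := hbroad Δ hΔ
    rwa [partIn, ext_sum hcont _ _ (fun c hc => hf c (Finset.mem_filter.1 hc).1)] at this
  have hη : ∑ c ∈ 𝒯, ‖a c - t c - s c‖ ≤ (K ^ 2)⁻¹ * X := by
    have h1 : ∀ c ∈ 𝒯, ‖a c - t c - s c‖ ≤ (1 + 𝕋.card) * (R ^ (-1000 : ℝ) * l2norm (f c)) :=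
      fun c hc => norm_ext_sub_tang_sub_trans_le hcont (hF c hc) hξ hξ'
    refine (Finset.sum_le_sum h1).trans ?_
    rw [← Finset.mul_sum, ← Finset.mul_sum]
    have e : R ^ (-1000 : ℝ) = (R ^ 100)⁻¹ * R ^ (-900 : ℝ) := by
      rw [← Real.rpow_natCast, ← Real.rpow_neg hR0.le, ← Real.rpow_add hR0]
      norm_num
    rw [e, mul_assoc, ← hΛ, ← mul_assoc]
    have h2 : (1 + (𝕋.card : ℝ)) * (R ^ 100)⁻¹ ≤ (K ^ 2)⁻¹ := by
      have h3 := card_tubes_le hR hδ hΘ h𝕋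
      have h4 : 1 + (𝕋.card : ℝ) ≤ R ^ 98 := by
        have h5 : (1 : ℝ) ≤ R ^ 10 := one_le_pow₀ (by linarith)
        calc 1 + (𝕋.card : ℝ) ≤ 2 * R ^ 10 := by linarith
          _ ≤ R * R ^ 10 := by gcongr; linarith
          _ = R ^ 11 := by ring
          _ ≤ R ^ 98 := pow_le_pow_right₀ (by linarith) (by norm_num)
      calc (1 + (𝕋.card : ℝ)) * (R ^ 100)⁻¹ ≤ R ^ 98 * (R ^ 100)⁻¹ := by gcongr
        _ = (R ^ 2)⁻¹ := by field_simp
        _ ≤ (K ^ 2)⁻¹ := by gcongr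
    exact mul_le_mul h2 (by linarith) hΛ0 (by positivity)
  -- This threshold makes one large separated pair give X ≤ K^100 · Bil, while at most K^3 caps
  -- below it contribute negligibly.
  set τ := X / K ^ 100 with hτ
  have hτ0 : 0 ≤ τ := by positivity
  by_cases hpair : ∃ c ∈ 𝒯, ∃ c' ∈ 𝒯, τ < ‖t c‖ ∧ τ < ‖t c'‖ ∧ StronglySeparated φ μ K c c'
  · obtain ⟨c, hc, c', hc', h1, h2, h3⟩ := hpair
    have h4 := le_Bil (tangPart φ R δ P b 𝕋 F) ξ hc hc' h3
    have h5 : τ ≤ √‖t c‖ * √‖t c'‖ := by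
      rw [← Real.mul_self_sqrt hτ0]
      exact mul_le_mul (Real.sqrt_le_sqrt h1.le) (Real.sqrt_le_sqrt h2.le) (Real.sqrt_nonneg _)
        (Real.sqrt_nonneg _)
    have h6 : X ≤ K ^ 100 * Bil φ μ K 𝒯 (tangPart φ R δ P b 𝕋 F) ξ := by
      have := h5.trans h4
      rw [hτ, div_le_iff₀ (by positivity)] at this
      linarith
    linarith
  push Not at hpair
  obtain ⟨𝓒, h𝓒, h𝓒n, hcov⟩ := hcover {c | c ∈ 𝒯 ∧ τ < ‖t c‖} (fun c hc => h𝒯.center_mem c hc.1)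
    fun z hz w hw => hpair z hz.1 w hw.1 hz.2 hw.2
  have hmain := norm_sum_sub_sum_trans_le hK0.le h𝒯.center_mem hN a t s (by positivity) hτ0 hB hη 𝓒
    h𝓒 (fun c hc h => hcov c ⟨hc, h⟩)
  set I := 𝒯.filter (fun c => ¬ ∃ L ∈ 𝓒, cap μ K c ⊆ L) with hI
  set U := (N + 1) * (n + 1) ^ N with hU
  have hT : (((N + 1) * (𝓒.card + 1) ^ N : ℕ) : ℝ) ≤ U := by
    rw [hU]
    push_cast
    gcongr
  have herr : 𝒯.card * τ + (K ^ 2)⁻¹ * X ≤ K⁻¹ * X := by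
    have h1 : 𝒯.card * τ ≤ (K ^ 2)⁻¹ * X := by
      have h2 := card_caps_le hK h𝒯
      calc 𝒯.card * τ ≤ K ^ 3 * τ := by gcongr
        _ = (K ^ 97)⁻¹ * X := by rw [hτ]; field_simp
        _ ≤ (K ^ 2)⁻¹ * X := by
          gcongr
          · linarith
          · norm_num
    have h2 : (K ^ 2)⁻¹ + (K ^ 2)⁻¹ ≤ K⁻¹ := by
      rw [← two_mul, mul_inv_le_iff₀ (by positivity)]
      field_simp
      linarith
    have h3 := mul_le_mul_of_nonneg_right h2 hX0
    linarith
  have hKinv : K⁻¹ ≤ 1 / 4 := by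
    rw [inv_le_comm₀ hK0 (by norm_num)]
    linarith
  have hIext (c : ℝ × ℝ) : ext φ (transPart φ R δ P b 𝕋 F I c) ξ = if c ∈ I then s c else 0 := by
    unfold transPart
    split_ifs
    · rfl
    · exact ext_zero φ ξ
  have hImem (c : ℝ × ℝ) (hc : c ∈ 𝒯) : MemLp (transPart φ R δ P b 𝕋 F I c) 2 volume := by
    unfold transPart
    split_ifs
    · exact hsmem c hc
    · exact MemLp.zero'
  have hmain' (D : Finset (Set (ℝ × ℝ))) (hD : (D : Set (Set (ℝ × ℝ))) ⊆ famL φ C C' ε' μ K) :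
      ‖∑ c ∈ 𝒯 with ∀ L ∈ D, cap μ K c ⊆ L, a c - ∑ c ∈ 𝒯 with ∀ L ∈ D, cap μ K c ⊆ L,
        (if c ∈ I then s c else 0)‖ ≤ U * (α * X) + K⁻¹ * X := by
    refine (hmain D hD).trans (add_le_add ?_ herr)
    gcongr
  -- The empty D imposes no condition on the caps; the two errors take away at most a quarter of X
  -- each.
  have hlow : X / 2 ≤ ‖∑ c ∈ 𝒯, if c ∈ I then s c else 0‖ := by
    have h1 := hmain' ∅ (by simp)
    simp only [Finset.notMem_empty, false_imp_iff, implies_true, Finset.filter_true] at h1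
    have h2 := norm_sub_norm_le (∑ c ∈ 𝒯, a c) (∑ c ∈ 𝒯, if c ∈ I then s c else 0)
    rw [← hXa] at h2
    have h3 : U * α * X ≤ 1 / 4 * X := mul_le_mul_of_nonneg_right hnα hX0
    have h4 : K⁻¹ * X ≤ 1 / 4 * X := mul_le_mul_of_nonneg_right hKinv hX0
    linarith
  have hSI : ext φ (∑ c ∈ 𝒯, transPart φ R δ P b 𝕋 F I c) ξ =
      ∑ c ∈ 𝒯, if c ∈ I then s c else 0 := by
    rw [ext_sum hcont _ _ hImem]
    exact Finset.sum_congr rfl fun c _ => hIext c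
  -- With Δ = ⋂ D, the part of f_{I,trans} in Δ is at most (U + 2)αX: broadness of f, the removed
  -- caps, and the error K⁻¹X ≤ αX. The lower bound X/2 for the full sum accounts for the factor 2
  -- in the condition on β.
  have hIbroad : IsBroad φ C C' ε' μ K 𝒯 (β * α) (transPart φ R δ P b 𝕋 F I) ξ := by
    intro Δ hΔ
    rw [hSI, partIn, ext_sum hcont _ _ (fun c hc => hImem c (Finset.mem_filter.1 hc).1),
      Finset.sum_congr rfl fun c _ => hIext c]
    have hBΔ := hB Δ hΔ
    obtain ⟨D, -, hD, rfl⟩ := hΔ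
    have h1 := hmain' D hD
    simp only [subset_sInter_iff, Finset.mem_coe] at hBΔ ⊢
    have h2 := norm_sub_norm_le (∑ c ∈ 𝒯 with ∀ L ∈ D, cap μ K c ⊆ L, if c ∈ I then s c else 0)
      (∑ c ∈ 𝒯 with ∀ L ∈ D, cap μ K c ⊆ L, a c)
    rw [norm_sub_rev] at h2
    have h3 : K⁻¹ * X ≤ α * X := by gcongr
    have hαX : 0 < α * X := by positivity
    have h4 : 2 * (U + 2) * (α * X) ≤ β * (α * X) := mul_le_mul_of_nonneg_right hnβ hαX.le
    have hβα : 0 ≤ β * α := by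
      have h0 : (0 : ℝ) ≤ (((N + 1) * (𝓒.card + 1) ^ N : ℕ) : ℝ) := Nat.cast_nonneg _
      exact mul_nonneg (by linarith) hα0.le
    have h5 := mul_le_mul_of_nonneg_left hlow hβα
    linarith
  have hBrI : Br φ C C' ε' μ K 𝒯 (β * α) (transPart φ R δ P b 𝕋 F I) ξ ≤ Ssum :=
    Finset.single_le_sum
      (f := fun I => Br φ C C' ε' μ K 𝒯 (β * α) (transPart φ R δ P b 𝕋 F I) ξ)
      (fun I _ => Br_nonneg _ _ _ _ _ _ _ _ _ _)
      (Finset.mem_powerset.2 (Finset.filter_subset _ _))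
  rw [show Br φ C C' ε' μ K 𝒯 (β * α) (transPart φ R δ P b 𝕋 F I) ξ = _ from if_pos hIbroad,
    hSI] at hBrI
  linarith

/-! ### Inequalities between the parameters -/

theorem eventually_le_rpow (c : ℝ) {y : ℝ} (hy : 0 < y) :
    ∀ᶠ K : ℝ in Filter.atTop, c ≤ K ^ y :=
  (tendsto_rpow_atTop hy).eventually_ge_atTop c

/-- The two conditions on α force μ ≤ K^{ε/2} ≤ K^{1/2}, so r ≤ K^{-1/2}; the rest is comparison of
powers of K. -/
theorem rad_bounds {ε ε' k μ α : ℝ} (hε1 : ε < 1 / 10) (hε' : 0 < ε')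
    (hε'ε : ε' ≤ ε / 10) (hk1 : 1 ≤ k) (hK4 : 5000 ≤ k ^ (1 / 4 : ℝ)) (hμ : 1 ≤ μ)
    (hα : k ^ (-ε) ≤ α) (hαμ : α * μ ≤ k ^ (-(ε / 2))) :
    rad μ k ≤ 1 ∧ √μ / k ≤ rad μ k / 5000 ∧ 2 * rad μ k < k ^ (-ε') / 2 := by
  have hk0 : 0 < k := by linarith
  have hμk : μ ≤ k ^ (1 / 2 : ℝ) := by
    have h1 : k ^ (-ε) * μ ≤ k ^ (-(ε / 2)) := (mul_le_mul_of_nonneg_right hα (by linarith)).trans hαμ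
    have h2 : μ = k ^ ε * (k ^ (-ε) * μ) := by
      rw [← mul_assoc, ← Real.rpow_add hk0]
      simp
    calc μ = k ^ ε * (k ^ (-ε) * μ) := h2
      _ ≤ k ^ ε * k ^ (-(ε / 2)) := by gcongr
      _ = k ^ (ε / 2) := by rw [← Real.rpow_add hk0]; ring_nf
      _ ≤ k ^ (1 / 2 : ℝ) := Real.rpow_le_rpow_of_exponent_le hk1 (by linarith)
  have hsμ : √μ ≤ k ^ (1 / 4 : ℝ) := by
    rw [Real.sqrt_le_left (by positivity), ← Real.rpow_natCast, ← Real.rpow_mul hk0.le]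
    norm_num
    exact hμk
  have hrad : rad μ k ≤ k ^ (-(1 / 2) : ℝ) := by
    calc rad μ k ≤ k ^ (1 / 4 : ℝ) * k ^ (-(3 / 4) : ℝ) := by unfold rad; gcongr
      _ = k ^ (-(1 / 2) : ℝ) := by rw [← Real.rpow_add hk0]; norm_num
  have hr1 : rad μ k ≤ 1 :=
    hrad.trans (Real.rpow_le_one_of_one_le_of_nonpos hk1 (by norm_num))
  have hcap : √μ / k ≤ rad μ k / 5000 := by
    have e : rad μ k = √μ / k * k ^ (1 / 4 : ℝ) := by
      unfold rad
      rw [div_mul_eq_mul_div, eq_div_iff hk0.ne', mul_assoc]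
      congr 1
      conv_lhs => rw [← Real.rpow_one k, ← Real.rpow_mul hk0.le, ← Real.rpow_add hk0]
      norm_num
    rw [e]
    have : 0 ≤ √μ / k := by positivity
    nlinarith
  have hrK : 2 * rad μ k < k ^ (-ε') / 2 := by
    have h1 : k ^ (-(1 / 2) : ℝ) * k ^ (1 / 4 : ℝ) ≤ k ^ (-ε') := by
      rw [← Real.rpow_add hk0]
      exact Real.rpow_le_rpow_of_exponent_le hk1 (by linarith)
    have h2 : 0 < k ^ (-(1 / 2) : ℝ) := by positivity
    nlinarith
  exact ⟨hr1, hcap, hrK⟩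

/-- One needs ε'(2M - 5) ≥ 3/4, where the extra ε' pays for D; for M ≥ 5 this follows from 2M - 5 ≥
M. -/
theorem mul_rpow_pow_le {D ε' k : ℝ} {M : ℕ} (hk1 : 1 ≤ k) (hε' : 0 < ε') (hMε : 3 / 4 ≤ ε' * M)
    (hM5 : 5 ≤ M) (hKD : D ≤ k ^ ε') :
    D * (k ^ (-(2 * ε'))) ^ (M - 2) ≤ k ^ (-(3 / 4) : ℝ) := by
  have hk0 : 0 < k := by linarith
  rw [← Real.rpow_natCast, ← Real.rpow_mul hk0.le, Nat.cast_sub (by omega)]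
  have hM5' : (5 : ℝ) ≤ M := by exact_mod_cast hM5
  calc D * k ^ (-(2 * ε') * ((M : ℝ) - (2 : ℕ))) ≤ k ^ ε' * k ^ (-(3 / 4) - ε') := by
        gcongr
        push_cast
        nlinarith
    _ = k ^ (-(3 / 4) : ℝ) := by rw [← Real.rpow_add hk0]; ring_nf

theorem card_factor_le (N : ℕ) {M : ℕ} (hM : 1 ≤ M) {ε' k : ℝ} (hε' : 0 < ε') (hk1 : 1 ≤ k) :
    ((N : ℝ) + 1) * (157 * M * k ^ (3 * ε') + 1) ^ N ≤
      (N + 1) * (158 * M) ^ N * k ^ (3 * N * ε') := by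
  have hk0 : 0 < k := by linarith
  have h1 : 1 ≤ (M : ℝ) * k ^ (3 * ε') := by
    have h2 := Real.one_le_rpow hk1 (by positivity : 0 ≤ 3 * ε')
    have h3 : (1 : ℝ) ≤ M := by exact_mod_cast hM
    exact one_le_mul_of_one_le_of_one_le h3 h2
  have e : k ^ (3 * N * ε') = (k ^ (3 * ε')) ^ N := by
    rw [← Real.rpow_natCast, ← Real.rpow_mul hk0.le]
    ring_nf
  calc ((N : ℝ) + 1) * (157 * M * k ^ (3 * ε') + 1) ^ N
      ≤ ((N : ℝ) + 1) * (158 * M * k ^ (3 * ε')) ^ N := by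
        gcongr
        linarith
    _ = (N + 1) * (158 * M) ^ N * k ^ (3 * N * ε') := by rw [e, mul_pow]; ring

end HypRestr

end

/-! ### Choice of the constants and conclusion -/

open HypRestr in
theorem lemma6p8 :
    ∃ C₀ : ℝ, ∀ C : ℝ, C₀ ≤ C → ∃ C₀' : ℝ, ∀ C' : ℝ, C₀' ≤ C' →
    -- the overlap constants exist, and the estimate holds for each of them
    (∃ N : ℕ, HypRestr.OverlapBound C C' N) ∧
    ∀ N : ℕ, HypRestr.OverlapBound C C' N →
    ∀ ε : ℝ, 0 < ε → ε < 1 / 10 ^ 10 →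
    ∀ ε' : ℝ, 10 * N * ε' = ε ^ 8 →
    ∀ M : ℕ, 3 / (4 * M) ≤ ε' → ε' ≤ 3 / (2 * M) →
    ∃ K₀ : ℝ, ∀ K : ℕ, K₀ ≤ K →
    ∀ φ : ℝ × ℝ → ℝ, HypRestr.IsHyp M φ →
    ∀ μ α R δ Cw : ℝ, 1 ≤ μ → (K : ℝ) ^ (-ε) ≤ α → α * μ ≤ (K : ℝ) ^ (-(ε / 2)) →
    α * μ ≤ 1 / 10 ^ 5 →
    1000 * Real.exp ((K : ℝ) ^ Real.exp ((1 / ε) ^ 1000)) ≤ R →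
    δ = ε ^ 2 →
    -- the caps and the functions supported in them
    ∀ 𝒯 : Finset (ℝ × ℝ), HypRestr.IsCapFamily μ K 𝒯 →
    ∀ f : ℝ × ℝ → ℝ × ℝ → ℂ,
    (∀ c ∈ 𝒯, MeasureTheory.MemLp (f c) 2 MeasureTheory.volume ∧
      Function.support (f c) ⊆ HypRestr.cap μ K c) →
    -- the tubes and the wave packets
    ∀ (Θ : Finset (ℝ × ℝ)) (𝕋 : Finset HypRestr.Tube),
    HypRestr.IsSmallCapDecomposition R Θ → HypRestr.IsTubeFamily φ R δ Θ 𝕋 →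
    ∀ F : ℝ × ℝ → HypRestr.Tube → ℝ × ℝ → ℂ,
    (∀ c ∈ 𝒯, HypRestr.IsWavePacketDecomposition φ R δ Cw Θ 𝕋 (f c) (F c)) →
    -- the polynomial, the centre of the ball and the point
    ∀ (P : MvPolynomial (Fin 3) ℝ) (b ξ : HypRestr.Space),
    ξ ∈ HypRestr.cube R → ξ ∈ HypRestr.ballJ R δ 1 b ∩ HypRestr.wall P R δ →
    HypRestr.Br φ C C' ε' μ K 𝒯 α f ξ ≤
      2 * (∑ I ∈ 𝒯.powerset,
            HypRestr.Br φ C C' ε' μ K 𝒯 ((K : ℝ) ^ (4 * N * ε') * α)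
              (HypRestr.transPart φ R δ P b 𝕋 F I) ξ
          + (K : ℝ) ^ 100 * HypRestr.Bil φ μ K 𝒯 (HypRestr.tangPart φ R δ P b 𝕋 F) ξ
          + R ^ (-900 : ℝ) * ∑ c ∈ 𝒯, HypRestr.l2norm (f c)) := by
  -- The value 16000 comes from `near_or_branch`, the factor 10 from the width of the strips in
  -- `exists_cover_of_segments`.
  refine ⟨16000, fun C hC => ⟨10 * C, fun C' hC' =>
    ⟨exists_overlapBound (by linarith) (by linarith), ?_⟩⟩⟩
  intro N hN ε hε hε1 ε' hNε M hM1 hM2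
  have hε8 : ε ^ 8 ≤ ε := pow_le_of_le_one hε.le (by linarith) (by norm_num)
  have hε8' : 0 < ε ^ 8 := by positivity
  have hN0 : 1 ≤ N := by
    rcases Nat.eq_zero_or_pos N with rfl | h
    · simp at hNε
      linarith
    · exact h
  have hN1 : (1 : ℝ) ≤ N := by exact_mod_cast hN0
  have hε' : 0 < ε' := by
    by_contra h
    push Not at h
    nlinarith
  have hε'ε : ε' ≤ ε / 10 := by nlinarith
  have hMpos : (0 : ℝ) < M := by
    -- For M = 0 the quotient 3/(2M) has the value 0, contradicting ε' > 0.
    rcases Nat.eq_zero_or_pos M with rfl | h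
    · simp at hM2
      linarith
    · exact_mod_cast h
  have hMε : 3 / 4 ≤ ε' * M := by
    rw [div_le_iff₀ (by positivity)] at hM1
    linarith
  have hM5 : 5 ≤ M := by
    have : (5 : ℝ) ≤ M := by nlinarith
    exact_mod_cast this
  obtain ⟨D, hD1, hD⟩ := exists_cover_of_not_stronglySeparated M
  set G : ℝ := (N + 1) * (158 * M) ^ N with hG
  have hG0 : 0 < G := by positivity
  -- Every requirement on K involves only D, N, M, ε and ε', so the threshold is uniform in the
  -- remaining data.
  have hev : ∀ᶠ K : ℝ in Filter.atTop, 49 ≤ K ∧ 5000 ≤ K ^ (1 / 4 : ℝ) ∧ 4 ≤ K ^ (2 * ε') ∧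
      D ≤ K ^ ε' ∧ 2 * (G + 2) ≤ K ^ (N * ε') ∧ 4 * G ≤ K ^ (ε / 5) := by
    filter_upwards [Filter.eventually_ge_atTop 49, eventually_le_rpow 5000 (by norm_num : (0 : ℝ) < 1 / 4),
      eventually_le_rpow 4 (by positivity : 0 < 2 * ε'), eventually_le_rpow D hε',
      eventually_le_rpow (2 * (G + 2)) (by positivity : 0 < N * ε'),
      eventually_le_rpow (4 * G) (by positivity : 0 < ε / 5)] with K h1 h2 h3 h4 h5 h6
    exact ⟨h1, h2, h3, h4, h5, h6⟩
  obtain ⟨K₀, hK₀⟩ := Filter.eventually_atTop.1 hev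
  refine ⟨K₀, fun K hK φ hφ μ α R δ Cw hμ hα hαμ _ hR hδ 𝒯 h𝒯 f hf Θ 𝕋 hΘ h𝕋 F hF P b ξ hξ hξ' => ?_⟩
  obtain ⟨hK49, hK4, hK2ε, hKD, hKN, hKε⟩ := hK₀ K hK
  generalize (K : ℝ) = k at *
  have hk0 : 0 < k := by linarith
  have hk1 : 1 ≤ k := by linarith
  obtain ⟨hkR, hR1000⟩ : k ≤ R ∧ 1000 ≤ R := by
    have h1 : (1 : ℝ) ≤ Real.exp ((1 / ε) ^ 1000) := Real.one_le_exp (by positivity)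
    generalize Real.exp ((1 / ε) ^ 1000) = e at *
    have h2 := Real.rpow_le_rpow_of_exponent_le hk1 h1
    rw [Real.rpow_one] at h2
    have h3 := Real.add_one_le_exp (k ^ e)
    exact ⟨by linarith only [h2, h3, hR, hk0], by linarith only [h2, h3, hR, hk0]⟩
  clear hR
  have hα0 : 0 < α := lt_of_lt_of_le (by positivity) hα
  obtain ⟨hr1, hcap, hrK⟩ := rad_bounds (by linarith) hε' hε'ε hk1 hK4 hμ hα hαμ
  have hℓ : k ^ (-(2 * ε')) ≤ 1 / 4 := by
    rw [Real.rpow_neg hk0.le, one_div]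
    exact inv_anti₀ (by norm_num) hK2ε
  have hDk := mul_rpow_pow_le hk1 hε' hMε hM5 hKD
  have hU := card_factor_le N (by omega : 1 ≤ M) hε' hk1
  rw [← hG] at hU
  refine Br_le (n := 157 * M * k ^ (3 * ε')) hφ hK49 ?_ hR1000 hkR ?_
    (fun z hz => hN φ (hφ.mono le_rfl hφ.three_le) μ k ε' hμ hk1 hε' hrK z hz)
    (hD C C' ε' μ k hC hC' hε' hμ hk1 hcap hr1 hℓ hDk φ hφ) ?_ ?_ h𝒯 (fun c hc => (hf c hc).1)
    hΘ h𝕋 hF P b ξ hξ hξ'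
  · refine le_trans ?_ hα
    rw [← Real.rpow_neg_one]
    exact Real.rpow_le_rpow_of_exponent_le hk1 (by linarith)
  · rw [hδ]
    nlinarith
  · have h1 : α ≤ k ^ (-(ε / 2)) := (le_mul_of_one_le_right hα0.le hμ).trans hαμ
    -- Since 10Nε' = ε^8 ≤ ε, the exponent 3Nε' is at most 3ε/10, which leaves K^{-ε/5} to beat the
    -- constant 4G.
    have h2 : k ^ (3 * N * ε') * k ^ (-(ε / 2)) ≤ (k ^ (ε / 5))⁻¹ := by
      rw [← Real.rpow_neg hk0.le, ← Real.rpow_add hk0]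
      refine Real.rpow_le_rpow_of_exponent_le hk1 ?_
      linarith
    calc ((N : ℝ) + 1) * (157 * M * k ^ (3 * ε') + 1) ^ N * α
        ≤ G * k ^ (3 * N * ε') * k ^ (-(ε / 2)) := by gcongr
      _ = G * (k ^ (3 * N * ε') * k ^ (-(ε / 2))) := by ring
      _ ≤ G * (k ^ (ε / 5))⁻¹ := by gcongr
      _ ≤ 1 / 4 := by
        rw [mul_inv_le_iff₀ (by positivity)]
        linarith
  -- Of the exponent 4Nε', the part 3Nε' is the size of the inclusion-exclusion and the remaining
  -- Nε' absorbs the constants.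
  · have e : k ^ (4 * N * ε') = k ^ (N * ε') * k ^ (3 * N * ε') := by
      rw [← Real.rpow_add hk0]
      ring_nf
    have h1 : 1 ≤ k ^ (3 * N * ε') := Real.one_le_rpow hk1 (by positivity)
    rw [e]
    calc 2 * (((N : ℝ) + 1) * (157 * M * k ^ (3 * ε') + 1) ^ N + 2)
        ≤ 2 * (G * k ^ (3 * N * ε') + 2 * k ^ (3 * N * ε')) := by linarith
      _ = 2 * (G + 2) * k ^ (3 * N * ε') := by ring
      _ ≤ k ^ (N * ε') * k ^ (3 * N * ε') := by gcongr
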